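/- Let $n\ge 1$ and let $(\mathcal C,\mathbb E,\mathfrak s)$ be an $n$-exangulated category in the sense of Herschend–Liu–Nakaoka: $\mathcal C$ is an additive category, $\mathbb E\colon\mathcal C^{\mathrm{op}}\times\mathcal C\to\mathrm{Ab}$ is an additive bifunctor, and $\mathfrak s$ is an exact realization of $\mathbb E$, assigning to each $\delta\in\mathbb E(C,A)$ a homotopy class $[A\to X_1\to\cdots\to X_n\to C]$ of complexes with fixed end terms, such that the axioms (EA1), (EA2), (EA2$^{\mathrm{op}}$) hold. A pair $\langle X_\bullet,\delta\rangle$ with $\mathfrak s(\delta)=[X_\bullet]$ is called a distinguished $n$-exangle and is written $X_0\to X_1\to\cdots\to X_n\to X_{n+1}\dashrightarrow$. An object $P$ is projective if for each distinguished $n$-exangle every morphism $P\to X_{n+1}$ factors through $X_n\to X_{n+1}$; injective objects are defined dually. $\mathcal C$ has enough projectives if for each object $C$ there is a distinguished $n$-exangle $B\to P_1\to\cdots\to P_n\to C\dashrightarrow$ with all $P_i$ projective; having enough injectives is defined dually. For a subcategory $\mathcal A$ of $\mathcal C$, let $\Omega\mathcal A$ consist of the objects $B$ for which there is a distinguished $n$-exangle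 $B\to P_1\to\cdots\to P_n\to A\dashrightarrow$ with all $P_i$ projective and $A\in\mathcal A$, and let $\Sigma\mathcal A$ consist of the objects $D$ for which there is a distinguished $n$-exangle $A\to I_1\to\cdots\to I_n\to D\dashrightarrow$ with all $I_i$ injective and $A\in\mathcal A$. Suppose that $\mathcal C$ is Krull–Schmidt (each object is a finite direct sum of objects with local endomorphism rings) and has enough projectives and enough injectives. Let $\mathcal A\subseteq\mathcal C$ be a full subcategory closed under isomorphisms, finite direct sums (including the zero object) and direct summands, which is $n$-extension closed: for all $A,C\in\mathcal A$ and $\delta\in\mathbb E(C,A)$ there is a distinguished $n$-exangle $\langle X_\bullet,\delta\rangle$ with $X_1,\dots,X_n\in\mathcal A$. For such $\delta$ and $X_\bullet$ put $\mathfrak t(\delta)=[X_\bullet]$, the homotopy class being taken among the complexes in $\mathcal A$ with fixed end terms $A$ and $C$. Let $\mathscr E_{\mathcal A}$ be the class of all $\mathfrak t$-conflations, i.e. of all complexes $X_0\to X_1\to\cdots\to X_{n+1}$ in $\mathcal A$ that belong to $\mathfrak t(\delta)$ for some $\delta\in\mathbb E(X_{n+1},X_0)$. If $\mathcal C(\Sigma\mathcal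 A,\mathcal A)=0$ and $\mathcal C(\mathcal A,\Omega\mathcal A)=0$, then $(\mathcal A,\mathscr E_{\mathcal A})$ is an $n$-exact category in the sense of Jasso; that is, $\mathcal A$ is additive and $\mathscr E_{\mathcal A}$ is a class of $n$-exact sequences in $\mathcal A$, closed under weak isomorphisms of $n$-exact sequences, which satisfies Jasso's axioms (E0), (E1), (E1$^{\mathrm{op}}$), (E2) and (E2$^{\mathrm{op}}$). -/

import Mathlib

open CategoryTheory CategoryTheory.Limits

universe w v u

namespace NExang

section

attribute [local instance] hasBinaryBiproducts_of_finite_biproducts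

/-! ### Complexes with `n + 2` terms, mapping cones, `n`-exact categories -/

section Complexes

variable {C : Type u} [Category.{v} C] [Preadditive C]

/-- The complex `K` is concentrated in the degrees `0, …, m`. -/
def ConcentratedLE (m : ℕ) (K : CochainComplex C ℕ) : Prop :=
  ∀ i, m < i → IsZero (K.X i)

/-- Let `f` be a morphism between the sequences `U₀ ⟶ ⋯ ⟶ Uₙ` and `V₀ ⟶ ⋯ ⟶ Vₙ` (`f` is given as
a morphism of complexes `U ⟶ V`, but only the degrees `0, …, n` are used).  For `ε = 1`, a term of
`MappingCone n 1 f K` exhibits `K` as the mapping cone of `f`, that is, as the `(n+2)`-term complex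
`U₀ ⟶ U₁ ⊞ V₀ ⟶ U₂ ⊞ V₁ ⟶ ⋯ ⟶ Uₙ ⊞ Vₙ₋₁ ⟶ Vₙ`
whose first, middle and last differentials are the matrices
`[-d; f]`, `[[-d, 0], [f, d]]`, `[f, d]`.
For `ε = -1` one gets the mapping cocone, which is the notion dual to the mapping cone (the mapping
cone of the opposite morphism in the opposite category): here the differentials are
`[d; f]`, `[[d, 0], [f, -d]]`, `[f, -d]`. -/
structure MappingCone [HasFiniteBiproducts C] (n : ℕ) (ε : ℤˣ) {U V : CochainComplex C ℕ}
    (f : U ⟶ V) (K : CochainComplex C ℕ) where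
  concentrated : ConcentratedLE (n + 1) K
  isoFirst : K.X 0 ≅ U.X 0
  isoMid : ∀ i, i < n → (K.X (i + 1) ≅ U.X (i + 1) ⊞ V.X i)
  isoLast : K.X (n + 1) ≅ V.X n
  d_first : ∀ h : 0 < n,
    K.d 0 1 ≫ (isoMid 0 h).hom = isoFirst.hom ≫ biprod.lift (-(ε • U.d 0 1)) (f.f 0)
  d_mid : ∀ (i : ℕ) (h : i + 1 < n),
    K.d (i + 1) (i + 2) ≫ (isoMid (i + 1) h).hom =
      (isoMid i (Nat.lt_of_succ_lt h)).hom ≫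
        biprod.desc (biprod.lift (-(ε • U.d (i + 1) (i + 2))) (f.f (i + 1)))
          (biprod.lift 0 (ε • V.d i (i + 1)))
  d_last : ∀ (i : ℕ) (h : i + 1 = n),
    K.d (i + 1) (n + 1) ≫ isoLast.hom =
      (isoMid i (Nat.lt_of_succ_le h.le)).hom ≫
        biprod.desc (f.f (i + 1) ≫ (V.XIsoOfEq h).hom) (ε • V.d i n)

/-- `K₁ ⟶ ⋯ ⟶ Kₙ₊₁` is an `n`-cokernel of `K₀ ⟶ K₁`: for each object `Y` the sequence
`0 ⟶ Hom(Kₙ₊₁, Y) ⟶ ⋯ ⟶ Hom(K₁, Y) ⟶ Hom(K₀, Y)` is exact. -/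
def IsNCokernel (n : ℕ) (K : CochainComplex C ℕ) : Prop :=
  (∀ (Y : C) (g : K.X (n + 1) ⟶ Y), K.d n (n + 1) ≫ g = 0 → g = 0) ∧
  ∀ i, i < n → ∀ (Y : C) (g : K.X (i + 1) ⟶ Y), K.d i (i + 1) ≫ g = 0 →
    ∃ h : K.X (i + 2) ⟶ Y, K.d (i + 1) (i + 2) ≫ h = g

/-- `K₀ ⟶ ⋯ ⟶ Kₙ` is an `n`-kernel of `Kₙ ⟶ Kₙ₊₁`: for each object `Y` the sequence
`0 ⟶ Hom(Y, K₀) ⟶ ⋯ ⟶ Hom(Y, Kₙ) ⟶ Hom(Y, Kₙ₊₁)` is exact. -/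
def IsNKernel (n : ℕ) (K : CochainComplex C ℕ) : Prop :=
  (∀ (Y : C) (g : Y ⟶ K.X 0), g ≫ K.d 0 1 = 0 → g = 0) ∧
  ∀ i, i < n → ∀ (Y : C) (g : Y ⟶ K.X (i + 1)), g ≫ K.d (i + 1) (i + 2) = 0 →
    ∃ h : Y ⟶ K.X i, h ≫ K.d i (i + 1) = g

/-- `n`-exact sequences `K₀ ⟶ K₁ ⟶ ⋯ ⟶ Kₙ₊₁`. -/
def IsNExactSeq (n : ℕ) (K : CochainComplex C ℕ) : Prop :=
  ConcentratedLE (n + 1) K ∧ IsNKernel n K ∧ IsNCokernel n K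

/-- A weak isomorphism: `fₖ` and `fₖ₊₁` are isomorphisms for some `k ∈ {0, …, n+1}`, where the
index `n + 2` is read as `0`. -/
def IsWeakIso (n : ℕ) {K L : CochainComplex C ℕ} (f : K ⟶ L) : Prop :=
  (∃ k, k ≤ n ∧ IsIso (f.f k) ∧ IsIso (f.f (k + 1))) ∨ (IsIso (f.f (n + 1)) ∧ IsIso (f.f 0))

/-- Admissible monomorphisms of a class `S` of sequences (up to isomorphism of arrows). -/
def AdmissibleMono (S : Set (CochainComplex C ℕ)) {A B : C} (f : A ⟶ B) : Prop :=
  ∃ K ∈ S, Nonempty (Arrow.mk (K.d 0 1) ≅ Arrow.mk f)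

/-- Admissible epimorphisms of a class `S` of `(n+2)`-term sequences (up to isomorphism of
arrows). -/
def AdmissibleEpi (n : ℕ) (S : Set (CochainComplex C ℕ)) {A B : C} (f : A ⟶ B) : Prop :=
  ∃ K ∈ S, Nonempty (Arrow.mk (K.d n (n + 1)) ≅ Arrow.mk f)

/-- `(C, S)` is an `n`-exact category in the sense of Jasso: `C` is an additive category and `S` is
a class of `n`-exact sequences in `C`, closed under weak isomorphisms, satisfying (E0), (E1),
(E1ᵒᵖ), (E2) and (E2ᵒᵖ). -/
structure IsNExactCategory (n : ℕ) (C : Type u) [Category.{v} C] [Preadditive C]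
    (S : Set (CochainComplex C ℕ)) : Prop where
  [hasFiniteBiproducts : HasFiniteBiproducts C]
  exact : ∀ K ∈ S, IsNExactSeq n K
  closed : ∀ (K L : CochainComplex C ℕ) (f : K ⟶ L), IsNExactSeq n K → IsNExactSeq n L →
    IsWeakIso n f → (K ∈ S ↔ L ∈ S)
  /-- (E0) -/
  zero_mem : ∀ K : CochainComplex C ℕ, (∀ i, IsZero (K.X i)) → K ∈ S
  /-- (E1) -/
  comp_mono : ∀ {A B D : C} (f : A ⟶ B) (g : B ⟶ D),
    AdmissibleMono S f → AdmissibleMono S g → AdmissibleMono S (f ≫ g)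
  /-- (E1ᵒᵖ) -/
  comp_epi : ∀ {A B D : C} (f : A ⟶ B) (g : B ⟶ D),
    AdmissibleEpi n S f → AdmissibleEpi n S g → AdmissibleEpi n S (f ≫ g)
  /-- (E2): each morphism `φ : X₀ ⟶ W` from the first term of a member of `S` admits an `n`-pushout
  diagram from `X₀ ⟶ ⋯ ⟶ Xₙ` to a sequence `Y₀ ⟶ ⋯ ⟶ Yₙ` with `Y₀ = W`, whose first morphism is an
  admissible monomorphism.  (As `Y` vanishes in degree `n + 1`, a morphism of complexes `X ⟶ Y` is
  the same thing as a morphism from the sequence `X₀ ⟶ ⋯ ⟶ Xₙ` to `Y`.) -/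
  pushout : ∀ X ∈ S, ∀ (W : C) (φ : X.X 0 ⟶ W),
    ∃ (Y : CochainComplex C ℕ) (f : X ⟶ Y) (e : Y.X 0 ≅ W) (K : CochainComplex C ℕ),
      ConcentratedLE n Y ∧ f.f 0 ≫ e.hom = φ ∧
      Nonempty (MappingCone n 1 f K) ∧ IsNCokernel n K ∧ AdmissibleMono S (Y.d 0 1)
  /-- (E2ᵒᵖ): each morphism `φ : W ⟶ Xₙ₊₁` to the last term of a member of `S` admits an `n`-pullback
  diagram to `X₁ ⟶ ⋯ ⟶ Xₙ₊₁` from a sequence `Y₀ ⟶ ⋯ ⟶ Yₙ` with `Yₙ = W`, whose last morphism is an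
  admissible epimorphism. -/
  pullback : ∀ X ∈ S, ∀ (W : C) (φ : W ⟶ X.X (n + 1)),
    ∃ (Y : CochainComplex C ℕ) (f : Y ⟶ CochainComplex.truncate.obj X) (e : Y.X n ≅ W)
      (K : CochainComplex C ℕ),
      ConcentratedLE n Y ∧ f.f n = e.hom ≫ φ ∧
      Nonempty (MappingCone n 1 f K) ∧ IsNKernel n K ∧
      ∀ i, i + 1 = n → AdmissibleEpi n S (Y.d i n)

/-- Objects of `C^{n+2}_{(C;A,B)}`: complexes `K₀ ⟶ ⋯ ⟶ Kₙ₊₁` whose end terms are (identified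
with) `A` and `B`. -/
structure EndedComplex (n : ℕ) (A B : C) where
  K : CochainComplex C ℕ
  concentrated : ConcentratedLE (n + 1) K
  left : K.X 0 ≅ A
  right : K.X (n + 1) ≅ B

namespace EndedComplex

variable {n : ℕ}

/-- A morphism of complexes which is the pair `(a, b)` on the end terms. -/
def IsOver {A B A' B' : C} (X : EndedComplex n A B) (Y : EndedComplex n A' B')
    (a : A ⟶ A') (b : B ⟶ B') (f : X.K ⟶ Y.K) : Prop :=
  f.f 0 ≫ Y.left.hom = X.left.hom ≫ a ∧ f.f (n + 1) ≫ Y.right.hom = X.right.hom ≫ b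

/-- Homotopy equivalence in `C^{n+2}_{(C;A,B)}`, by morphisms which are the identity of `A` and of
`B` on the end terms. -/
def HtpyEquiv {A B : C} (X Y : EndedComplex n A B) : Prop :=
  ∃ (f : X.K ⟶ Y.K) (g : Y.K ⟶ X.K),
    IsOver X Y (𝟙 A) (𝟙 B) f ∧ IsOver Y X (𝟙 A) (𝟙 B) g ∧
    Nonempty (Homotopy (f ≫ g) (𝟙 X.K)) ∧ Nonempty (Homotopy (g ≫ f) (𝟙 Y.K))

instance htpySetoid (n : ℕ) (A B : C) : Setoid (EndedComplex n A B) where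
  r := HtpyEquiv
  iseqv :=
    { refl := fun X => ⟨𝟙 _, 𝟙 _, by simp [IsOver], by simp [IsOver],
        ⟨Homotopy.ofEq (by simp)⟩, ⟨Homotopy.ofEq (by simp)⟩⟩
      symm := fun ⟨f, g, hf, hg, h₁, h₂⟩ => ⟨g, f, hg, hf, h₂, h₁⟩
      trans := by
        rintro X Y Z ⟨f, g, hf, hg, ⟨h₁⟩, ⟨h₂⟩⟩ ⟨f', g', hf', hg', ⟨h₁'⟩, ⟨h₂'⟩⟩
        simp only [IsOver, Category.comp_id] at hf hg hf' hg'
        refine ⟨f ≫ f', g' ≫ g, ?_, ?_, ⟨?_⟩, ⟨?_⟩⟩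
        · simp [IsOver, hf, hf']
        · simp [IsOver, hg, hg']
        · refine (Homotopy.ofEq ?_).trans ((((h₁'.compLeft f).compRight g)).trans
            ((Homotopy.ofEq ?_).trans h₁)) <;> simp
        · refine (Homotopy.ofEq ?_).trans ((((h₂.compLeft g').compRight f')).trans
            ((Homotopy.ofEq ?_).trans h₂')) <;> simp }

/-- The image under the inclusion functor of a complex in a full subcategory. -/
def incl (P : ObjectProperty C) {A B : P.FullSubcategory} (X : EndedComplex n A B) :
    EndedComplex n A.obj B.obj where
  K := (P.ι.mapHomologicalComplex _).obj X.K
  concentrated := fun i hi => P.ι.map_isZero (X.concentrated i hi)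
  left := P.ι.mapIso X.left
  right := P.ι.mapIso X.right

end EndedComplex

/-- Krull–Schmidt categories: each object is a finite direct sum of objects with local endomorphism
rings. -/
def IsKrullSchmidt (C : Type u) [Category.{v} C] [Preadditive C] [HasFiniteBiproducts C] : Prop :=
  ∀ X : C, ∃ (m : ℕ) (Y : Fin m → C), (∀ i, IsLocalRing (End (Y i))) ∧ Nonempty (X ≅ ⨁ Y)

/-- The standing assumption on subcategories: they are full (automatic for an `ObjectProperty`),
closed under isomorphisms, finite direct sums and direct summands. -/
structure IsAdditiveSubcategory [HasFiniteBiproducts C] (P : ObjectProperty C) : Prop where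
  of_iso : ∀ {X Y : C}, (X ≅ Y) → P X → P Y
  zero : ∀ Z : C, IsZero Z → P Z
  sum : ∀ X Y : C, P X → P Y → P (X ⊞ Y)
  summand : ∀ X Y : C, P (X ⊞ Y) → P X

end Complexes

/-! ### `n`-exangulated categories -/

section Exangulated

variable {C : Type u} [Category.{v} C] [Preadditive C]

/-- The group `E(Z, A)` of extensions. -/
abbrev Ext (E : Cᵒᵖ ⥤ C ⥤ AddCommGrpCat.{w}) (Z A : C) : Type w :=
  ((E.obj (Opposite.op Z)).obj A : AddCommGrpCat.{w})

/-- `a_* δ`. -/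
def push (E : Cᵒᵖ ⥤ C ⥤ AddCommGrpCat.{w}) {Z A A' : C} (a : A ⟶ A') (δ : Ext E Z A) :
    Ext E Z A' :=
  ((E.obj (Opposite.op Z)).map a).hom δ

/-- `c^* δ`. -/
def pull (E : Cᵒᵖ ⥤ C ⥤ AddCommGrpCat.{w}) {Z Z' A : C} (c : Z' ⟶ Z) (δ : Ext E Z A) :
    Ext E Z' A :=
  ((E.map c.op).app A).hom δ

/-- The pair `⟨X, δ⟩` is an `n`-exangle: it is an `E`-attached complex and the two long sequences
`Hom(-, X₀) ⟶ ⋯ ⟶ Hom(-, Xₙ₊₁) ⟶ E(-, X₀)` and `Hom(Xₙ₊₁, -) ⟶ ⋯ ⟶ Hom(X₀, -) ⟶ E(Xₙ₊₁, -)`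
are exact. -/
structure IsNExangle (E : Cᵒᵖ ⥤ C ⥤ AddCommGrpCat.{w}) {n : ℕ} {A Z : C} (X : EndedComplex n A Z)
    (δ : Ext E Z A) : Prop where
  push_d : push E (X.left.inv ≫ X.K.d 0 1) δ = 0
  pull_d : pull E (X.K.d n (n + 1) ≫ X.right.hom) δ = 0
  exact_to : ∀ i, i < n → ∀ (W : C) (g : W ⟶ X.K.X (i + 1)), g ≫ X.K.d (i + 1) (i + 2) = 0 →
    ∃ h : W ⟶ X.K.X i, h ≫ X.K.d i (i + 1) = g
  exact_to_last : ∀ (W : C) (g : W ⟶ Z), pull E g δ = 0 →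
    ∃ h : W ⟶ X.K.X n, h ≫ X.K.d n (n + 1) ≫ X.right.hom = g
  exact_from : ∀ i, i < n → ∀ (W : C) (g : X.K.X (i + 1) ⟶ W), X.K.d i (i + 1) ≫ g = 0 →
    ∃ h : X.K.X (i + 2) ⟶ W, X.K.d (i + 1) (i + 2) ≫ h = g
  exact_from_first : ∀ (W : C) (g : A ⟶ W), push E g δ = 0 →
    ∃ h : X.K.X 1 ⟶ W, (X.left.inv ≫ X.K.d 0 1) ≫ h = g

/-- An assignment of a homotopy class of complexes to each extension. -/
abbrev Correspondence (n : ℕ) (E : Cᵒᵖ ⥤ C ⥤ AddCommGrpCat.{w}) :=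
  ∀ {Z A : C}, Ext E Z A → Quotient (EndedComplex.htpySetoid n A Z)

/-- The pair `⟨X, δ⟩` is distinguished, i.e. `s δ = [X]`. -/
def Realizes {n : ℕ} {E : Cᵒᵖ ⥤ C ⥤ AddCommGrpCat.{w}} (s : Correspondence n E) {Z A : C}
    (δ : Ext E Z A) (X : EndedComplex n A Z) : Prop :=
  s δ = Quotient.mk _ X

/-- `f` is an inflation: up to isomorphism of arrows, the first morphism of a conflation. -/
def IsInflation {n : ℕ} {E : Cᵒᵖ ⥤ C ⥤ AddCommGrpCat.{w}} (s : Correspondence n E) {A B : C}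
    (f : A ⟶ B) : Prop :=
  ∃ (Z A' : C) (δ : Ext E Z A') (X : EndedComplex n A' Z), Realizes s δ X ∧
    Nonempty (Arrow.mk (X.K.d 0 1) ≅ Arrow.mk f)

/-- `f` is a deflation: up to isomorphism of arrows, the last morphism of a conflation. -/
def IsDeflation {n : ℕ} {E : Cᵒᵖ ⥤ C ⥤ AddCommGrpCat.{w}} (s : Correspondence n E) {A B : C}
    (f : A ⟶ B) : Prop :=
  ∃ (Z A' : C) (δ : Ext E Z A') (X : EndedComplex n A' Z), Realizes s δ X ∧
    Nonempty (Arrow.mk (X.K.d n (n + 1)) ≅ Arrow.mk f)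

end Exangulated

/-- An `n`-exangulated structure `(E, s)` on the additive category `C`, in the sense of Herschend,
Liu and Nakaoka. -/
structure NExangulated (n : ℕ) (C : Type u) [Category.{v} C] [Preadditive C]
    [HasFiniteBiproducts C] where
  E : Cᵒᵖ ⥤ C ⥤ AddCommGrpCat.{w}
  additive_right : ∀ Z : C, (E.obj (Opposite.op Z)).Additive
  additive_left : ∀ A : C, (E.flip.obj A).Additive
  s : Correspondence n E
  /-- (R0) -/
  lift : ∀ {Z A Z' A' : C} (δ : Ext E Z A) (ρ : Ext E Z' A') (a : A ⟶ A') (c : Z ⟶ Z'),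
    push E a δ = pull E c ρ → ∀ (X : EndedComplex n A Z) (Y : EndedComplex n A' Z'),
      Realizes s δ X → Realizes s ρ Y → ∃ f : X.K ⟶ Y.K, EndedComplex.IsOver X Y a c f
  /-- (R1) -/
  exangle : ∀ {Z A : C} (δ : Ext E Z A) (X : EndedComplex n A Z), Realizes s δ X → IsNExangle E X δ
  /-- (R2): the extension `0 ∈ E(0, A)` is realized by `A = A ⟶ 0 ⟶ ⋯ ⟶ 0`. -/
  zero_left : ∀ (A Z : C), IsZero Z → ∀ X : EndedComplex n A Z, IsIso (X.K.d 0 1) →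
    (∀ i, 2 ≤ i → IsZero (X.K.X i)) → Realizes s (0 : Ext E Z A) X
  /-- (R2), dual part: the extension `0 ∈ E(A, 0)` is realized by `0 ⟶ ⋯ ⟶ 0 ⟶ A = A`. -/
  zero_right : ∀ (A Z : C), IsZero Z → ∀ X : EndedComplex n Z A, IsIso (X.K.d n (n + 1)) →
    (∀ i, i < n → IsZero (X.K.X i)) → Realizes s (0 : Ext E A Z) X
  /-- (EA1) -/
  comp_inflation : ∀ {A B D : C} (f : A ⟶ B) (g : B ⟶ D),
    IsInflation s f → IsInflation s g → IsInflation s (f ≫ g)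
  /-- (EA1), dual part -/
  comp_deflation : ∀ {A B D : C} (f : A ⟶ B) (g : B ⟶ D),
    IsDeflation s f → IsDeflation s g → IsDeflation s (f ≫ g)
  /-- (EA2): `(𝟙 A, c)` has a lift `f : X ⟶ Y` whose mapping cone
  `X₁ ⟶ X₂ ⊞ Y₁ ⟶ ⋯ ⟶ Xₙ₊₁ ⊞ Yₙ ⟶ Yₙ₊₁` realizes `(d₀)_* ρ`. -/
  good_lift : ∀ {A Z Z' : C} (ρ : Ext E Z' A) (c : Z ⟶ Z') (X : EndedComplex n A Z)
    (Y : EndedComplex n A Z'), Realizes s (pull E c ρ) X → Realizes s ρ Y →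
    ∃ (f : X.K ⟶ Y.K) (M : EndedComplex n (X.K.X 1) Z')
      (m : MappingCone n 1 (CochainComplex.truncate.map f) M.K),
      EndedComplex.IsOver X Y (𝟙 A) c f ∧
      M.left = m.isoFirst ∧ M.right = m.isoLast ≪≫ Y.right ∧
      Realizes s (push E (X.left.inv ≫ X.K.d 0 1) ρ) M
  /-- (EA2ᵒᵖ): `(a, 𝟙 Z)` has a lift `f : X ⟶ Y` whose mapping cocone
  `X₀ ⟶ X₁ ⊞ Y₀ ⟶ ⋯ ⟶ Xₙ ⊞ Yₙ₋₁ ⟶ Yₙ` realizes `(dₙ)^* ρ`. -/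
  good_lift_op : ∀ {A A' Z : C} (ρ : Ext E Z A) (a : A ⟶ A') (X : EndedComplex n A Z)
    (Y : EndedComplex n A' Z), Realizes s ρ X → Realizes s (push E a ρ) Y →
    ∃ (f : X.K ⟶ Y.K) (M : EndedComplex n A (Y.K.X n)) (m : MappingCone n (-1) f M.K),
      EndedComplex.IsOver X Y a (𝟙 Z) f ∧
      M.left = m.isoFirst ≪≫ X.left ∧ M.right = m.isoLast ∧
      Realizes s (pull E (Y.K.d n (n + 1) ≫ Y.right.hom) ρ) M

namespace NExangulated

variable {n : ℕ} {C : Type u} [Category.{v} C] [Preadditive C] [HasFiniteBiproducts C]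
  (S : NExangulated.{w} n C)

/-- Projective objects. -/
def IsProjective (Q : C) : Prop :=
  ∀ {Z A : C} (δ : Ext S.E Z A) (X : EndedComplex n A Z), Realizes S.s δ X →
    ∀ c : Q ⟶ X.K.X (n + 1), ∃ b : Q ⟶ X.K.X n, b ≫ X.K.d n (n + 1) = c

/-- Injective objects. -/
def IsInjective (J : C) : Prop :=
  ∀ {Z A : C} (δ : Ext S.E Z A) (X : EndedComplex n A Z), Realizes S.s δ X →
    ∀ c : X.K.X 0 ⟶ J, ∃ b : X.K.X 1 ⟶ J, X.K.d 0 1 ≫ b = c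

/-- There is a distinguished `n`-exangle `A ⟶ X₁ ⟶ ⋯ ⟶ Xₙ ⟶ Z ⇢` with `X₁, …, Xₙ` in `Q`. -/
def HasExangle (Q : ObjectProperty C) (A Z : C) : Prop :=
  ∃ (δ : Ext S.E Z A) (X : EndedComplex n A Z), Realizes S.s δ X ∧
    ∀ i, 1 ≤ i → i ≤ n → Q (X.K.X i)

/-- Each object `Z` is the last term of a distinguished `n`-exangle with projective middle terms. -/
def EnoughProjectives : Prop :=
  ∀ Z : C, ∃ A : C, S.HasExangle (fun Q => S.IsProjective Q) A Z

/-- Each object `A` is the first term of a distinguished `n`-exangle with injective middle terms. -/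
def EnoughInjectives : Prop :=
  ∀ A : C, ∃ Z : C, S.HasExangle (fun J => S.IsInjective J) A Z

/-- `CoCone(P', P'')`. -/
def CoCone (P' P'' : ObjectProperty C) : ObjectProperty C :=
  fun A => ∃ Z : C, P'' Z ∧ S.HasExangle P' A Z

/-- `Cone(P', P'')`. -/
def Cone (P' P'' : ObjectProperty C) : ObjectProperty C :=
  fun Z => ∃ A : C, P' A ∧ S.HasExangle P'' A Z

/-- `Ω P = CoCone(projectives, P)`. -/
def Omega (P : ObjectProperty C) : ObjectProperty C :=
  S.CoCone (fun Q => S.IsProjective Q) P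

/-- `Σ P = Cone(P, injectives)`. -/
def Sigma (P : ObjectProperty C) : ObjectProperty C :=
  S.Cone P (fun J => S.IsInjective J)

/-- `P` is `n`-extension closed. -/
def IsExtensionClosed (P : ObjectProperty C) : Prop :=
  ∀ (Z A : C), P Z → P A → ∀ δ : Ext S.E Z A, ∃ X : EndedComplex n A Z, Realizes S.s δ X ∧
    ∀ i, 1 ≤ i → i ≤ n → P (X.K.X i)

/-- The complex `X` in the full subcategory `P` belongs to `t(δ)`: it is homotopy equivalent, in
the category of complexes in `P` with fixed end terms, to a complex `Y` in `P` such that `⟨Y, δ⟩` is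
distinguished for `s`. -/
def TRealizes (P : ObjectProperty C) {Z A : P.FullSubcategory} (δ : Ext S.E Z.obj A.obj)
    (X : EndedComplex n A Z) : Prop :=
  ∃ Y : EndedComplex n A Z, Realizes S.s δ (Y.incl P) ∧ EndedComplex.HtpyEquiv X Y

/-- The class of all `t`-conflations: the complexes in `P` realizing an extension of objects of
`P`. -/
def TConflations (P : ObjectProperty C) : Set (CochainComplex P.FullSubcategory ℕ) :=
  {K | ∃ (Z A : P.FullSubcategory) (δ : Ext S.E Z.obj A.obj) (X : EndedComplex n A Z),
    X.K = K ∧ S.TRealizes P δ X}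

end NExangulated

end

end NExang

/-! Conflations in the subcategory are `n`-exact. Exactness of the Hom sequences at the inner terms
is part of being an `n`-exangle; what is missing is that the first morphism is monic and the last
one epic with respect to objects of `P`. Given `δ ∈ E(Z, A)`, take an exangle `B ⟶ P₁ ⟶ ⋯ ⟶ Pₙ ⟶ Z`
with projective middle terms. Since `E(Pₙ, A) = 0`, `δ` is a pushforward along some `B ⟶ A`, and the
mapping cocone of a good lift is a conflation starting with `B ⟶ P₁ ⊞ A`. A morphism `W ⟶ A` killed
by `A ⟶ X₁` therefore factors through `B ∈ Ω P`, so it vanishes for `W` in `P`. The last morphism is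
treated dually with `Σ P` (`eq_zero_of_comp_d`, `eq_zero_of_d_comp`, `isGood`).

Between `n`-exact sequences a commutative square extends to a chain map, and a chain map vanishing
in one degree is null-homotopic (`exists_chainMap`, `isNull_of_degree`). Hence an `n`-exact sequence
with chain maps to and from a conflation which are mutually inverse in a single degree is itself a
conflation, for a suitably transported extension (`IsGood.exists_realizes_of_equiv`). This is the
main criterion for membership. It gives closure under weak isomorphisms once an inverse has been
found, which for isomorphisms at the two outer ends needs an argument with extensions
(`IsGood.exists_inverse_of_ends`).

Pushouts and pullbacks come from (EA2): the mapping cone of a good lift realizes an extension of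
objects of `P`, and its terms are sums of objects of `P`, so it is `n`-exact.

Compositions are the delicate point, because the conflation that (EA1) supplies for a composite of
inflations may leave `P`. Two constructions are compared. Splicing gives an `n`-exact sequence in
`P` beginning with the composite (`exists_splice`), not yet known to be a conflation. On the other
hand, the extension `θ` of the ambient conflation and a certain extension `δ'` of objects of `P` are
pullbacks of each other (`exists_comp_inflation`). A conflation in `P` realizing `δ'` therefore maps
to and from the spliced sequence over the identity of the first term, and the membership criterion
applies. Deflations are dual. -/

namespace NExang
section
attribute [local instance] hasBinaryBiproducts_of_finite_biproducts

/-! ### Families determined step by step -/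

/-- A family of elements, consecutive ones of which are related, is built from two consecutive
members by extending it in both directions. -/
theorem exists_family {T : ℕ → Type*} [∀ i, Nonempty (T i)]
    (R : ∀ i, T i → T (i + 1) → Prop) (k : ℕ) (x : T k) (y : T (k + 1)) (hxy : R k x y)
    (right : ∀ i, k ≤ i → ∀ a b, R i a b → ∃ c, R (i + 1) b c)
    (left : ∀ i, i < k → ∀ b c, R (i + 1) b c → ∃ a, R i a b) (N : ℕ) :
    ∃ f : ∀ i, T i, f k = x ∧ f (k + 1) = y ∧ ∀ i, i < N → R i (f i) (f (i + 1)) := by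
  classical
  -- Only finitely many members matter, so induction on the length of the range suffices; each step
  -- overwrites one value of an arbitrary family.
  have h₁ : ∀ m, ∃ f : ∀ i, T i, f k = x ∧ f (k + 1) = y ∧
      ∀ i, k ≤ i → i ≤ k + m → R i (f i) (f (i + 1)) := by
    intro m
    induction m with
    | zero =>
      refine ⟨Function.update (Function.update (fun i => Classical.arbitrary _) k x) (k + 1) y,
        ?_, ?_, ?_⟩
      · simp
      · simp
      · intro i h h'
        obtain rfl : i = k := by omega
        simpa using hxy
    | succ m ih =>
      obtain ⟨f, hx, hy, hf⟩ := ih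
      obtain ⟨c, hc⟩ := right (k + m) (by omega) _ _ (hf (k + m) (by omega) le_rfl)
      refine ⟨Function.update f (k + m + 2) c, ?_, ?_, ?_⟩
      · rw [Function.update_of_ne (by omega), hx]
      · rw [Function.update_of_ne (by omega), hy]
      · intro i h h'
        obtain rfl | h'' : i = k + m + 1 ∨ i ≤ k + m := by omega
        · rw [Function.update_of_ne (by omega), Function.update_self]
          exact hc
        · rw [Function.update_of_ne (by omega), Function.update_of_ne (by omega)]
          exact hf i h h''
  have h₂ : ∀ m, m ≤ k → ∃ f : ∀ i, T i, f k = x ∧ f (k + 1) = y ∧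
      ∀ i, k ≤ i + m → i ≤ k + N → R i (f i) (f (i + 1)) := by
    intro m
    induction m with
    | zero =>
      intro _
      obtain ⟨f, hx, hy, hf⟩ := h₁ N
      exact ⟨f, hx, hy, fun i h h' => hf i h h'⟩
    | succ m ih =>
      intro hm
      obtain ⟨f, hx, hy, hf⟩ := ih (by omega)
      obtain ⟨j, rfl⟩ : ∃ j, k = j + (m + 1) := ⟨k - (m + 1), by omega⟩
      obtain ⟨a, ha⟩ := left j (by omega) _ _ (hf (j + 1) (by omega) (by omega))
      refine ⟨Function.update f j a, ?_, ?_, ?_⟩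
      · rw [Function.update_of_ne (by omega), hx]
      · rw [Function.update_of_ne (by omega), hy]
      · intro i h h'
        obtain rfl | h'' : i = j ∨ j + 1 ≤ i := by omega
        · rw [Function.update_self, Function.update_of_ne (by omega)]
          exact ha
        · rw [Function.update_of_ne (by omega), Function.update_of_ne (by omega)]
          exact hf i (by omega) h'
  obtain ⟨f, hx, hy, hf⟩ := h₂ k le_rfl
  exact ⟨f, hx, hy, fun i h => hf i (by omega) (by omega)⟩

/-! ### Chain maps and null-homotopies between `n`-exact sequences -/

section Complexes

variable {C : Type u} [Category.{v} C] [Preadditive C] {n : ℕ}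

/-- In all degrees `i + 1` the sequences `Hom(K, Y)` are exact. -/
def RightExact (K : CochainComplex C ℕ) : Prop :=
  ∀ i (Y : C) (g : K.X (i + 1) ⟶ Y), K.d i (i + 1) ≫ g = 0 →
    ∃ h : K.X (i + 2) ⟶ Y, K.d (i + 1) (i + 2) ≫ h = g

/-- In all degrees `i ≤ n` the sequences `Hom(Y, K)` are exact. -/
def LeftExact (n : ℕ) (K : CochainComplex C ℕ) : Prop :=
  ∀ i, i ≤ n → ∀ (Y : C) (g : Y ⟶ K.X i), g ≫ K.d i (i + 1) = 0 →
    ∃ h : Y ⟶ K.X (i - 1), h ≫ K.d (i - 1) i = g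

theorem rightExact_of_isNCokernel {K : CochainComplex C ℕ} (hc : ConcentratedLE (n + 1) K)
    (hK : IsNCokernel n K) : RightExact K := by
  intro i Y g hg
  rcases lt_trichotomy i n with h | rfl | h
  · exact hK.2 i h Y g hg
  · exact ⟨0, by rw [hK.1 Y g hg, comp_zero]⟩
  · exact ⟨0, (hc (i + 1) (by omega)).eq_of_src _ _⟩

/-- At `i = 0` the truncated index `i - 1` is `0` and `K.d 0 0 = 0`, so `LeftExact` there says
exactly that the first differential is monic. This lets the end be treated like every other degree.
-/
theorem leftExact_of_isNKernel {K : CochainComplex C ℕ} (hK : IsNKernel n K) :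
    LeftExact n K := by
  intro i hi Y g hg
  cases i with
  | zero => exact ⟨0, by rw [hK.1 Y g hg, zero_comp]⟩
  | succ i => exact hK.2 i hi Y g hg

theorem IsNExactSeq.rightExact {K : CochainComplex C ℕ} (hK : IsNExactSeq n K) : RightExact K :=
  rightExact_of_isNCokernel hK.1 hK.2.2

theorem IsNExactSeq.leftExact {K : CochainComplex C ℕ} (hK : IsNExactSeq n K) : LeftExact n K :=
  leftExact_of_isNKernel hK.2.1

theorem isNExactSeq_of_exact {K : CochainComplex C ℕ} (hc : ConcentratedLE (n + 1) K)
    (hl : LeftExact n K) (hr : RightExact K) : IsNExactSeq n K := by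
  refine ⟨hc, ⟨?_, ?_⟩, ⟨?_, ?_⟩⟩
  · intro Y g hg
    obtain ⟨h, hh⟩ := hl 0 (Nat.zero_le _) Y g hg
    rw [← hh, K.shape _ _ (by simp), comp_zero]
  · intro i hi Y g hg
    exact hl (i + 1) hi Y g hg
  · intro Y g hg
    obtain ⟨h, hh⟩ := hr n Y g hg
    rw [← hh, (hc (n + 2) (by omega)).eq_of_tgt (K.d (n + 1) (n + 2)) 0, zero_comp]
  · intro i _ Y g hg
    exact hr i Y g hg

/-- Commutative squares extend to chain maps. -/
theorem exists_chainMap {K M : CochainComplex C ℕ} (hc : ConcentratedLE (n + 1) K)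
    (hK : RightExact K) (hM : LeftExact n M) (k : ℕ) (hk : k ≤ n) (x : K.X k ⟶ M.X k)
    (y : K.X (k + 1) ⟶ M.X (k + 1)) (hxy : K.d k (k + 1) ≫ y = x ≫ M.d k (k + 1)) :
    ∃ f : K ⟶ M, f.f k = x ∧ f.f (k + 1) = y := by
  obtain ⟨f, hx, hy, hf⟩ := exists_family (T := fun i => K.X i ⟶ M.X i)
    (fun i a b => K.d i (i + 1) ≫ b = a ≫ M.d i (i + 1)) k x y hxy
    -- To the right one extends along the source, by exactness of `Hom(K, -)`; to the left one lifts
    -- along the target, by exactness of `Hom(-, M)`.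
    (fun i _ a b hab => by
      obtain ⟨c, hc⟩ := hK i _ (b ≫ M.d (i + 1) (i + 2)) (by simp [reassoc_of% hab])
      exact ⟨c, hc⟩)
    (fun i hi b c hbc => by
      obtain ⟨a, ha⟩ := hM (i + 1) (by omega) _ (K.d i (i + 1) ≫ b) (by simp [← hbc])
      exact ⟨a, ha.symm⟩) (n + 2)
  refine ⟨{ f := f, comm' := ?_ }, hx, hy⟩
  rintro i _ rfl
  by_cases hi : i < n + 2
  · exact (hf i hi).symm
  · exact (hc i (by omega)).eq_of_src _ _

/-- The chain map `φ` is null-homotopic. -/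
def IsNull {K M : CochainComplex C ℕ} (φ : K ⟶ M) : Prop :=
  Nonempty (Homotopy φ 0)

theorem IsNull.exists_zero {K M : CochainComplex C ℕ} {φ : K ⟶ M} (h : IsNull φ) :
    ∃ s : K.X 1 ⟶ M.X 0, φ.f 0 = K.d 0 1 ≫ s := by
  obtain ⟨s⟩ := h
  refine ⟨s.hom 1 0, ?_⟩
  have := s.comm 0
  rw [Homotopy.prevD_zero_cochainComplex, Homotopy.dNext_cochainComplex] at this
  simpa using this

theorem IsNull.exists_last {K M : CochainComplex C ℕ} {φ : K ⟶ M} (h : IsNull φ)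
    (hc : ConcentratedLE (n + 1) K) :
    ∃ s : K.X (n + 1) ⟶ M.X n, φ.f (n + 1) = s ≫ M.d n (n + 1) := by
  obtain ⟨s⟩ := h
  refine ⟨s.hom (n + 1) n, ?_⟩
  have := s.comm (n + 1)
  rw [Homotopy.prevD_succ_cochainComplex, Homotopy.dNext_cochainComplex,
    (hc (n + 2) (by omega)).eq_of_tgt (K.d (n + 1) (n + 1 + 1)) 0, zero_comp] at this
  simpa using this

theorem IsNull.nonempty_homotopy {K M : CochainComplex C ℕ} {f g : K ⟶ M} (h : IsNull (f - g)) :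
    Nonempty (Homotopy f g) :=
  h.map Homotopy.equivSubZero.symm

/-- A chain map is null-homotopic if it is so in one degree. -/
theorem isNull_of_degree {K M : CochainComplex C ℕ} (hc : ConcentratedLE (n + 1) K)
    (hK : RightExact K) (hM : LeftExact n M) (φ : K ⟶ M) (k : ℕ) (hk : k ≤ n + 1)
    (x : K.X k ⟶ M.X (k - 1)) (y : K.X (k + 1) ⟶ M.X k)
    (hxy : φ.f k = x ≫ M.d (k - 1) k + K.d k (k + 1) ≫ y) : IsNull φ := by
  have hM0 : M.d 0 0 = 0 := M.shape _ _ (by simp)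
  -- For `i = 0` the truncated index allows a spurious component `K₀ ⟶ M₀`. It is only ever composed
  -- with `M.d 0 0 = 0`, and it is dropped from the homotopy below.
  obtain ⟨s, -, -, hs⟩ := exists_family (T := fun i => K.X i ⟶ M.X (i - 1))
    (fun i a b => φ.f i = a ≫ M.d (i - 1) i + K.d i (i + 1) ≫ (show K.X (i + 1) ⟶ M.X i from b))
    k x y hxy
    (fun i _ a b hab => by
      change K.X (i + 1) ⟶ M.X i at b
      change φ.f i = a ≫ M.d (i - 1) i + K.d i (i + 1) ≫ b at hab
      obtain ⟨c, hc⟩ := hK i _ (φ.f (i + 1) - b ≫ M.d i (i + 1)) (by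
        rw [Preadditive.comp_sub, ← φ.comm, hab]
        simp)
      refine ⟨c, ?_⟩
      change φ.f (i + 1) = b ≫ M.d i (i + 1) + K.d (i + 1) (i + 2) ≫ c
      rw [hc]
      abel)
    (fun i hi b c hbc => by
      change K.X (i + 1) ⟶ M.X i at b
      change K.X (i + 2) ⟶ M.X (i + 1) at c
      change φ.f (i + 1) = b ≫ M.d i (i + 1) + K.d (i + 1) (i + 2) ≫ c at hbc
      obtain ⟨a, ha⟩ := hM i (by omega) _ (φ.f i - K.d i (i + 1) ≫ b) (by
        rw [Preadditive.sub_comp, φ.comm, hbc]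
        simp)
      refine ⟨a, ?_⟩
      change φ.f i = a ≫ M.d (i - 1) i + K.d i (i + 1) ≫ b
      rw [ha]
      abel) (n + 2)
  refine ⟨{
      hom := fun i j => if h : i - 1 = j ∧ i ≠ 0 then s i ≫ (M.XIsoOfEq h.1).hom else 0
      zero := fun i j hij => dif_neg (fun h => hij (by
        change j + 1 = i
        omega))
      comm := fun i => ?_ }⟩
  by_cases hi : i < n + 2
  · rw [Homotopy.dNext_cochainComplex, HomologicalComplex.zero_f_apply, add_zero]
    cases i with
    | zero =>
      rw [Homotopy.prevD_zero_cochainComplex, add_zero, dif_pos (by simp)]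
      have := hs 0 hi
      simpa [hM0] using this
    | succ i =>
      rw [Homotopy.prevD_succ_cochainComplex, dif_pos (by simp), dif_pos (by simp)]
      refine Eq.trans ?_ (add_comm _ _)
      have := hs (i + 1) hi
      simpa using this
  · exact (hc i (by omega)).eq_of_src _ _

theorem isNull_of_zero {K M : CochainComplex C ℕ} (hc : ConcentratedLE (n + 1) K)
    (hK : RightExact K) (hM : LeftExact n M) (φ : K ⟶ M) (k : ℕ) (hk : k ≤ n + 1)
    (hφ : φ.f k = 0) : IsNull φ :=
  isNull_of_degree hc hK hM φ k hk 0 0 (by simp [hφ])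

/-- A chain map may be changed in the outer degrees by morphisms factoring through the outer
differentials. -/
theorem exists_chainMap_modify (hn : 0 < n) {K M : CochainComplex C ℕ}
    (hc : ConcentratedLE (n + 1) K)
    (φ : K ⟶ M) (s : K.X 1 ⟶ M.X 0) (t : K.X (n + 1) ⟶ M.X n) :
    ∃ ψ : K ⟶ M, ψ.f 0 = φ.f 0 + K.d 0 1 ≫ s ∧
      ψ.f (n + 1) = φ.f (n + 1) + t ≫ M.d n (n + 1) := by
  -- A null-homotopic map with at most two nonzero homotopy components. As `0 < n`, the positions
  -- `(1, 0)` and `(n + 1, n)` are distinct, so each end sees only its own component.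
  let h : ∀ i j, K.X i ⟶ M.X j := fun i j =>
    if h : i = 1 ∧ j = 0 then (K.XIsoOfEq h.1).hom ≫ s ≫ (M.XIsoOfEq h.2.symm).hom
    else if h : i = n + 1 ∧ j = n then (K.XIsoOfEq h.1).hom ≫ t ≫ (M.XIsoOfEq h.2.symm).hom
    else 0
  have h10 : h 1 0 = s := by simp [h]
  have hn1 : h (n + 1) n = t := by simp [h, hn.ne']
  refine ⟨φ + Homotopy.nullHomotopicMap h, ?_, ?_⟩
  · rw [HomologicalComplex.add_f_apply]
    congr 1
    change dNext 0 h + prevD 0 h = _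
    rw [Homotopy.prevD_zero_cochainComplex, Homotopy.dNext_cochainComplex, h10, add_zero]
  · rw [HomologicalComplex.add_f_apply]
    congr 1
    change dNext (n + 1) h + prevD (n + 1) h = _
    rw [Homotopy.prevD_succ_cochainComplex, Homotopy.dNext_cochainComplex, hn1,
      (hc (n + 2) (by omega)).eq_of_tgt (K.d (n + 1) (n + 1 + 1)) 0, zero_comp, zero_add]

end Complexes

/-! ### Splicing two exact complexes -/

section Splice

variable {C : Type u} [Category.{v} C] [Preadditive C] [HasFiniteBiproducts C] {n : ℕ}

/-- The terms `X₀, D, M₂, M₃ ⊞ X₃, M₄ ⊞ X₄, …`. -/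
noncomputable def spliceX (X M : CochainComplex C ℕ) (D : C) : ℕ → C
  | 0 => X.X 0
  | 1 => D
  | 2 => M.X 2
  | i + 3 => M.X (i + 3) ⊞ X.X (i + 3)

/-- The differentials of the complex with terms `spliceX X M D`. -/
noncomputable def spliceD (X M : CochainComplex C ℕ) {D : C} (d₀ : X.X 0 ⟶ D) (d₁ : D ⟶ M.X 2)
    (ψ : ∀ i, M.X (i + 1) ⟶ X.X (i + 2)) : ∀ i, spliceX X M D i ⟶ spliceX X M D (i + 1)
  | 0 => d₀
  | 1 => d₁
  | 2 => biprod.lift (M.d 2 3) (ψ 1)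
  | i + 3 => biprod.desc (biprod.lift (M.d (i + 3) (i + 4)) (ψ (i + 2)))
      (biprod.lift 0 (X.d (i + 3) (i + 4)))

/-- The complex `X₀ ⟶ D ⟶ M₂ ⟶ M₃ ⊞ X₃ ⟶ M₄ ⊞ X₄ ⟶ ⋯`. -/
noncomputable def splice (X M : CochainComplex C ℕ) {D : C} (d₀ : X.X 0 ⟶ D) (d₁ : D ⟶ M.X 2)
    (ψ : ∀ i, M.X (i + 1) ⟶ X.X (i + 2)) (h₀ : d₀ ≫ d₁ = 0) (h₁ : d₁ ≫ M.d 2 3 = 0)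
    (h₁' : d₁ ≫ ψ 1 = 0)
    (hψ : ∀ i, M.d (i + 1) (i + 2) ≫ ψ (i + 1) + ψ i ≫ X.d (i + 2) (i + 3) = 0) :
    CochainComplex C ℕ :=
  CochainComplex.of (spliceX X M D) (spliceD X M d₀ d₁ ψ) (fun i => by
    match i with
    | 0 => exact h₀
    | 1 =>
      change d₁ ≫ biprod.lift (M.d 2 3) (ψ 1) = 0
      ext <;> simp [h₁, h₁']
    | 2 =>
      change biprod.lift (M.d 2 3) (ψ 1) ≫ biprod.desc (biprod.lift (M.d 3 4) (ψ 2))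
        (biprod.lift 0 (X.d 3 4)) = 0
      ext
      · simp
      · simpa using hψ 1
    | i + 3 =>
      change biprod.desc (biprod.lift (M.d (i + 3) (i + 4)) (ψ (i + 2)))
        (biprod.lift 0 (X.d (i + 3) (i + 4))) ≫
          biprod.desc (biprod.lift (M.d (i + 4) (i + 5)) (ψ (i + 3)))
            (biprod.lift 0 (X.d (i + 4) (i + 5))) = 0
      ext
      · simp
      · simpa using hψ (i + 2)
      · simp
      · simp)

/-- If `X₀ ⟶ X₁ ⟶ ⋯` and `X₁ ⟶ D ⊞ X₂ ⟶ M₂ ⟶ ⋯` are exact sequences, then so is a suitable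
sequence `X₀ ⟶ D ⟶ M₂ ⟶ M₃ ⊞ X₃ ⟶ ⋯`. -/
theorem exists_splice {X M : CochainComplex C ℕ} (hX : IsNExactSeq n X) (hM : IsNExactSeq n M)
    {D : C} (y : X.X 1 ⟶ D) (l : M.X 0 ≅ X.X 1) (w : M.X 1 ≅ D ⊞ X.X 2)
    (hw : M.d 0 1 ≫ w.hom = l.hom ≫ biprod.lift y (X.d 1 2)) :
    ∃ N : CochainComplex C ℕ, IsNExactSeq n N ∧ ∃ (a : N.X 0 ≅ X.X 0) (b : N.X 1 ≅ D),
      N.d 0 1 ≫ b.hom = a.hom ≫ X.d 0 1 ≫ y := by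
  have hXr := hX.rightExact
  have hXl := hX.leftExact
  have hMr := hM.rightExact
  have hMl := hM.leftExact
  have hX0 : X.d 0 0 = 0 := X.shape _ _ (by simp)
  have hM0 : M.d 0 0 = 0 := M.shape _ _ (by simp)
  have hw' : l.inv ≫ M.d 0 1 = biprod.lift y (X.d 1 2) ≫ w.inv := by
    rw [Iso.inv_comp_eq, ← Category.assoc, ← hw]
    simp
  -- With the sign-changed `M₀ ≅ X₁` as a further component, the `ψ i` form an anticommuting map
  -- from `M` to `X` shifted by one. Its cone has terms `Mⱼ ⊞ Xⱼ`; cancelling `M₀` against `X₁`, and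
  -- the summand `X₂` of `M₁` against `X₂`, leaves `X₀, D, M₂, M₃ ⊞ X₃, …`.
  obtain ⟨ψ, hψ0, hψ⟩ : ∃ ψ : ∀ i, M.X (i + 1) ⟶ X.X (i + 2), ψ 0 = w.hom ≫ biprod.snd ∧
      ∀ i, M.d (i + 1) (i + 2) ≫ ψ (i + 1) + ψ i ≫ X.d (i + 2) (i + 3) = 0 := by
    have step : ∀ i (a : M.X (i + 1) ⟶ X.X (i + 2)),
        M.d i (i + 1) ≫ a ≫ X.d (i + 2) (i + 3) = 0 →
        ∃ b : M.X (i + 2) ⟶ X.X (i + 3),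
          M.d (i + 1) (i + 2) ≫ b + a ≫ X.d (i + 2) (i + 3) = 0 := by
      intro i a ha
      obtain ⟨b, hb⟩ := hMr i _ (-(a ≫ X.d (i + 2) (i + 3))) (by simp [ha])
      exact ⟨b, by rw [hb]; simp⟩
    obtain ⟨y', hy'⟩ := step 0 (w.hom ≫ biprod.snd) (by
      rw [Category.assoc, reassoc_of% hw]
      simp)
    obtain ⟨ψ, h0, -, h⟩ := exists_family (T := fun i => M.X (i + 1) ⟶ X.X (i + 2))
      (fun i a b => M.d (i + 1) (i + 2) ≫ b + a ≫ X.d (i + 2) (i + 3) = 0) 0 _ y' hy'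
      (fun i _ a b hab => step (i + 1) b (by
        rw [← Category.assoc, eq_neg_of_add_eq_zero_left hab]
        simp)) (fun i hi => absurd hi (by omega)) (n + 1)
    refine ⟨ψ, h0, fun i => ?_⟩
    by_cases hi : i < n + 1
    · exact h i hi
    · exact (hM.1 (i + 1) (by omega)).eq_of_src _ _
  have hψ' : ∀ i, M.d (i + 1) (i + 2) ≫ ψ (i + 1) = -(ψ i ≫ X.d (i + 2) (i + 3)) :=
    fun i => eq_neg_of_add_eq_zero_left (hψ i)
  have e₀ : (X.d 0 1 ≫ y) ≫ biprod.inl ≫ w.inv = X.d 0 1 ≫ l.inv ≫ M.d 0 1 := by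
    rw [hw', ← Category.assoc, ← Category.assoc]
    congr 1
    ext <;> simp
  have h₁' : (biprod.inl ≫ w.inv ≫ M.d 1 2) ≫ ψ 1 = 0 := by
    simp [hψ' 0, hψ0]
  let δ₀ : X.X 0 ⟶ D := X.d 0 1 ≫ y
  let δ₁ : D ⟶ M.X 2 := biprod.inl ≫ w.inv ≫ M.d 1 2
  let δ₂ : M.X 2 ⟶ M.X 3 ⊞ X.X 3 := biprod.lift (M.d 2 3) (ψ 1)
  let δ₃ (i : ℕ) : M.X (i + 3) ⊞ X.X (i + 3) ⟶ M.X (i + 4) ⊞ X.X (i + 4) :=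
    biprod.desc (biprod.lift (M.d (i + 3) (i + 4)) (ψ (i + 2)))
      (biprod.lift 0 (X.d (i + 3) (i + 4)))
  have hδ₀ : δ₀ ≫ biprod.inl ≫ w.inv = X.d 0 1 ≫ l.inv ≫ M.d 0 1 := e₀
  have hM1 : biprod.lift y (X.d 1 2) ≫ w.inv ≫ M.d 1 2 = 0 := by
    rw [← Category.assoc, ← hw']
    simp
  have δ₃_inl (i : ℕ) : biprod.inl ≫ δ₃ i = biprod.lift (M.d (i + 3) (i + 4)) (ψ (i + 2)) :=
    biprod.inl_desc _ _
  have δ₃_inr (i : ℕ) : biprod.inr ≫ δ₃ i = biprod.lift 0 (X.d (i + 3) (i + 4)) :=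
    biprod.inr_desc _ _
  -- The facts `l0`–`l4` give left exactness and `r0`–`r3` right exactness. The low degrees feel the
  -- cancelled terms; `l4` and `r3` are the usual diagram chase for a mapping cone.
  have l0 (hi : 0 ≤ n) (W : C) (g : W ⟶ X.X 0) (hg : g ≫ δ₀ = 0) : g = 0 := by
    obtain ⟨h, hh⟩ := hMl 0 hi W (g ≫ X.d 0 1 ≫ l.inv) (by
      rw [Category.assoc, Category.assoc, ← hδ₀, reassoc_of% hg, zero_comp])
    have h1 : (g ≫ X.d 0 1) ≫ l.inv = 0 := by
      rw [Category.assoc, ← hh]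
      exact (congrArg (h ≫ ·) hM0).trans comp_zero
    obtain ⟨h', hh'⟩ := hXl 0 hi W g ((cancel_mono l.inv).1 (by rw [h1, zero_comp]))
    rw [← hh']
    exact (congrArg (h' ≫ ·) hX0).trans comp_zero
  have l1 (hi : 1 ≤ n) (W : C) (g : W ⟶ D) (hg : g ≫ δ₁ = 0) :
      ∃ h : W ⟶ X.X 0, h ≫ δ₀ = g := by
    obtain ⟨b, hb⟩ := hMl 1 hi W (g ≫ biprod.inl ≫ w.inv) (by simpa [δ₁] using hg)
    change b ≫ M.d 0 1 = _ at hb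
    have hb' : b ≫ l.hom ≫ biprod.lift y (X.d 1 2) = g ≫ biprod.inl := by
      rw [← hw, ← Category.assoc, hb]
      simp
    obtain ⟨a, ha⟩ := hXl 1 hi W (b ≫ l.hom) (by
      have := congrArg (· ≫ biprod.snd) hb'
      simpa using this)
    change a ≫ X.d 0 1 = _ at ha
    refine ⟨a, ?_⟩
    have := congrArg (· ≫ biprod.fst) hb'
    simp only [Category.assoc, biprod.lift_fst, biprod.inl_fst, Category.comp_id] at this
    simp only [δ₀, reassoc_of% ha, this]
  have l2 (hi : 2 ≤ n) (W : C) (g : W ⟶ M.X 2) (hg : g ≫ δ₂ = 0) :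
      ∃ h : W ⟶ D, h ≫ δ₁ = g := by
    have hg1 := congrArg (· ≫ biprod.fst) hg
    have hg2 := congrArg (· ≫ biprod.snd) hg
    simp only [δ₂, Category.assoc, biprod.lift_fst, biprod.lift_snd, zero_comp] at hg1 hg2
    obtain ⟨v, hv⟩ := hMl 2 hi W g hg1
    change W ⟶ M.X 1 at v
    change v ≫ M.d 1 2 = _ at hv
    -- The preimage `v` in `M₁ ≅ D ⊞ X₂` may have an `X₂`-component. It is a cycle of `X`, hence
    -- comes from some `b` into `X₁`, and subtracting the image of `b` in `M₁` moves `v` into `D`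
    -- without changing its image in `M₂`.
    obtain ⟨b, hb⟩ := hXl 2 hi W (v ≫ ψ 0) (by
      have this : M.d 1 2 ≫ ψ 1 = -(ψ 0 ≫ X.d 2 3) := hψ' 0
      rw [Category.assoc, ← neg_eq_zero, ← Preadditive.comp_neg, ← this, ← Category.assoc, hv, hg2])
    change W ⟶ X.X 1 at b
    change b ≫ X.d 1 2 = _ at hb
    refine ⟨v ≫ w.hom ≫ biprod.fst - b ≫ y, ?_⟩
    have key : (v ≫ w.hom ≫ biprod.fst - b ≫ y) ≫ biprod.inl =
        v ≫ w.hom - b ≫ biprod.lift y (X.d 1 2) := by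
      ext
      · simp
      · simp [hb, hψ0]
    simp only [δ₁]
    rw [← Category.assoc, key, Preadditive.sub_comp, Category.assoc, Category.assoc, hM1]
    simp [hv]
  have l3 (hi : 3 ≤ n) (W : C) (g : W ⟶ M.X 3 ⊞ X.X 3) (hg : g ≫ δ₃ 0 = 0) :
      ∃ h : W ⟶ M.X 2, h ≫ δ₂ = g := by
    have hgd : g = (g ≫ biprod.fst) ≫ biprod.inl + (g ≫ biprod.snd) ≫ biprod.inr := by
      ext <;> simp
    generalize g ≫ biprod.fst = u, g ≫ biprod.snd = x at hgd
    subst hgd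
    rw [Preadditive.add_comp, Category.assoc, Category.assoc, δ₃_inl, δ₃_inr] at hg
    have hg1 := congrArg (· ≫ biprod.fst) hg
    have hg2 := congrArg (· ≫ biprod.snd) hg
    simp at hg1 hg2
    obtain ⟨v, hv⟩ := hMl 3 hi W u hg1
    change W ⟶ M.X 2 at v
    change v ≫ M.d 2 3 = _ at hv
    obtain ⟨b, hb⟩ := hXl 3 hi W (x - v ≫ ψ 1) (by
      have this : M.d 2 3 ≫ ψ 2 = -(ψ 1 ≫ X.d 3 4) := hψ' 1
      rw [Preadditive.sub_comp, Category.assoc, sub_eq_add_neg, ← Preadditive.comp_neg, ← this,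
        reassoc_of% hv]
      exact (add_comm _ _).trans hg2)
    change W ⟶ X.X 2 at b
    change b ≫ X.d 2 3 = _ at hb
    have this : M.d 1 2 ≫ ψ 1 = -(ψ 0 ≫ X.d 2 3) := hψ' 0
    refine ⟨v - b ≫ biprod.inr ≫ w.inv ≫ M.d 1 2, ?_⟩
    ext
    · simp [δ₂, hv]
    · simp [δ₂, this, hψ0, hb]
  have l4 (j : ℕ) (hi : j + 4 ≤ n) (W : C) (g : W ⟶ M.X (j + 4) ⊞ X.X (j + 4))
      (hg : g ≫ δ₃ (j + 1) = 0) : ∃ h : W ⟶ M.X (j + 3) ⊞ X.X (j + 3), h ≫ δ₃ j = g := by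
    have hgd : g = (g ≫ biprod.fst) ≫ biprod.inl + (g ≫ biprod.snd) ≫ biprod.inr := by
      ext <;> simp
    generalize g ≫ biprod.fst = u, g ≫ biprod.snd = x at hgd
    subst hgd
    rw [Preadditive.add_comp, Category.assoc, Category.assoc, δ₃_inl, δ₃_inr] at hg
    have hg1 := congrArg (· ≫ biprod.fst) hg
    have hg2 := congrArg (· ≫ biprod.snd) hg
    simp at hg1 hg2
    obtain ⟨v, hv⟩ := hMl (j + 4) hi W u hg1
    change W ⟶ M.X (j + 3) at v
    change v ≫ M.d (j + 3) (j + 4) = _ at hv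
    obtain ⟨b, hb⟩ := hXl (j + 4) hi W (x - v ≫ ψ (j + 2)) (by
      have := hψ' (j + 2)
      rw [Preadditive.sub_comp, Category.assoc, sub_eq_add_neg, ← Preadditive.comp_neg]
      erw [← this]
      rw [reassoc_of% hv]
      exact (add_comm _ _).trans hg2)
    change W ⟶ X.X (j + 3) at b
    change b ≫ X.d (j + 3) (j + 4) = _ at hb
    refine ⟨biprod.lift v b, ?_⟩
    ext
    · simp [δ₃, hv]
    · simp [δ₃, hb]
  have r0 (W : C) (g : D ⟶ W) (hg : δ₀ ≫ g = 0) : ∃ h : M.X 2 ⟶ W, δ₁ ≫ h = g := by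
    -- With `χ` extending `y ≫ g` over `X₂`, the pair `(g, -χ)` on `D ⊞ X₂` vanishes on `X₁` and so
    -- factors through `M₂`.
    obtain ⟨χ, hχ⟩ := hXr 0 W (y ≫ g) (by simpa [δ₀] using hg)
    change X.X 2 ⟶ W at χ
    change X.d 1 2 ≫ χ = _ at hχ
    obtain ⟨h, hh⟩ := hMr 0 W (w.hom ≫ biprod.desc g (-χ)) (by
      simp [reassoc_of% hw, biprod.lift_desc, hχ])
    change M.X 2 ⟶ W at h
    change M.d 1 2 ≫ h = _ at hh
    exact ⟨h, by simp [δ₁, hh]⟩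
  have r1 (W : C) (g : M.X 2 ⟶ W) (hg : δ₁ ≫ g = 0) : ∃ h : M.X 3 ⊞ X.X 3 ⟶ W, δ₂ ≫ h = g := by
    have hd : M.d 1 2 ≫ g = ψ 0 ≫ biprod.inr ≫ w.inv ≫ M.d 1 2 ≫ g := by
      rw [hψ0, ← cancel_epi w.inv]
      ext
      · simpa [δ₁] using hg
      · simp
    obtain ⟨τ, hτ⟩ := hXr 1 W (biprod.inr ≫ w.inv ≫ M.d 1 2 ≫ g) (by
      have h2 : l.hom ≫ X.d 1 2 = M.d 0 1 ≫ ψ 0 := by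
        rw [hψ0, ← Category.assoc, hw]
        simp
      rw [← cancel_epi l.hom, ← Category.assoc, h2, Category.assoc, ← hd]
      simp)
    change X.X 3 ⟶ W at τ
    change X.d 2 3 ≫ τ = _ at hτ
    have this : M.d 1 2 ≫ ψ 1 = -(ψ 0 ≫ X.d 2 3) := hψ' 0
    obtain ⟨σ, hσ⟩ := hMr 1 W (g + ψ 1 ≫ τ) (by
      rw [Preadditive.comp_add, reassoc_of% this, Preadditive.neg_comp, Category.assoc, hτ, ← hd]
      simp)
    change M.X 3 ⟶ W at σ
    change M.d 2 3 ≫ σ = _ at hσ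
    exact ⟨biprod.desc σ (-τ), by simp [δ₂, biprod.lift_desc, hσ]⟩
  have r2 (W : C) (g : M.X 3 ⊞ X.X 3 ⟶ W) (hg : δ₂ ≫ g = 0) :
      ∃ h : M.X 4 ⊞ X.X 4 ⟶ W, δ₃ 0 ≫ h = g := by
    have hgd : g = biprod.desc (biprod.inl ≫ g) (biprod.inr ≫ g) := by ext <;> simp
    generalize biprod.inl ≫ g = α, biprod.inr ≫ g = τ at hgd
    subst hgd
    simp only [δ₂, biprod.lift_desc] at hg
    have h0 : M.d 1 2 ≫ ψ 1 = -(ψ 0 ≫ X.d 2 3) := hψ' 0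
    have h1 : M.d 2 3 ≫ ψ 2 = -(ψ 1 ≫ X.d 3 4) := hψ' 1
    -- Precomposing `hg` with `X₂ ⟶ M₁ ⟶ M₂` kills the term in `α` and turns `ψ 1` into `-X.d 2 3`;
    -- so `τ` vanishes on the image of `X₂`.
    obtain ⟨τ', hτ⟩ := hXr 2 W τ (by
      have h3 : biprod.inr ≫ w.inv ≫ M.d 1 2 ≫ (M.d 2 3 ≫ α + ψ 1 ≫ τ) = 0 := by rw [hg]; simp
      have h4 := reassoc_of% h0
      simpa [h4, hψ0] using h3)
    change X.X 4 ⟶ W at τ'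
    change X.d 3 4 ≫ τ' = _ at hτ
    obtain ⟨σ, hσ⟩ := hMr 2 W (α - ψ 2 ≫ τ') (by
      have h4 := reassoc_of% h1
      simp only [Nat.reduceAdd, Preadditive.comp_sub, h4, Preadditive.neg_comp, Category.assoc, hτ, sub_neg_eq_add, hg])
    change M.X 4 ⟶ W at σ
    change M.d 3 4 ≫ σ = _ at hσ
    refine ⟨biprod.desc σ τ', ?_⟩
    ext <;> simp [δ₃, biprod.lift_desc, hσ, hτ]
  have r3 (j : ℕ) (W : C) (g : M.X (j + 4) ⊞ X.X (j + 4) ⟶ W) (hg : δ₃ j ≫ g = 0) :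
      ∃ h : M.X (j + 5) ⊞ X.X (j + 5) ⟶ W, δ₃ (j + 1) ≫ h = g := by
    have hgd : g = biprod.desc (biprod.inl ≫ g) (biprod.inr ≫ g) := by ext <;> simp
    generalize biprod.inl ≫ g = α, biprod.inr ≫ g = τ at hgd
    subst hgd
    have hg1 := congrArg (biprod.inl ≫ ·) hg
    have hg2 := congrArg (biprod.inr ≫ ·) hg
    simp [δ₃, biprod.lift_desc] at hg1 hg2
    obtain ⟨τ', hτ⟩ := hXr (j + 3) W τ hg2
    change X.X (j + 5) ⟶ W at τ'
    change X.d (j + 4) (j + 5) ≫ τ' = _ at hτ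
    obtain ⟨σ, hσ⟩ := hMr (j + 3) W (α - ψ (j + 3) ≫ τ') (by
      have h4 := reassoc_of% (hψ' (j + 2))
      rw [Preadditive.comp_sub]
      erw [h4]
      rw [Preadditive.neg_comp, Category.assoc]
      erw [hτ]
      rw [sub_neg_eq_add]
      exact hg1)
    change M.X (j + 5) ⟶ W at σ
    change M.d (j + 4) (j + 5) ≫ σ = _ at hσ
    refine ⟨biprod.desc σ τ', ?_⟩
    ext <;> simp [δ₃, biprod.lift_desc, hσ, hτ]
  have hδ₀₁ : δ₀ ≫ δ₁ = 0 := by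
    change δ₀ ≫ biprod.inl ≫ w.inv ≫ M.d 1 2 = 0
    rw [reassoc_of% hδ₀]
    simp
  let N := splice X M δ₀ δ₁ ψ hδ₀₁ (by simp [δ₁]) h₁' hψ
  have hd (i : ℕ) : N.d i (i + 1) = spliceD X M δ₀ δ₁ ψ i := CochainComplex.of_d _ _ i
  have d0 : N.d 0 1 = δ₀ := hd 0
  have d1 : N.d 1 2 = δ₁ := hd 1
  have d2 : N.d 2 3 = δ₂ := hd 2
  have d3 (i : ℕ) : N.d (i + 3) (i + 4) = δ₃ i := hd (i + 3)
  refine ⟨N, isNExactSeq_of_exact ?_ ?_ ?_, Iso.refl _, Iso.refl _, ?_⟩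
  · intro i hi
    match i with
    | 0 => omega
    | 1 => omega
    | 2 => exact hM.1 2 hi
    | i + 3 => exact biprod_isZero_iff _ _ |>.2 ⟨hM.1 _ hi, hX.1 _ hi⟩
  · intro i hi W g hg
    match i with
    | 0 =>
      rw [d0] at hg
      exact ⟨0, by rw [zero_comp]; exact (l0 hi W g hg).symm⟩
    | 1 =>
      rw [d1] at hg
      obtain ⟨h, hh⟩ := l1 hi W g hg
      exact ⟨h, (congrArg (h ≫ ·) d0).trans hh⟩
    | 2 =>
      rw [d2] at hg
      obtain ⟨h, hh⟩ := l2 hi W g hg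
      exact ⟨h, (congrArg (h ≫ ·) d1).trans hh⟩
    | 3 =>
      rw [d3] at hg
      obtain ⟨h, hh⟩ := l3 hi W g hg
      exact ⟨h, (congrArg (h ≫ ·) d2).trans hh⟩
    | j + 4 =>
      rw [d3 (j + 1)] at hg
      obtain ⟨h, hh⟩ := l4 j hi W g hg
      exact ⟨h, (congrArg (h ≫ ·) (d3 j)).trans hh⟩
  · intro i W g hg
    match i with
    | 0 =>
      rw [d0] at hg
      obtain ⟨h, hh⟩ := r0 W g hg
      exact ⟨h, (congrArg (· ≫ h) d1).trans hh⟩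
    | 1 =>
      rw [d1] at hg
      obtain ⟨h, hh⟩ := r1 W g hg
      exact ⟨h, (congrArg (· ≫ h) d2).trans hh⟩
    | 2 =>
      rw [d2] at hg
      obtain ⟨h, hh⟩ := r2 W g hg
      exact ⟨h, (congrArg (· ≫ h) (d3 0)).trans hh⟩
    | j + 3 =>
      rw [d3 j] at hg
      obtain ⟨h, hh⟩ := r3 j W g hg
      exact ⟨h, (congrArg (· ≫ h) (d3 (j + 1))).trans hh⟩
  · rw [d0]
    exact (Category.comp_id _).trans (Category.id_comp _).symm

end Splice

/-! ### Reversed complexes -/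

section Reverse

variable {C : Type u} [Category.{v} C] [Preadditive C] {n : ℕ}

/-- The complex `L` in the opposite category is the complex `K₀ ⟶ ⋯ ⟶ Kₙ₊₁` read backwards. -/
structure Reversal (n : ℕ) (K : CochainComplex C ℕ) (L : CochainComplex Cᵒᵖ ℕ) where
  concentrated : ConcentratedLE (n + 1) K
  concentrated' : ConcentratedLE (n + 1) L
  iso : ∀ i j, i + j = n + 1 → (L.X i ≅ Opposite.op (K.X j))
  comm : ∀ i j (h : i + 1 + j = n + 1) (h' : i + (j + 1) = n + 1),
    L.d i (i + 1) ≫ (iso (i + 1) j h).hom = (iso i (j + 1) h').hom ≫ (K.d j (j + 1)).op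

/-- The involution of `ℕ` which reverses `{0, …, n + 1}` and fixes all other numbers. -/
def revIndex (n i : ℕ) : ℕ := if i ≤ n + 1 then n + 1 - i else i

theorem revIndex_eq {i j : ℕ} (h : i + j = n + 1) : revIndex n i = j := by
  rw [revIndex, if_pos (by omega)]
  omega

theorem revIndex_of_lt {i : ℕ} (h : n + 1 < i) : revIndex n i = i := by
  rw [revIndex, if_neg (by omega)]

theorem d_comp_XIsoOfEq {K : CochainComplex C ℕ} {i i' j j' : ℕ} (hi : i = i') (hj : j = j') :
    K.d i j ≫ (K.XIsoOfEq hj).hom = (K.XIsoOfEq hi).hom ≫ K.d i' j' := by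
  subst hi hj
  simp

theorem exists_reversal (K : CochainComplex C ℕ) (hK : ConcentratedLE (n + 1) K) :
    ∃ L : CochainComplex Cᵒᵖ ℕ, Nonempty (Reversal n K L) := by
  let L : CochainComplex Cᵒᵖ ℕ :=
    { X := fun i => Opposite.op (K.X (revIndex n i))
      d := fun i j => if i + 1 = j then (K.d (revIndex n j) (revIndex n i)).op else 0
      shape := fun i j h => if_neg h
      d_comp_d' := by
        rintro i _ _ rfl rfl
        rw [if_pos rfl, if_pos rfl, ← op_comp, K.d_comp_d, op_zero] }
  refine ⟨L, ⟨⟨hK, fun i hi => ?_, fun i j h => (K.XIsoOfEq (revIndex_eq h).symm).op, ?_⟩⟩⟩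
  · change IsZero (Opposite.op (K.X (revIndex n i)))
    rw [revIndex_of_lt hi]
    exact (hK i hi).op
  · intro i j h h'
    have : L.d i (i + 1) = (K.d (revIndex n (i + 1)) (revIndex n i)).op := if_pos rfl
    rw [this, Iso.op_hom, Iso.op_hom, ← op_comp, ← op_comp, d_comp_XIsoOfEq]

theorem exists_reversal' (L : CochainComplex Cᵒᵖ ℕ) (hL : ConcentratedLE (n + 1) L) :
    ∃ K : CochainComplex C ℕ, Nonempty (Reversal n K L) := by
  let K : CochainComplex C ℕ :=
    { X := fun i => (L.X (revIndex n i)).unop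
      d := fun i j => if i + 1 = j then (L.d (revIndex n j) (revIndex n i)).unop else 0
      shape := fun i j h => if_neg h
      d_comp_d' := by
        rintro i _ _ rfl rfl
        rw [if_pos rfl, if_pos rfl, ← unop_comp, L.d_comp_d, unop_zero] }
  refine ⟨K, ⟨⟨fun i hi => ?_, hL,
    fun i j h => L.XIsoOfEq (revIndex_eq ((add_comm j i).trans h)).symm, ?_⟩⟩⟩
  · change IsZero (L.X (revIndex n i)).unop
    rw [revIndex_of_lt hi]
    exact (hL i hi).unop
  · intro i j h h'
    have : K.d j (j + 1) = (L.d (revIndex n (j + 1)) (revIndex n j)).unop := if_pos rfl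
    rw [this, Quiver.Hom.op_unop, d_comp_XIsoOfEq]

namespace Reversal

variable {K : CochainComplex C ℕ} {L : CochainComplex Cᵒᵖ ℕ} (r : Reversal n K L)

include r

theorem comm_inv (i j : ℕ) (h : i + 1 + j = n + 1) (h' : i + (j + 1) = n + 1) :
    (r.iso i (j + 1) h').inv ≫ L.d i (i + 1) = (K.d j (j + 1)).op ≫ (r.iso (i + 1) j h).inv := by
  rw [Iso.inv_comp_eq, ← Category.assoc, ← r.comm i j h h']
  simp

/-- Left exactness of `L` at `i` is right exactness of `K` at the complementary degree, and
conversely. At the ends the factorization passes through a zero object or a zero differential, which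
is why the extreme indices are split off. -/
theorem isNExactSeq (hK : IsNExactSeq n K) : IsNExactSeq n L := by
  have hl := hK.leftExact
  have hr := hK.rightExact
  refine isNExactSeq_of_exact r.concentrated' ?_ ?_
  · intro i hi Y g hg
    obtain ⟨j, rfl⟩ : ∃ j, n = i + j := ⟨n - i, by omega⟩
    obtain ⟨h, hh⟩ := hr j Y.unop (g ≫ (r.iso i (j + 1) (by omega)).hom).unop (by
      rw [← Quiver.Hom.unop_op (K.d j (j + 1)), ← unop_comp, Category.assoc,
        ← r.comm i j (by omega), reassoc_of% hg, zero_comp, unop_zero])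
    cases i with
    | zero =>
      refine ⟨0, ?_⟩
      rw [(r.concentrated (j + 2) (by omega)).eq_of_tgt (K.d (j + 1) (j + 2)) 0, zero_comp] at hh
      have := congrArg Quiver.Hom.op hh
      rw [op_zero, Quiver.Hom.op_unop] at this
      rw [← cancel_mono (r.iso 0 (j + 1) (by omega)).hom, ← this, zero_comp, zero_comp]
    | succ i =>
      refine ⟨h.op ≫ (r.iso i (j + 2) (by omega)).inv, ?_⟩
      change (h.op ≫ _) ≫ L.d i (i + 1) = g
      rw [Category.assoc, r.comm_inv i (j + 1) (by omega), ← Category.assoc, ← op_comp, hh]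
      simp
  · intro i Y g hg
    by_cases hi : i ≤ n
    · obtain ⟨j, rfl⟩ : ∃ j, n = i + j := ⟨n - i, by omega⟩
      obtain ⟨h, hh⟩ := hl j (by omega) Y.unop ((r.iso (i + 1) j (by omega)).inv ≫ g).unop (by
        rw [← Quiver.Hom.unop_op (K.d j (j + 1)), ← unop_comp, ← Category.assoc,
          ← r.comm_inv i j (by omega) (by omega), Category.assoc, hg, comp_zero, unop_zero])
      cases j with
      | zero =>
        refine ⟨0, ?_⟩
        rw [K.shape _ _ (by simp), comp_zero] at hh
        have := congrArg Quiver.Hom.op hh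
        rw [op_zero, Quiver.Hom.op_unop] at this
        rw [← cancel_epi (r.iso (i + 1) 0 (by omega)).inv, ← this, comp_zero, comp_zero]
      | succ j =>
        change Y.unop ⟶ K.X j at h
        change h ≫ K.d j (j + 1) = _ at hh
        refine ⟨(r.iso (i + 2) j (by omega)).hom ≫ h.op, ?_⟩
        rw [← Category.assoc, r.comm (i + 1) j (by omega) (by omega), Category.assoc, ← op_comp, hh]
        simp
    · exact ⟨0, (r.concentrated' (i + 1) (by omega)).eq_of_src _ _⟩

theorem isNExactSeq_symm (hL : IsNExactSeq n L) : IsNExactSeq n K := by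
  have hl := hL.leftExact
  have hr := hL.rightExact
  refine isNExactSeq_of_exact r.concentrated ?_ ?_
  · intro j hj Y g hg
    obtain ⟨i, rfl⟩ : ∃ i, n = i + j := ⟨n - j, by omega⟩
    obtain ⟨h, hh⟩ := hr i _ ((r.iso (i + 1) j (by omega)).hom ≫ g.op) (by
      rw [← Category.assoc, r.comm i j (by omega) (by omega), Category.assoc, ← op_comp, hg,
        op_zero, comp_zero])
    cases j with
    | zero =>
      refine ⟨0, ?_⟩
      rw [(r.concentrated' (i + 2) (by omega)).eq_of_tgt (L.d (i + 1) (i + 2)) 0, zero_comp,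
        ← comp_zero (f := (r.iso (i + 1) 0 (by omega)).hom), cancel_epi] at hh
      rw [zero_comp]
      exact Quiver.Hom.op_inj hh
    | succ j =>
      refine ⟨((r.iso (i + 2) j (by omega)).inv ≫ h).unop, Quiver.Hom.op_inj ?_⟩
      change (K.d j (j + 1)).op ≫ (r.iso (i + 2) j _).inv ≫ h = g.op
      rw [← Category.assoc, ← r.comm_inv (i + 1) j (by omega) (by omega), Category.assoc, hh]
      simp
  · intro j Y g hg
    by_cases hj : j ≤ n
    · obtain ⟨i, rfl⟩ : ∃ i, n = i + j := ⟨n - j, by omega⟩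
      obtain ⟨h, hh⟩ := hl i (by omega) _ (g.op ≫ (r.iso i (j + 1) (by omega)).inv) (by
        rw [Category.assoc, r.comm_inv i j (by omega), ← Category.assoc, ← op_comp, hg,
          op_zero, zero_comp])
      cases i with
      | zero =>
        refine ⟨0, ?_⟩
        rw [L.shape _ _ (by simp), comp_zero,
          ← zero_comp (f := (r.iso 0 (j + 1) (by omega)).inv), cancel_mono] at hh
        rw [comp_zero]
        exact Quiver.Hom.op_inj hh
      | succ i =>
        change _ ⟶ L.X i at h
        change h ≫ L.d i (i + 1) = _ at hh
        refine ⟨(h ≫ (r.iso i (j + 2) (by omega)).hom).unop, Quiver.Hom.op_inj ?_⟩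
        change (h ≫ (r.iso i (j + 2) _).hom) ≫ (K.d (j + 1) (j + 2)).op = g.op
        rw [Category.assoc, ← r.comm i (j + 1) (by omega), ← Category.assoc, hh]
        simp
    · exact ⟨0, (r.concentrated (j + 1) (by omega)).eq_of_src _ _⟩

end Reversal

end Reverse

/-! ### The dual splicing, by passage to the opposite category -/

section CoSplice

variable {C : Type u} [Category.{v} C] [Preadditive C] [HasFiniteBiproducts C] {n : ℕ}

/-- Biproducts in the opposite category. -/
noncomputable def opBiprodIso (A B : C) :
    Opposite.op (A ⊞ B) ≅ Opposite.op A ⊞ Opposite.op B where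
  hom := biprod.lift biprod.inl.op biprod.inr.op
  inv := biprod.desc biprod.fst.op biprod.snd.op
  hom_inv_id := by
    rw [biprod.lift_desc, ← op_comp, ← op_comp, ← op_add, biprod.total, op_id]
  inv_hom_id := by
    ext <;> simp [← op_comp]

/-- If `⋯ ⟶ Xₙ ⟶ Xₙ₊₁` and `⋯ ⟶ D ⊞ Xₙ₋₁ ⟶ Xₙ` are exact sequences, then so is a
suitable sequence `⋯ ⟶ D ⟶ Xₙ₊₁`. -/
theorem exists_cosplice {X M : CochainComplex C ℕ} {m : ℕ} (hX : IsNExactSeq (m + 1) X)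
    (hM : IsNExactSeq (m + 1) M) {D : C} (y : D ⟶ X.X (m + 1)) (l : M.X (m + 2) ≅ X.X (m + 1))
    (w : M.X (m + 1) ≅ D ⊞ X.X m)
    (hw : w.inv ≫ M.d (m + 1) (m + 2) ≫ l.hom = biprod.desc y (X.d m (m + 1))) :
    ∃ N : CochainComplex C ℕ, IsNExactSeq (m + 1) N ∧
      ∃ (a : N.X (m + 2) ≅ X.X (m + 2)) (b : N.X (m + 1) ≅ D),
        N.d (m + 1) (m + 2) ≫ a.hom = b.hom ≫ y ≫ X.d (m + 1) (m + 2) := by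
  obtain ⟨X', ⟨rX⟩⟩ := exists_reversal X hX.1
  obtain ⟨M', ⟨rM⟩⟩ := exists_reversal M hM.1
  have eX := rX.comm_inv 0 (m + 1) (by omega) (by omega)
  have eX1 := rX.comm 1 m (by omega) (by omega)
  have eM := rM.comm 0 (m + 1) (by omega) (by omega)
  let y' : X'.X 1 ⟶ Opposite.op D := (rX.iso 1 (m + 1) (by omega)).hom ≫ y.op
  let l' : M'.X 0 ≅ X'.X 1 :=
    rM.iso 0 (m + 2) (by omega) ≪≫ l.op.symm ≪≫ (rX.iso 1 (m + 1) (by omega)).symm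
  let w' : M'.X 1 ≅ Opposite.op D ⊞ X'.X 2 :=
    rM.iso 1 (m + 1) (by omega) ≪≫ w.op.symm ≪≫ opBiprodIso D (X.X m) ≪≫
      biprod.mapIso (Iso.refl _) (rX.iso 2 m (by omega)).symm
  have hw1 := congrArg (biprod.inl ≫ ·) hw
  have hw2 := congrArg (biprod.inr ≫ ·) hw
  simp only [biprod.inl_desc, biprod.inr_desc] at hw1 hw2
  have hw' : M'.d 0 1 ≫ w'.hom = l'.hom ≫ biprod.lift y' (X'.d 1 2) := by
    have h1 : (M.d (m + 1) (m + 2)).op ≫ w.inv.op ≫ biprod.inl.op = l.inv.op ≫ y.op := by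
      rw [← hw1]
      simp [← op_comp]
    have h2 : (M.d (m + 1) (m + 2)).op ≫ w.inv.op ≫ biprod.inr.op =
        l.inv.op ≫ (X.d m (m + 1)).op := by
      rw [← hw2]
      simp [← op_comp]
    have eM' : M'.d 0 1 ≫ (rM.iso 1 (m + 1) (by omega)).hom =
      (rM.iso 0 (m + 2) (by omega)).hom ≫ (M.d (m + 1) (m + 2)).op := eM
    have eX1' : (rX.iso 1 (m + 1) (by omega)).inv ≫ X'.d 1 2 =
      (X.d m (m + 1)).op ≫ (rX.iso 2 m (by omega)).inv := rX.comm_inv 1 m (by omega) (by omega)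
    ext
    · simp [w', l', y', opBiprodIso, reassoc_of% eM', h1]
    · simp [w', l', opBiprodIso, reassoc_of% eM', reassoc_of% h2, eX1']
  -- Splicing the reversed sequences in `Cᵒᵖ` and reversing the result gives the dual statement.
  have : HasFiniteBiproducts Cᵒᵖ := HasFiniteBiproducts.of_hasFiniteProducts
  obtain ⟨N', hN', a', b', hab⟩ := exists_splice (rX.isNExactSeq hX) (rM.isNExactSeq hM) y' l' w' hw'
  obtain ⟨N, ⟨r⟩⟩ := exists_reversal' N' hN'.1
  have eN : N'.d 0 1 ≫ (r.iso 1 (m + 1) (by omega)).hom =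
      (r.iso 0 (m + 2) (by omega)).hom ≫ (N.d (m + 1) (m + 2)).op :=
    r.comm 0 (m + 1) (by omega) (by omega)
  have eX' : (rX.iso 0 (m + 2) (by omega)).inv ≫ X'.d 0 1 =
      (X.d (m + 1) (m + 2)).op ≫ (rX.iso 1 (m + 1) (by omega)).inv := eX
  refine ⟨N, r.isNExactSeq_symm hN', ((rX.iso 0 (m + 2) (by omega)).symm ≪≫ a'.symm ≪≫
      r.iso 0 (m + 2) (by omega)).unop, ((r.iso 1 (m + 1) (by omega)).symm ≪≫ b').symm.unop, ?_⟩
  apply Quiver.Hom.op_inj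
  have hab' : a'.inv ≫ N'.d 0 1 = (X'.d 0 1 ≫ y') ≫ b'.inv := by
    rw [Iso.inv_comp_eq, ← Category.assoc, ← hab]
    simp
  simp only [Iso.unop_hom, op_comp, Quiver.Hom.op_unop, Iso.trans_hom, Iso.symm_hom,
    Category.assoc, Iso.trans_inv, Iso.symm_inv]
  rw [← eN, reassoc_of% hab', ← Category.assoc, eX']
  simp [y']

end CoSplice

/-! ### Calculus of extensions -/

section ExtCalculus

variable {C : Type u} [Category.{v} C]

section

variable (E : Cᵒᵖ ⥤ C ⥤ AddCommGrpCat.{w})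

theorem push_id {Z A : C} (δ : Ext E Z A) : push E (𝟙 A) δ = δ := by
  simp [push]

theorem pull_id {Z A : C} (δ : Ext E Z A) : pull E (𝟙 Z) δ = δ := by
  simp [pull]

theorem push_comp {Z A A' A'' : C} (a : A ⟶ A') (b : A' ⟶ A'') (δ : Ext E Z A) :
    push E (a ≫ b) δ = push E b (push E a δ) := by
  simp [push]

theorem pull_comp {Z Z' Z'' A : C} (c : Z'' ⟶ Z') (d : Z' ⟶ Z) (δ : Ext E Z A) :
    pull E (c ≫ d) δ = pull E c (pull E d δ) := by
  simp [pull]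

theorem push_pull {Z Z' A A' : C} (a : A ⟶ A') (c : Z' ⟶ Z) (δ : Ext E Z A) :
    push E a (pull E c δ) = pull E c (push E a δ) :=
  (ConcreteCategory.congr_hom ((E.map c.op).naturality a) δ).symm

@[simp]
theorem push_zero {Z A A' : C} (a : A ⟶ A') : push E a (0 : Ext E Z A) = 0 :=
  map_zero _

@[simp]
theorem pull_zero {Z Z' A : C} (c : Z' ⟶ Z) : pull E c (0 : Ext E Z A) = 0 :=
  map_zero _

theorem push_add {Z A A' : C} (a : A ⟶ A') (δ δ' : Ext E Z A) :
    push E a (δ + δ') = push E a δ + push E a δ' :=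
  map_add _ _ _

theorem pull_add {Z Z' A : C} (c : Z' ⟶ Z) (δ δ' : Ext E Z A) :
    pull E c (δ + δ') = pull E c δ + pull E c δ' :=
  map_add _ _ _

end

namespace NExangulated

variable [Preadditive C] [HasFiniteBiproducts C] {n : ℕ} (S : NExangulated.{w} n C)

theorem add_push {Z A A' : C} (a b : A ⟶ A') (δ : Ext S.E Z A) :
    push S.E (a + b) δ = push S.E a δ + push S.E b δ := by
  have := S.additive_right Z
  simp [push, (S.E.obj (Opposite.op Z)).map_add]

theorem add_pull {Z Z' A : C} (c d : Z' ⟶ Z) (δ : Ext S.E Z A) :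
    pull S.E (c + d) δ = pull S.E c δ + pull S.E d δ := by
  have := S.additive_left A
  have h := (S.E.flip.obj A).map_add (f := c.op) (g := d.op)
  exact ConcreteCategory.congr_hom h δ

@[simp]
theorem zero_push {Z A A' : C} (δ : Ext S.E Z A) : push S.E (0 : A ⟶ A') δ = 0 := by
  simpa using S.add_push (0 : A ⟶ A') 0 δ

@[simp]
theorem zero_pull {Z Z' A : C} (δ : Ext S.E Z A) : pull S.E (0 : Z' ⟶ Z) δ = 0 := by
  simpa using S.add_pull (0 : Z' ⟶ Z) 0 δ

theorem neg_push {Z A A' : C} (a : A ⟶ A') (δ : Ext S.E Z A) :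
    push S.E (-a) δ = -push S.E a δ := by
  rw [eq_neg_iff_add_eq_zero, ← add_push]
  simp

theorem neg_pull {Z Z' A : C} (c : Z' ⟶ Z) (δ : Ext S.E Z A) :
    pull S.E (-c) δ = -pull S.E c δ := by
  rw [eq_neg_iff_add_eq_zero, ← add_pull]
  simp

theorem sub_push {Z A A' : C} (a b : A ⟶ A') (δ : Ext S.E Z A) :
    push S.E (a - b) δ = push S.E a δ - push S.E b δ := by
  rw [sub_eq_add_neg, add_push, neg_push, sub_eq_add_neg]

theorem sub_pull {Z Z' A : C} (c d : Z' ⟶ Z) (δ : Ext S.E Z A) :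
    pull S.E (c - d) δ = pull S.E c δ - pull S.E d δ := by
  rw [sub_eq_add_neg, add_pull, neg_pull, sub_eq_add_neg]

theorem exists_realizes {Z A : C} (δ : Ext S.E Z A) : ∃ X : EndedComplex n A Z, Realizes S.s δ X :=
  let ⟨X, hX⟩ := Quotient.exists_rep (S.s δ)
  ⟨X, hX.symm⟩

end NExangulated

end ExtCalculus

/-! ### Exact sequences of extension groups deduced from (EA2) -/

namespace NExangulated

variable {C : Type u} [Category.{v} C] [Preadditive C] [HasFiniteBiproducts C] {m : ℕ}
  (S : NExangulated.{w} (m + 1) C)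

/-- The axiom (EA2), with the outer differentials of the mapping cone made explicit. -/
theorem exists_good_lift {A Z Z' : C} (ρ : Ext S.E Z' A) (c : Z ⟶ Z') (X : EndedComplex (m + 1) A Z)
    (Y : EndedComplex (m + 1) A Z') (hX : Realizes S.s (pull S.E c ρ) X) (hY : Realizes S.s ρ Y) :
    ∃ (f : X.K ⟶ Y.K) (M : EndedComplex (m + 1) (X.K.X 1) Z')
      (e : ∀ i, i < m + 1 → (M.K.X (i + 1) ≅ X.K.X (i + 2) ⊞ Y.K.X (i + 1))),
      EndedComplex.IsOver X Y (𝟙 A) c f ∧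
      (M.left.inv ≫ M.K.d 0 1) ≫ (e 0 (by omega)).hom = biprod.lift (-X.K.d 1 2) (f.f 1) ∧
      (e m (by omega)).inv ≫ M.K.d (m + 1) (m + 2) ≫ M.right.hom =
        biprod.desc (X.right.hom ≫ c) (Y.K.d (m + 1) (m + 2) ≫ Y.right.hom) ∧
      (∀ (W : C) (g : X.K.X (m + 2) ⟶ W), X.K.d (m + 1) (m + 2) ≫ g = 0 →
        M.K.d m (m + 1) ≫ (e m (by omega)).hom ≫ biprod.fst ≫ g = 0) ∧
      Realizes S.s (push S.E (X.left.inv ≫ X.K.d 0 1) ρ) M := by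
  obtain ⟨f, M, k, hf, hl, hr, hM⟩ := S.good_lift ρ c X Y hX hY
  let e : ∀ i, i < m + 1 → (M.K.X (i + 1) ≅ X.K.X (i + 2) ⊞ Y.K.X (i + 1)) := k.isoMid
  let eL : M.K.X (m + 2) ≅ Y.K.X (m + 2) := k.isoLast
  have h1 : M.K.d 0 1 ≫ (e 0 (by omega)).hom = M.left.hom ≫ biprod.lift (-X.K.d 1 2) (f.f 1) := by
    have := k.d_first (by omega)
    rw [one_smul, ← hl] at this
    exact this
  have h2 : M.K.d (m + 1) (m + 2) ≫ eL.hom =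
      (e m (by omega)).hom ≫ biprod.desc (f.f (m + 2)) (Y.K.d (m + 1) (m + 2)) := by
    have := k.d_last m rfl
    rw [one_smul] at this
    refine this.trans ?_
    congr 2
    simp only [HomologicalComplex.XIsoOfEq_rfl, Iso.refl_hom]
    exact Category.comp_id _
  have hr' : M.right.hom = eL.hom ≫ Y.right.hom := congrArg Iso.hom hr
  refine ⟨f, M, e, hf, ?_, ?_, fun W g hg => ?_, hM⟩
  · rw [Category.assoc, h1, Iso.inv_hom_id_assoc]
  · rw [hr', reassoc_of% h2, Iso.inv_hom_id_assoc]
    ext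
    · simpa using hf.2
    · simp
  -- For `m = 0` the differential in question is the first one of the cone, otherwise a middle one.
  -- In both cases its `X`-component is minus the last differential of `X`, on the summand `Xₘ₊₁`
  -- when there are two, and this is killed by `g`.
  · cases m with
    | zero =>
      rw [reassoc_of% h1]
      simp [hg]
    | succ j =>
      have h3 : M.K.d (j + 1) (j + 2) ≫ (e (j + 1) (by omega)).hom = (e j (by omega)).hom ≫
          biprod.desc (biprod.lift (-X.K.d (j + 2) (j + 3)) (f.f (j + 2)))
            (biprod.lift 0 (Y.K.d (j + 1) (j + 2))) := by
        have := k.d_mid j (by omega)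
        rw [one_smul, one_smul] at this
        exact this
      rw [reassoc_of% h3, biprod.desc_eq]
      simp [hg]

/-- The axiom (EA2ᵒᵖ), with the outer differentials of the mapping cocone made explicit. -/
theorem exists_good_lift_op {A A' Z : C} (ρ : Ext S.E Z A) (a : A ⟶ A')
    (X : EndedComplex (m + 1) A Z) (Y : EndedComplex (m + 1) A' Z) (hX : Realizes S.s ρ X)
    (hY : Realizes S.s (push S.E a ρ) Y) :
    ∃ (f : X.K ⟶ Y.K) (M : EndedComplex (m + 1) A (Y.K.X (m + 1)))
      (e : ∀ i, i < m + 1 → (M.K.X (i + 1) ≅ X.K.X (i + 1) ⊞ Y.K.X i)),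
      EndedComplex.IsOver X Y a (𝟙 Z) f ∧
      (M.left.inv ≫ M.K.d 0 1) ≫ (e 0 (by omega)).hom =
        biprod.lift (X.left.inv ≫ X.K.d 0 1) (a ≫ Y.left.inv) ∧
      (e m (by omega)).inv ≫ M.K.d (m + 1) (m + 2) ≫ M.right.hom =
        biprod.desc (f.f (m + 1)) (-Y.K.d m (m + 1)) ∧
      (∀ (W : C) (g : W ⟶ Y.K.X 0), g ≫ Y.K.d 0 1 = 0 →
        g ≫ biprod.inr ≫ (e 0 (by omega)).inv ≫ M.K.d 1 2 = 0) ∧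
      Realizes S.s (pull S.E (Y.K.d (m + 1) (m + 2) ≫ Y.right.hom) ρ) M := by
  obtain ⟨f, M, k, hf, hl, hr, hM⟩ := S.good_lift_op ρ a X Y hX hY
  refine ⟨f, M, k.isoMid, hf, ?_, ?_, fun W g hg => ?_, hM⟩
  · have := k.d_first (by omega)
    rw [hl, Category.assoc, this]
    ext
    · simp
    · have h2 := hf.1
      rw [← Iso.eq_comp_inv] at h2
      simp [h2]
  · have := k.d_last m rfl
    rw [hr, this, Iso.inv_hom_id_assoc]
    simp
  · cases m with
    | zero =>
      have h3 := k.d_last 0 rfl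
      rw [← Iso.eq_comp_inv] at h3
      rw [h3]
      simp [reassoc_of% hg]
    | succ j =>
      have h3 := k.d_mid 0 (by omega)
      rw [← Iso.eq_comp_inv] at h3
      rw [h3]
      simp [biprod.lift_eq, reassoc_of% hg]

/-- Exactness of `Hom(B, A) ⟶ E(Z, A) ⟶ E(Xₙ, A)`. -/
theorem exists_push_eq {Z A B : C} (ρ : Ext S.E Z B) (X : EndedComplex (m + 1) B Z)
    (hX : Realizes S.s ρ X) (δ : Ext S.E Z A)
    (hδ : pull S.E (X.K.d (m + 1) (m + 2) ≫ X.right.hom) δ = 0) :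
    ∃ b : B ⟶ A, push S.E b ρ = δ := by
  -- The extension with components `ρ` and `δ`. Both die on the deflation of `X`, so the cocone of a
  -- good lift of the projection `B ⊞ A ⟶ B` realizes `0` and its inflation has a retraction `h`.
  let τ : Ext S.E Z (B ⊞ A) := push S.E biprod.inl ρ + push S.E biprod.inr δ
  have hτ : push S.E biprod.fst τ = ρ := by
    simp [τ, push_add, ← push_comp, push_id]
  obtain ⟨W, hW⟩ := S.exists_realizes τ
  obtain ⟨f, M, e, -, h1, -, -, hM⟩ := S.exists_good_lift_op τ biprod.fst W X hW (by rwa [hτ])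
  have hz : pull S.E (X.K.d (m + 1) (m + 2) ≫ X.right.hom) τ = 0 := by
    simp [τ, pull_add, ← push_pull, hδ, (S.exangle ρ X hX).pull_d]
  rw [hz] at hM
  obtain ⟨h, hh⟩ := (S.exangle _ _ hM).exact_from_first _ (𝟙 _) (push_zero _ _)
  rw [← Iso.eq_comp_inv] at h1
  rw [h1] at hh
  have key := congrArg (fun t => biprod.inr ≫ t ≫ biprod.snd) hh
  -- The part of the retraction passing through the inflation of `W`, projected to `A`. It kills
  -- `τ`, and it restricts to the identity of `A` because the other part passes through the
  -- projection to `B`. Evaluating `k` on `τ` expresses `δ` as a pushforward of `ρ`.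
  let k : B ⊞ A ⟶ A :=
    (W.left.inv ≫ W.K.d 0 1) ≫ biprod.inl ≫ (e 0 (by omega)).inv ≫ h ≫ biprod.snd
  have hk1 : biprod.inr ≫ k = 𝟙 A := by
    have : biprod.inr ≫ k = biprod.inr ≫ ((biprod.lift (W.left.inv ≫ W.K.d 0 1)
        (biprod.fst ≫ X.left.inv) ≫ (e 0 (by omega)).inv) ≫ h) ≫ biprod.snd := by
      simp [k, biprod.lift_eq]
    rw [this, key]
    simp
  have hk2 : push S.E k τ = 0 := by
    rw [push_comp, (S.exangle _ _ hW).push_d, push_zero]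
  refine ⟨-(biprod.inl ≫ k), ?_⟩
  rw [push_add, ← push_comp, ← push_comp, hk1, push_id] at hk2
  rw [neg_push]
  exact neg_eq_of_add_eq_zero_right hk2

/-- Exactness of `Hom(W, Z) ⟶ E(W, A) ⟶ E(W, X₁)`. -/
theorem exists_pull_eq {Z A W : C} (ρ : Ext S.E Z A) (X : EndedComplex (m + 1) A Z)
    (hX : Realizes S.s ρ X) (δ : Ext S.E W A)
    (hδ : push S.E (X.left.inv ≫ X.K.d 0 1) δ = 0) :
    ∃ c : W ⟶ Z, pull S.E c ρ = δ := by
  -- Dually, both components die on the inflation of `X`, so the cone of a good lift of `Z ⟶ Z ⊞ W`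
  -- realizes `0` and its deflation has a section.
  let τ : Ext S.E (Z ⊞ W) A := pull S.E biprod.fst ρ + pull S.E biprod.snd δ
  have hτ : pull S.E biprod.inl τ = ρ := by
    simp [τ, pull_add, ← pull_comp, pull_id]
  obtain ⟨Y, hY⟩ := S.exists_realizes τ
  obtain ⟨f, M, e, -, -, h1, -, hM⟩ := S.exists_good_lift τ biprod.inl X Y (by rwa [hτ]) hY
  have hz : push S.E (X.left.inv ≫ X.K.d 0 1) τ = 0 := by
    simp [τ, push_add, push_pull, hδ, (S.exangle ρ X hX).push_d]
  rw [hz] at hM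
  obtain ⟨h, hh⟩ := (S.exangle _ _ hM).exact_to_last _ (𝟙 _) (pull_zero _ _)
  rw [Iso.inv_comp_eq] at h1
  rw [h1] at hh
  have key := congrArg (fun t => biprod.inr ≫ t ≫ biprod.snd) hh
  let k : W ⟶ Z ⊞ W :=
    biprod.inr ≫ h ≫ (e m (by omega)).hom ≫ biprod.snd ≫ Y.K.d (m + 1) (m + 2) ≫ Y.right.hom
  have hk1 : k ≫ biprod.snd = 𝟙 W := by
    have : k ≫ biprod.snd = biprod.inr ≫ (h ≫ (e m (by omega)).hom ≫
        biprod.desc (X.right.hom ≫ biprod.inl) (Y.K.d (m + 1) (m + 2) ≫ Y.right.hom)) ≫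
          biprod.snd := by
      simp [k, biprod.desc_eq]
    rw [this, key]
    simp
  have hk2 : pull S.E k τ = 0 := by
    simp only [k, pull_comp, (S.exangle _ _ hY).pull_d, pull_zero]
  refine ⟨-(k ≫ biprod.fst), ?_⟩
  rw [pull_add, ← pull_comp, ← pull_comp, hk1, pull_id] at hk2
  rw [neg_pull]
  exact neg_eq_of_add_eq_zero_right hk2

/-- The identity of `Q` lifts through the deflation of a realization, and `δ` pulls back to zero
along that deflation. -/
theorem IsProjective.ext_eq_zero {Q A : C} (hQ : S.IsProjective Q) (δ : Ext S.E Q A) : δ = 0 := by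
  obtain ⟨X, hX⟩ := S.exists_realizes δ
  obtain ⟨b, hb⟩ := hQ δ X hX X.right.inv
  have h := congrArg (pull S.E b) (S.exangle δ X hX).pull_d
  rw [← pull_comp, reassoc_of% hb] at h
  simpa [pull_id] using h

theorem IsInjective.ext_eq_zero {J Z : C} (hJ : S.IsInjective J) (δ : Ext S.E Z J) : δ = 0 := by
  obtain ⟨X, hX⟩ := S.exists_realizes δ
  obtain ⟨b, hb⟩ := hJ δ X hX X.left.hom
  have h := congrArg (push S.E b) (S.exangle δ X hX).push_d
  rw [← push_comp, Category.assoc, hb] at h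
  simpa [push_id] using h

end NExangulated

/-! ### Extension-closed subcategories -/

section

variable {C : Type u} [Category.{v} C] [Preadditive C]

/-- A complex all of whose terms belong to `P`, as a complex in the full subcategory. -/
def liftComplex (P : ObjectProperty C) (K : CochainComplex C ℕ) (hK : ∀ i, P (K.X i)) :
    CochainComplex P.FullSubcategory ℕ where
  X i := ⟨K.X i, hK i⟩
  d i j := ObjectProperty.homMk (K.d i j)
  shape i j h := ObjectProperty.hom_ext _ (K.shape i j h)
  d_comp_d' i j k _ _ := ObjectProperty.hom_ext _ (K.d_comp_d i j k)

/-- A chain map between complexes in a full subcategory. -/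
def liftChainMap {P : ObjectProperty C} {K L : CochainComplex P.FullSubcategory ℕ}
    (f : (P.ι.mapHomologicalComplex _).obj K ⟶ (P.ι.mapHomologicalComplex _).obj L) : K ⟶ L where
  f i := ObjectProperty.homMk (f.f i)
  comm' i j _ := ObjectProperty.hom_ext _ (f.comm i j)

theorem isZero_of_isZero_obj {P : ObjectProperty C} {X : P.FullSubcategory} (h : IsZero X.obj) :
    IsZero X := by
  rw [IsZero.iff_id_eq_zero] at h ⊢
  exact ObjectProperty.hom_ext _ h

theorem isZero_obj {P : ObjectProperty C} {X : P.FullSubcategory} (h : IsZero X) :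
    IsZero X.obj :=
  P.ι.map_isZero h

/-- An `EndedComplex` in a full subcategory. -/
def EndedComplex.lift {P : ObjectProperty C} {n : ℕ} {A Z : P.FullSubcategory}
    (X : EndedComplex n A.obj Z.obj) (hX : ∀ i, P (X.K.X i)) : EndedComplex n A Z where
  K := liftComplex P X.K hX
  concentrated i hi := isZero_of_isZero_obj (X.concentrated i hi)
  left := P.isoMk X.left
  right := P.isoMk X.right

variable [HasFiniteBiproducts C]

theorem IsAdditiveSubcategory.hasFiniteBiproducts {P : ObjectProperty C}
    (hP : IsAdditiveSubcategory P) : HasFiniteBiproducts P.FullSubcategory := by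
  have : HasZeroObject C := hasZeroObject_of_hasFiniteBiproducts C
  obtain ⟨O, hO⟩ := this.zero
  have : HasZeroObject P.FullSubcategory :=
    ⟨⟨⟨O, hP.zero _ hO⟩, isZero_of_isZero_obj hO⟩⟩
  have : HasBinaryBiproducts P.FullSubcategory := ⟨fun A B =>
    HasBinaryBiproduct.mk
      { bicone :=
          { pt := ⟨A.obj ⊞ B.obj, hP.sum _ _ A.property B.property⟩
            fst := ObjectProperty.homMk biprod.fst
            snd := ObjectProperty.homMk biprod.snd
            inl := ObjectProperty.homMk biprod.inl
            inr := ObjectProperty.homMk biprod.inr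
            inl_fst := ObjectProperty.hom_ext _ biprod.inl_fst
            inl_snd := ObjectProperty.hom_ext _ biprod.inl_snd
            inr_fst := ObjectProperty.hom_ext _ biprod.inr_fst
            inr_snd := ObjectProperty.hom_ext _ biprod.inr_snd }
        isBilimit := isBinaryBilimitOfTotal _ (ObjectProperty.hom_ext _ biprod.total) }⟩
  have : HasFiniteProducts P.FullSubcategory := hasFiniteProducts_of_has_binary_and_terminal
  exact HasFiniteBiproducts.of_hasFiniteProducts

/-- The inclusion functor commutes with biproducts. -/
noncomputable def objBiprod {P : ObjectProperty C} [HasFiniteBiproducts P.FullSubcategory]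
    (A B : P.FullSubcategory) : (A ⊞ B).obj ≅ A.obj ⊞ B.obj where
  hom := biprod.lift (biprod.fst : A ⊞ B ⟶ A).hom (biprod.snd : A ⊞ B ⟶ B).hom
  inv := biprod.desc (biprod.inl : A ⟶ A ⊞ B).hom (biprod.inr : B ⟶ A ⊞ B).hom
  hom_inv_id := by
    rw [biprod.lift_desc]
    exact congrArg P.ι.map (biprod.total (X := A) (Y := B))
  inv_hom_id := by
    ext
    · simp only [Category.assoc, biprod.inl_desc_assoc, biprod.lift_fst, Category.id_comp,
        biprod.inl_fst]
      exact congrArg P.ι.map (biprod.inl_fst (X := A) (Y := B))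
    · simp only [Category.assoc, biprod.inl_desc_assoc, biprod.lift_snd, Category.id_comp,
        biprod.inl_snd]
      exact congrArg P.ι.map (biprod.inl_snd (X := A) (Y := B))
    · simp only [Category.assoc, biprod.inr_desc_assoc, biprod.lift_fst, Category.id_comp,
        biprod.inr_fst]
      exact congrArg P.ι.map (biprod.inr_fst (X := A) (Y := B))
    · simp only [Category.assoc, biprod.inr_desc_assoc, biprod.lift_snd, Category.id_comp,
        biprod.inr_snd]
      exact congrArg P.ι.map (biprod.inr_snd (X := A) (Y := B))

end

namespace NExangulated

section

variable {C : Type u} [Category.{v} C] [Preadditive C] [HasFiniteBiproducts C] {n : ℕ}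
  (S : NExangulated.{w} n C) {P : ObjectProperty C}

/-- A homotopy equivalence in `P` remains one in `C`, and `s δ` is a whole homotopy class there. So
the auxiliary complex in the definition of `TRealizes` can be taken to be `X` itself. -/
theorem tRealizes_iff {Z A : P.FullSubcategory} (δ : Ext S.E Z.obj A.obj)
    (X : EndedComplex n A Z) : S.TRealizes P δ X ↔ Realizes S.s δ (X.incl P) := by
  constructor
  · rintro ⟨Y, hY, f, g, hf, hg, ⟨h₁⟩, ⟨h₂⟩⟩
    refine Eq.trans hY (Quotient.sound ?_)
    let F := P.ι.mapHomologicalComplex (ComplexShape.up ℕ)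
    refine ⟨F.map g, F.map f, ⟨?_, ?_⟩, ⟨?_, ?_⟩,
      ⟨(Homotopy.ofEq (F.map_comp _ _).symm).trans
        ((P.ι.mapHomotopy h₂).trans (Homotopy.ofEq (F.map_id _)))⟩,
      ⟨(Homotopy.ofEq (F.map_comp _ _).symm).trans
        ((P.ι.mapHomotopy h₁).trans (Homotopy.ofEq (F.map_id _)))⟩⟩
    · exact congrArg P.ι.map hg.1
    · exact congrArg P.ι.map hg.2
    · exact congrArg P.ι.map hf.1
    · exact congrArg P.ι.map hf.2
  · intro h
    exact ⟨X, h, Setoid.refl (α := EndedComplex n A Z) X⟩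

theorem mem_tConflations_iff (K : CochainComplex P.FullSubcategory ℕ) :
    K ∈ S.TConflations P ↔ ∃ (Z A : P.FullSubcategory) (δ : Ext S.E Z.obj A.obj)
      (X : EndedComplex n A Z), X.K = K ∧ Realizes S.s δ (X.incl P) := by
  simp only [TConflations, Set.mem_ofPred_eq, tRealizes_iff]

theorem mem_tConflations {Z A : P.FullSubcategory} {δ : Ext S.E Z.obj A.obj}
    {X : EndedComplex n A Z} (h : Realizes S.s δ (X.incl P)) : X.K ∈ S.TConflations P :=
  (S.mem_tConflations_iff _).2 ⟨Z, A, δ, X, rfl, h⟩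

theorem prop_of_middle (hP : IsAdditiveSubcategory P) {Z A : C} (hZ : P Z) (hA : P A)
    (X : EndedComplex n A Z) (h : ∀ i, 1 ≤ i → i ≤ n → P (X.K.X i)) (i : ℕ) : P (X.K.X i) := by
  rcases Nat.lt_or_ge (n + 1) i with hi | hi
  · exact hP.zero _ (X.concentrated i hi)
  · rcases Nat.eq_zero_or_pos i with rfl | hi0
    · exact hP.of_iso X.left.symm hA
    · rcases Nat.lt_or_ge n i with hi' | hi'
      · obtain rfl : i = n + 1 := by omega
        exact hP.of_iso X.right.symm hZ
      · exact h i hi0 hi'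

theorem exists_realizes_incl (hP : IsAdditiveSubcategory P) (hext : S.IsExtensionClosed P)
    {Z A : P.FullSubcategory} (δ : Ext S.E Z.obj A.obj) :
    ∃ X : EndedComplex n A Z, Realizes S.s δ (X.incl P) := by
  obtain ⟨X, hX, h⟩ := hext _ _ Z.property A.property δ
  exact ⟨X.lift (prop_of_middle hP Z.property A.property X h), hX⟩

theorem exists_isOver {Z A Z' A' : P.FullSubcategory} {δ : Ext S.E Z.obj A.obj}
    {ρ : Ext S.E Z'.obj A'.obj} (a : A ⟶ A') (c : Z ⟶ Z') (h : push S.E a.hom δ = pull S.E c.hom ρ)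
    {X : EndedComplex n A Z} {Y : EndedComplex n A' Z'} (hX : Realizes S.s δ (X.incl P))
    (hY : Realizes S.s ρ (Y.incl P)) : ∃ f : X.K ⟶ Y.K, EndedComplex.IsOver X Y a c f := by
  obtain ⟨f, hf⟩ := S.lift δ ρ a.hom c.hom h _ _ hX hY
  exact ⟨liftChainMap f, ObjectProperty.hom_ext _ hf.1, ObjectProperty.hom_ext _ hf.2⟩

end

/-! ### `n`-exactness of the conflations in `P` -/

section

variable {C : Type u} [Category.{v} C] [Preadditive C] [HasFiniteBiproducts C] {m : ℕ}
  (S : NExangulated.{w} (m + 1) C) {P : ObjectProperty C}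

/-- Write `δ` as the pushforward of a projective cover extension `ρ ∈ E(Z, B)`. In the cocone `B ⟶
P₁ ⊞ A ⟶ ⋯` the morphism `(0, g)` is killed by the next differential, so it factors through `B ∈ Ω
P`, and such a morphism from `W` vanishes. -/
theorem eq_zero_of_comp_d (hproj : S.EnoughProjectives)
    (hOmega : ∀ X Y : C, P X → S.Omega P Y → ∀ f : X ⟶ Y, f = 0) {Z A : C} (hZ : P Z)
    (δ : Ext S.E Z A) (X : EndedComplex (m + 1) A Z) (hX : Realizes S.s δ X) {W : C} (hW : P W)
    (g : W ⟶ X.K.X 0) (hg : g ≫ X.K.d 0 1 = 0) : g = 0 := by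
  obtain ⟨B, ρ, R, hR, hRp⟩ := hproj Z
  obtain ⟨b, rfl⟩ := S.exists_push_eq ρ R hR δ
    (IsProjective.ext_eq_zero S (hRp (m + 1) (by omega) le_rfl) _)
  obtain ⟨f, M, e, -, h1, -, h2, hM⟩ := S.exists_good_lift_op ρ b R X hR hX
  obtain ⟨h, hh⟩ := (S.exangle _ _ hM).exact_to 0 (by omega) W
    (g ≫ biprod.inr ≫ (e 0 (by omega)).inv) (by simpa using h2 W g hg)
  have h0 : h ≫ M.left.hom = 0 := hOmega W B hW ⟨Z, hZ, ρ, R, hR, hRp⟩ _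
  have h0' : h = 0 := by rw [← cancel_mono M.left.hom, h0, zero_comp]
  rw [h0', zero_comp] at hh
  have := congrArg (· ≫ (e 0 (by omega)).hom ≫ biprod.snd) hh
  simpa using this.symm

/-- Dually, `δ` is a pullback of an extension `ρ ∈ E(D, A)` with injective middle terms, and `g`,
extended by zero to the last middle term of the cone, factors through `D ∈ Σ P`. -/
theorem eq_zero_of_d_comp (hinj : S.EnoughInjectives)
    (hSigma : ∀ X Y : C, S.Sigma P X → P Y → ∀ f : X ⟶ Y, f = 0) {Z A : C} (hA : P A)
    (δ : Ext S.E Z A) (X : EndedComplex (m + 1) A Z) (hX : Realizes S.s δ X) {W : C} (hW : P W)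
    (g : X.K.X (m + 2) ⟶ W) (hg : X.K.d (m + 1) (m + 2) ≫ g = 0) : g = 0 := by
  obtain ⟨D, ρ, R, hR, hRp⟩ := hinj A
  obtain ⟨c, rfl⟩ := S.exists_pull_eq ρ R hR δ
    (IsInjective.ext_eq_zero S (hRp 1 le_rfl (by omega)) _)
  obtain ⟨f, M, e, -, -, h1, h2, hM⟩ := S.exists_good_lift ρ c X R hX hR
  obtain ⟨h, hh⟩ := (S.exangle _ _ hM).exact_from m (by omega) W
    ((e m (by omega)).hom ≫ biprod.fst ≫ g) (h2 W g hg)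
  have h0 : M.right.inv ≫ h = 0 := hSigma D W ⟨A, hA, ρ, R, hR, hRp⟩ hW _
  have h0' : h = 0 := by rw [← cancel_epi M.right.inv, h0, comp_zero]
  rw [h0', comp_zero] at hh
  have := congrArg (fun t => biprod.inl ≫ (e m (by omega)).inv ≫ t) hh
  simpa using this.symm

/-- The standing hypotheses on the subcategory `P`, in the form in which they are used. -/
structure IsGood (P : ObjectProperty C) : Prop where
  add : IsAdditiveSubcategory P
  ext : S.IsExtensionClosed P
  exact : ∀ {Z A : P.FullSubcategory} {δ : Ext S.E Z.obj A.obj} {X : EndedComplex (m + 1) A Z},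
    Realizes S.s δ (X.incl P) → IsNExactSeq (m + 1) X.K

theorem isGood (hproj : S.EnoughProjectives) (hinj : S.EnoughInjectives)
    (hP : IsAdditiveSubcategory P) (hext : S.IsExtensionClosed P)
    (hSigma : ∀ X Y : C, S.Sigma P X → P Y → ∀ f : X ⟶ Y, f = 0)
    (hOmega : ∀ X Y : C, P X → S.Omega P Y → ∀ f : X ⟶ Y, f = 0) : S.IsGood P where
  add := hP
  ext := hext
  exact := by
    intro Z A δ X hX
    have hx := S.exangle _ _ hX
    refine ⟨X.concentrated, ⟨fun Y g hg => ?_, fun i hi Y g hg => ?_⟩,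
      ⟨fun Y g hg => ?_, fun i hi Y g hg => ?_⟩⟩
    · exact ObjectProperty.hom_ext _ (S.eq_zero_of_comp_d hproj hOmega Z.property δ _ hX
        Y.property g.hom (congrArg P.ι.map hg))
    · obtain ⟨h, hh⟩ := hx.exact_to i hi Y.obj g.hom (congrArg P.ι.map hg)
      exact ⟨ObjectProperty.homMk h, ObjectProperty.hom_ext _ hh⟩
    · exact ObjectProperty.hom_ext _ (S.eq_zero_of_d_comp hinj hSigma A.property δ _ hX
        Y.property g.hom (congrArg P.ι.map hg))
    · obtain ⟨h, hh⟩ := hx.exact_from i hi Y.obj g.hom (congrArg P.ι.map hg)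
      exact ⟨ObjectProperty.homMk h, ObjectProperty.hom_ext _ hh⟩

end

end NExangulated

/-! ### Invariance of conflations under weak isomorphisms -/

section

variable {C : Type u} [Category.{v} C] [Preadditive C] {m : ℕ}

theorem EndedComplex.IsOver.comp {A Z A' Z' A'' Z'' : C} {n : ℕ} {X : EndedComplex n A Z}
    {Y : EndedComplex n A' Z'} {W : EndedComplex n A'' Z''} {a : A ⟶ A'} {c : Z ⟶ Z'}
    {a' : A' ⟶ A''} {c' : Z' ⟶ Z''} {f : X.K ⟶ Y.K} {g : Y.K ⟶ W.K} (hf : X.IsOver Y a c f)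
    (hg : Y.IsOver W a' c' g) : X.IsOver W (a ≫ a') (c ≫ c') (f ≫ g) :=
  ⟨by rw [HomologicalComplex.comp_f, Category.assoc, hg.1, reassoc_of% hf.1],
    by rw [HomologicalComplex.comp_f, Category.assoc, hg.2, reassoc_of% hf.2]⟩

theorem EndedComplex.isOver_of_eq {A Z A' Z' : C} {n : ℕ} {X : EndedComplex n A Z}
    {Y : EndedComplex n A' Z'} (f : X.K ⟶ Y.K) :
    X.IsOver Y (X.left.inv ≫ f.f 0 ≫ Y.left.hom) (X.right.inv ≫ f.f (n + 1) ≫ Y.right.hom) f :=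
  ⟨by simp, by simp⟩

/-- Used to replace a chain map whose end components differ from identities by morphisms through the
outer differentials by one which is the identity on both ends. -/
theorem EndedComplex.IsOver.modify {A Z A' Z' : C} {X : EndedComplex (m + 1) A Z}
    {Y : EndedComplex (m + 1) A' Z'} {a b : A ⟶ A'} {c d : Z ⟶ Z'} {f : X.K ⟶ Y.K}
    (hf : X.IsOver Y a c f) (s : X.K.X 1 ⟶ A') (hs : (X.left.inv ≫ X.K.d 0 1) ≫ s = b - a)
    (t : Z ⟶ Y.K.X (m + 1)) (ht : t ≫ Y.K.d (m + 1) (m + 2) ≫ Y.right.hom = d - c) :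
    ∃ g : X.K ⟶ Y.K, X.IsOver Y b d g := by
  obtain ⟨g, h0, h1⟩ := exists_chainMap_modify (by omega) X.concentrated f (s ≫ Y.left.inv)
    (X.right.hom ≫ t)
  rw [Category.assoc, Iso.inv_comp_eq] at hs
  refine ⟨g, ?_, ?_⟩
  · rw [h0, Preadditive.add_comp, hf.1]
    simp [hs]
  · rw [h1, Preadditive.add_comp, hf.2]
    simp [ht]

/-- Between `n`-exact sequences with the same ends, morphisms in both directions which are the
identity of the ends are homotopy equivalences. -/
theorem EndedComplex.htpyEquiv_of_isOver {A Z : C} {X Y : EndedComplex (m + 1) A Z}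
    (hX : IsNExactSeq (m + 1) X.K) (hY : IsNExactSeq (m + 1) Y.K) {f : X.K ⟶ Y.K} {g : Y.K ⟶ X.K}
    (hf : X.IsOver Y (𝟙 A) (𝟙 Z) f) (hg : Y.IsOver X (𝟙 A) (𝟙 Z) g) : X.HtpyEquiv Y := by
  have key : ∀ {X : EndedComplex (m + 1) A Z} (hX : IsNExactSeq (m + 1) X.K) {h : X.K ⟶ X.K}
      (hh : X.IsOver X (𝟙 A ≫ 𝟙 A) (𝟙 Z ≫ 𝟙 Z) h), Nonempty (Homotopy h (𝟙 X.K)) := by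
    intro X hX h hh
    refine (isNull_of_zero hX.1 hX.rightExact hX.leftExact _ 0 (by omega) ?_).nonempty_homotopy
    have h1 := hh.1
    simp only [Category.comp_id] at h1
    rw [HomologicalComplex.sub_f_apply, HomologicalComplex.id_f, sub_eq_zero,
      ← cancel_mono X.left.hom, h1, Category.id_comp]
  exact ⟨f, g, hf, hg, key hX (hf.comp hg), key hY (hg.comp hf)⟩

/-- A complex, with its own outer terms as prescribed ends. -/
def EndedComplex.self {n : ℕ} (K : CochainComplex C ℕ) (hK : ConcentratedLE (n + 1) K) :
    EndedComplex n (K.X 0) (K.X (n + 1)) where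
  K := K
  concentrated := hK
  left := Iso.refl _
  right := Iso.refl _

end

namespace NExangulated

variable {C : Type u} [Category.{v} C] [Preadditive C] [HasFiniteBiproducts C] {m : ℕ}
  {S : NExangulated.{w} (m + 1) C} {P : ObjectProperty C}

section

variable (S)

theorem push_comp_hom {Z : C} {A A' A'' : P.FullSubcategory} (a : A ⟶ A') (b : A' ⟶ A'')
    (δ : Ext S.E Z A.obj) : push S.E (a ≫ b).hom δ = push S.E b.hom (push S.E a.hom δ) :=
  push_comp S.E a.hom b.hom δ

theorem pull_comp_hom {A : C} {Z Z' Z'' : P.FullSubcategory} (c : Z'' ⟶ Z') (d : Z' ⟶ Z)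
    (δ : Ext S.E Z.obj A) : pull S.E (c ≫ d).hom δ = pull S.E c.hom (pull S.E d.hom δ) :=
  pull_comp S.E c.hom d.hom δ

theorem push_id_hom {Z : C} {A : P.FullSubcategory} (δ : Ext S.E Z A.obj) :
    push S.E (𝟙 A : A ⟶ A).hom δ = δ :=
  push_id S.E δ

theorem pull_id_hom {A : C} {Z : P.FullSubcategory} (δ : Ext S.E Z.obj A) :
    pull S.E (𝟙 Z : Z ⟶ Z).hom δ = δ :=
  pull_id S.E δ

theorem add_push_hom {Z : C} {A A' : P.FullSubcategory} (a b : A ⟶ A') (δ : Ext S.E Z A.obj) :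
    push S.E (a + b).hom δ = push S.E a.hom δ + push S.E b.hom δ :=
  S.add_push a.hom b.hom δ

theorem add_pull_hom {A : C} {Z Z' : P.FullSubcategory} (c d : Z' ⟶ Z) (δ : Ext S.E Z.obj A) :
    pull S.E (c + d).hom δ = pull S.E c.hom δ + pull S.E d.hom δ :=
  S.add_pull c.hom d.hom δ

theorem sub_push_hom {Z : C} {A A' : P.FullSubcategory} (a b : A ⟶ A') (δ : Ext S.E Z A.obj) :
    push S.E (a - b).hom δ = push S.E a.hom δ - push S.E b.hom δ :=
  S.sub_push a.hom b.hom δ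

theorem sub_pull_hom {A : C} {Z Z' : P.FullSubcategory} (c d : Z' ⟶ Z) (δ : Ext S.E Z.obj A) :
    pull S.E (c - d).hom δ = pull S.E c.hom δ - pull S.E d.hom δ :=
  S.sub_pull c.hom d.hom δ

variable {S} {Z A W : P.FullSubcategory} {δ : Ext S.E Z.obj A.obj} {X : EndedComplex (m + 1) A Z}
  (hX : Realizes S.s δ (X.incl P))

include hX

theorem push_d_comp_hom (g : X.K.X 1 ⟶ W) :
    push S.E (X.left.inv ≫ X.K.d 0 1 ≫ g).hom δ = 0 := by
  have h : push S.E (X.left.inv ≫ X.K.d 0 1).hom δ = 0 := (S.exangle _ _ hX).push_d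
  rw [← Category.assoc, push_comp_hom, h, push_zero]

theorem pull_comp_d_hom (g : W ⟶ X.K.X (m + 1)) :
    pull S.E (g ≫ X.K.d (m + 1) (m + 2) ≫ X.right.hom).hom δ = 0 := by
  have h : pull S.E (X.K.d (m + 1) (m + 2) ≫ X.right.hom).hom δ = 0 := (S.exangle _ _ hX).pull_d
  rw [pull_comp_hom, h, pull_zero]

theorem exists_of_push_eq_zero (g : A ⟶ W) (hg : push S.E g.hom δ = 0) :
    ∃ h : X.K.X 1 ⟶ W, X.left.inv ≫ X.K.d 0 1 ≫ h = g := by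
  obtain ⟨h, hh⟩ := (S.exangle _ _ hX).exact_from_first _ g.hom hg
  exact ⟨ObjectProperty.homMk h, ObjectProperty.hom_ext _ ((Category.assoc _ _ _).symm.trans hh)⟩

theorem exists_of_pull_eq_zero (g : W ⟶ Z) (hg : pull S.E g.hom δ = 0) :
    ∃ h : W ⟶ X.K.X (m + 1), h ≫ X.K.d (m + 1) (m + 2) ≫ X.right.hom = g := by
  obtain ⟨h, hh⟩ := (S.exangle _ _ hX).exact_to_last _ g.hom hg
  exact ⟨ObjectProperty.homMk h, ObjectProperty.hom_ext _ hh⟩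

end

theorem IsGood.realizes_of_isOver (hG : S.IsGood P) {Z A : P.FullSubcategory}
    {δ : Ext S.E Z.obj A.obj} {X Y : EndedComplex (m + 1) A Z} (hX : Realizes S.s δ (X.incl P))
    (hY : IsNExactSeq (m + 1) Y.K) {f : X.K ⟶ Y.K} {g : Y.K ⟶ X.K}
    (hf : X.IsOver Y (𝟙 A) (𝟙 Z) f) (hg : Y.IsOver X (𝟙 A) (𝟙 Z) g) :
    Realizes S.s δ (Y.incl P) :=
  (S.tRealizes_iff δ Y).1 ⟨X, hX, EndedComplex.htpyEquiv_of_isOver hY (hG.exact hX) hg hf⟩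

/-- If an `n`-exact sequence `L` is equivalent to a conflation, then it is a conflation. -/
theorem IsGood.exists_realizes_of_equiv (hG : S.IsGood P) {Z A Z' A' : P.FullSubcategory}
    {δ : Ext S.E Z.obj A.obj} {X : EndedComplex (m + 1) A Z} (hX : Realizes S.s δ (X.incl P))
    (L : EndedComplex (m + 1) A' Z') (hL : IsNExactSeq (m + 1) L.K) (f : X.K ⟶ L.K)
    (g : L.K ⟶ X.K) (k : ℕ) (hk : k ≤ m + 2) (hfg : f.f k ≫ g.f k = 𝟙 _)
    (hgf : g.f k ≫ f.f k = 𝟙 _) : ∃ ε : Ext S.E Z'.obj A'.obj, Realizes S.s ε (L.incl P) := by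
  have hXe := hG.exact hX
  -- The two composites agree with the identities in degree `k`, hence up to homotopy. On the ends
  -- they therefore differ from identities only by morphisms through the outer differentials, which
  -- act trivially on `δ`.
  have nX : IsNull (f ≫ g - 𝟙 X.K) :=
    isNull_of_zero hXe.1 hXe.rightExact hXe.leftExact _ k hk (by simp [hfg])
  have nL : IsNull (g ≫ f - 𝟙 L.K) :=
    isNull_of_zero hL.1 hL.rightExact hL.leftExact _ k hk (by simp [hgf])
  obtain ⟨s, hs⟩ := nX.exists_zero
  obtain ⟨t, ht⟩ := nX.exists_last hXe.1
  obtain ⟨s', hs'⟩ := nL.exists_zero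
  obtain ⟨t', ht'⟩ := nL.exists_last hL.1
  simp only [HomologicalComplex.sub_f_apply, HomologicalComplex.comp_f, HomologicalComplex.id_f]
    at hs ht hs' ht'
  rw [sub_eq_iff_eq_add] at hs ht hs' ht'
  have hf := EndedComplex.isOver_of_eq f
  have hg := EndedComplex.isOver_of_eq g
  set a : A ⟶ A' := X.left.inv ≫ f.f 0 ≫ L.left.hom with ha
  set a' : A' ⟶ A := L.left.inv ≫ g.f 0 ≫ X.left.hom with ha'
  set c : Z ⟶ Z' := X.right.inv ≫ f.f (m + 1 + 1) ≫ L.right.hom with hc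
  set c' : Z' ⟶ Z := L.right.inv ≫ g.f (m + 1 + 1) ≫ X.right.hom with hc'
  have haa : a ≫ a' = 𝟙 A + (X.left.inv ≫ X.K.d 0 1) ≫ s ≫ X.left.hom := by
    simp [ha, ha', reassoc_of% hs, add_comm]
  have hcc : c ≫ c' = 𝟙 Z + (X.right.inv ≫ t) ≫ X.K.d (m + 1) (m + 2) ≫ X.right.hom := by
    simp [hc, hc', reassoc_of% ht, add_comm]
  have haa' : a' ≫ a = 𝟙 A' + (L.left.inv ≫ L.K.d 0 1) ≫ s' ≫ L.left.hom := by
    simp [ha, ha', reassoc_of% hs', add_comm]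
  have hcc' : c' ≫ c = 𝟙 Z' + (L.right.inv ≫ t') ≫ L.K.d (m + 1) (m + 2) ≫ L.right.hom := by
    simp [hc, hc', reassoc_of% ht', add_comm]
  have pa : push S.E a'.hom (push S.E a.hom δ) = δ := by
    rw [← push_comp_hom, haa, add_push_hom, Category.assoc, push_d_comp_hom hX, push_id_hom,
      add_zero]
  have pc : pull S.E c.hom (pull S.E c'.hom δ) = δ := by
    rw [← pull_comp_hom, hcc, add_pull_hom, pull_comp_d_hom hX, pull_id_hom, add_zero]
  -- The transport of `δ` to the ends of `L`. A realization `E` of `ε` admits lifts from and to `X`;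
  -- composed with `f` and `g` they give maps between `E` and `L`, to be corrected to identities on
  -- the ends.
  let ε : Ext S.E Z'.obj A'.obj := push S.E a.hom (pull S.E c'.hom δ)
  have paε : push S.E a'.hom ε = pull S.E c'.hom δ := by
    simp only [ε, push_pull, pa]
  have pcε : pull S.E c.hom ε = push S.E a.hom δ := by
    simp only [ε, ← push_pull, pc]
  obtain ⟨E, hE⟩ := S.exists_realizes_incl hG.add hG.ext ε
  obtain ⟨u, hu⟩ := S.exists_isOver a c pcε.symm hX hE
  obtain ⟨v, hv⟩ := S.exists_isOver a' c' paε hE hX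
  -- For maps out of `E` on the left, and into `E` on the right, the defect kills `ε` and so factors
  -- through the outer differentials of `E`. For `L` the homotopies `s'` and `t'` provide the
  -- corrections.
  obtain ⟨s₁, hs₁⟩ := exists_of_push_eq_zero hE (𝟙 A' - a' ≫ a) (by
    rw [sub_push_hom, push_id_hom, push_comp_hom, paε]
    exact sub_self ε)
  obtain ⟨t₁, ht₁⟩ := exists_of_pull_eq_zero hE (𝟙 Z' - c' ≫ c) (by
    rw [sub_pull_hom, pull_id_hom, pull_comp_hom, pcε, ← push_pull]
    exact sub_self ε)
  obtain ⟨p, hp⟩ := (hv.comp hf).modify (b := 𝟙 A') (d := 𝟙 Z') s₁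
    ((Category.assoc _ _ _).trans hs₁) (-(L.right.inv ≫ t')) (by rw [hcc']; simp)
  obtain ⟨q, hq⟩ := (hg.comp hu).modify (b := 𝟙 A') (d := 𝟙 Z') (-(s' ≫ L.left.hom))
    (by rw [haa']; simp) t₁ ht₁
  exact ⟨ε, hG.realizes_of_isOver hE hL hp hq⟩

theorem IsGood.exact_of_mem (hG : S.IsGood P) {K : CochainComplex P.FullSubcategory ℕ}
    (hK : K ∈ S.TConflations P) : IsNExactSeq (m + 1) K := by
  obtain ⟨Z, A, δ, X, rfl, hX⟩ := (S.mem_tConflations_iff K).1 hK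
  exact hG.exact hX

theorem IsGood.mem_of_equiv (hG : S.IsGood P) {K L : CochainComplex P.FullSubcategory ℕ}
    (hK : K ∈ S.TConflations P) (hL : IsNExactSeq (m + 1) L) (f : K ⟶ L)
    (g : L ⟶ K) (k : ℕ) (hk : k ≤ m + 2) (hfg : f.f k ≫ g.f k = 𝟙 _)
    (hgf : g.f k ≫ f.f k = 𝟙 _) : L ∈ S.TConflations P := by
  obtain ⟨Z, A, δ, X, rfl, hX⟩ := (S.mem_tConflations_iff K).1 hK
  obtain ⟨ε, hε⟩ := hG.exists_realizes_of_equiv hX (EndedComplex.self L hL.1) hL f g k hk hfg hgf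
  exact S.mem_tConflations hε

/-- A conflation realizes an extension of its ends, however these are identified. -/
theorem IsGood.exists_realizes_of_mem (hG : S.IsGood P) {Z A : P.FullSubcategory}
    (X : EndedComplex (m + 1) A Z) (hX : X.K ∈ S.TConflations P) :
    ∃ δ : Ext S.E Z.obj A.obj, Realizes S.s δ (X.incl P) := by
  obtain ⟨Z', A', δ, Y, hY, hYr⟩ := (S.mem_tConflations_iff X.K).1 hX
  exact hG.exists_realizes_of_equiv hYr X (hG.exact_of_mem hX) (eqToHom hY) (eqToHom hY.symm) 0
    (by omega) (by rw [← HomologicalComplex.comp_f]; simp)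
    (by rw [← HomologicalComplex.comp_f]; simp)

/-- It suffices to lift `q : Lₙ ⟶ Z` through `Kₙ`, that is, to see that `q` pulls `δ` back to zero.
If `W` realizes this pullback, the composite `W ⟶ K ⟶ L` factors through `Lₙ` in the last degree, so
it is null-homotopic. In degree zero this makes the inflation of `W` split, so the pullback is zero.
-/
theorem IsGood.exists_inverse_of_ends (hG : S.IsGood P) {K L : CochainComplex P.FullSubcategory ℕ}
    (f : K ⟶ L) (hK : K ∈ S.TConflations P) (hL : IsNExactSeq (m + 1) L) [IsIso (f.f (m + 2))]
    [IsIso (f.f 0)] : ∃ g : L ⟶ K, g.f (m + 2) = inv (f.f (m + 2)) := by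
  have hKe := hG.exact_of_mem hK
  obtain ⟨Z, A, δ, X, rfl, hX⟩ := (S.mem_tConflations_iff K).1 hK
  let q : L.X (m + 1) ⟶ Z := L.d (m + 1) (m + 2) ≫ inv (f.f (m + 2)) ≫ X.right.hom
  obtain ⟨W, hW⟩ := S.exists_realizes_incl hG.add hG.ext (pull S.E q.hom δ)
  obtain ⟨φ, hφ⟩ := S.exists_isOver (𝟙 A) q (push_id _ _) hW hX
  have hWe := hG.exact hW
  have h2 : φ.f (m + 2) = W.right.hom ≫ L.d (m + 1) (m + 2) ≫ inv (f.f (m + 2)) := by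
    rw [← cancel_mono X.right.hom]
    refine hφ.2.trans ?_
    simp [q]
  obtain ⟨s, hs⟩ := (isNull_of_degree hWe.1 hWe.rightExact hL.leftExact (φ ≫ f) (m + 2) le_rfl
    W.right.hom 0 (by
      rw [HomologicalComplex.comp_f, h2]
      simp)).exists_zero
  have h3 : 𝟙 A = (W.left.inv ≫ W.K.d 0 1) ≫ s ≫ inv (f.f 0) ≫ X.left.hom := by
    have := hφ.1
    rw [HomologicalComplex.comp_f] at hs
    rw [Category.assoc, ← reassoc_of% hs]
    simp [this]
  have h4 : pull S.E q.hom δ = 0 := by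
    rw [← push_id_hom S (pull S.E q.hom δ), h3, Category.assoc, push_d_comp_hom hW]
  obtain ⟨h, hh⟩ := exists_of_pull_eq_zero hX q h4
  obtain ⟨g, -, hg⟩ := exists_chainMap hL.1 hL.rightExact hKe.leftExact (m + 1) le_rfl
    h (inv (f.f (m + 2))) (by
      rw [← cancel_mono X.right.hom, Category.assoc, Category.assoc]
      exact hh.symm)
  exact ⟨g, hg⟩

/-- The dual argument: the pushforward of `δ` to `K₁` is realized by a sequence whose deflation
splits. -/
theorem IsGood.exists_inverse_of_ends' (hG : S.IsGood P)
    {K L : CochainComplex P.FullSubcategory ℕ} (f : K ⟶ L) (hK : IsNExactSeq (m + 1) K)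
    (hL : L ∈ S.TConflations P) [IsIso (f.f (m + 2))] [IsIso (f.f 0)] :
    ∃ g : L ⟶ K, g.f 0 = inv (f.f 0) := by
  have hLe := hG.exact_of_mem hL
  obtain ⟨Z, A, δ, X, rfl, hX⟩ := (S.mem_tConflations_iff L).1 hL
  let p : A ⟶ K.X 1 := X.left.inv ≫ inv (f.f 0) ≫ K.d 0 1
  obtain ⟨W, hW⟩ := S.exists_realizes_incl hG.add hG.ext (push S.E p.hom δ)
  obtain ⟨φ, hφ⟩ := S.exists_isOver p (𝟙 Z) (pull_id _ _).symm hX hW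
  have hWe := hG.exact hW
  have h2 : φ.f 0 = inv (f.f 0) ≫ K.d 0 1 ≫ W.left.inv := by
    rw [← cancel_mono W.left.hom]
    refine hφ.1.trans ?_
    simp [p]
  obtain ⟨t, ht⟩ := (isNull_of_degree hK.1 hK.rightExact hWe.leftExact (f ≫ φ) 0 (by omega)
    0 W.left.inv (by
      rw [HomologicalComplex.comp_f, h2]
      simp)).exists_last hK.1
  have h3 : 𝟙 Z = (X.right.inv ≫ inv (f.f (m + 2)) ≫ t) ≫
      W.K.d (m + 1) (m + 2) ≫ W.right.hom := by
    have := hφ.2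
    rw [HomologicalComplex.comp_f] at ht
    simp only [Category.assoc]
    rw [← reassoc_of% ht, this]
    simp
  have h4 : push S.E p.hom δ = 0 := by
    rw [← pull_id_hom S (push S.E p.hom δ), h3, pull_comp_d_hom hW]
  obtain ⟨h, hh⟩ := exists_of_push_eq_zero hX p h4
  obtain ⟨g, hg, -⟩ := exists_chainMap hLe.1 hLe.rightExact hK.leftExact 0 (by omega)
    (inv (f.f 0)) h (by
      rw [← cancel_epi X.left.inv]
      exact hh)
  exact ⟨g, hg⟩

/-- The class of conflations is closed under weak isomorphisms. -/
theorem IsGood.mem_iff_of_isWeakIso (hG : S.IsGood P) {K L : CochainComplex P.FullSubcategory ℕ}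
    (f : K ⟶ L) (hK : IsNExactSeq (m + 1) K) (hL : IsNExactSeq (m + 1) L)
    (hf : IsWeakIso (m + 1) f) : K ∈ S.TConflations P ↔ L ∈ S.TConflations P := by
  rcases hf with ⟨k, hk, h1, h2⟩ | ⟨h1, h2⟩
  · obtain ⟨g, hg, -⟩ := exists_chainMap hL.1 hL.rightExact hK.leftExact k hk (inv (f.f k))
      (inv (f.f (k + 1))) (by rw [IsIso.eq_inv_comp, ← Category.assoc, f.comm]; simp)
    have e1 : f.f k ≫ g.f k = 𝟙 _ := by simp [hg]
    have e2 : g.f k ≫ f.f k = 𝟙 _ := by simp [hg]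
    exact ⟨fun h => hG.mem_of_equiv h hL f g k (by omega) e1 e2,
      fun h => hG.mem_of_equiv h hK g f k (by omega) e2 e1⟩
  · constructor
    · intro h
      obtain ⟨g, hg⟩ := hG.exists_inverse_of_ends f h hL
      exact hG.mem_of_equiv h hL f g (m + 2) le_rfl (by simp [hg]) (by simp [hg])
    · intro h
      obtain ⟨g, hg⟩ := hG.exists_inverse_of_ends' f hK h
      exact hG.mem_of_equiv h hK g f 0 (by omega) (by simp [hg]) (by simp [hg])

theorem mem_of_isZero (S : NExangulated.{w} (m + 1) C) (K : CochainComplex P.FullSubcategory ℕ)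
    (hK : ∀ i, IsZero (K.X i)) : K ∈ S.TConflations P := by
  have hK' : ∀ i, IsZero (K.X i).obj := fun i => isZero_obj (hK i)
  refine S.mem_tConflations (X := EndedComplex.self K fun i _ => hK i)
    (S.zero_left _ _ (hK' _) _ ?_ fun i _ => hK' i)
  exact ⟨0, (hK' 0).eq_of_src _ _, (hK' 1).eq_of_src _ _⟩

end NExangulated

/-! ### Mapping cones -/

section

variable {C : Type u} [Category.{v} C]

/-- Stated for arbitrary morphisms so that composites in the full subcategory and in `C`, which
agree only after unfolding, are matched by unification. -/
theorem comp_comp_eq {A A' B B' D D' : C} {d : A ⟶ A'} {u' : A' ⟶ B'} {u : A ⟶ B} {o : D ≅ B}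
    {x : B ⟶ B'} {o' : B' ⟶ D'} {y : D ⟶ D'} (hy : y = o.hom ≫ x ≫ o') (h : d ≫ u' = u ≫ x) :
    d ≫ u' ≫ o' = (u ≫ o.inv) ≫ y := by
  rw [hy, Category.assoc, Iso.inv_hom_id_assoc, reassoc_of% h]

theorem comp_eq {A A' B B' D : C} {d : A ⟶ A'} {u' : A' ⟶ B'} {u : A ⟶ B} {o : D ≅ B}
    {x : B ⟶ B'} {y : D ⟶ B'} (hy : y = o.hom ≫ x) (h : d ≫ u' = u ≫ x) :
    d ≫ u' = (u ≫ o.inv) ≫ y := by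
  rw [hy, Category.assoc, Iso.inv_hom_id_assoc, h]

end

section MappingCones

variable {C : Type u} [Category.{v} C] [Preadditive C] {n : ℕ}

/-- The complex with the opposite differentials. -/
def negComplex (K : CochainComplex C ℕ) : CochainComplex C ℕ where
  X := K.X
  d i j := -K.d i j
  shape i j h := by rw [K.shape i j h, neg_zero]

theorem isNCokernel_negComplex {K : CochainComplex C ℕ} (hK : IsNCokernel n K) :
    IsNCokernel n (negComplex K) := by
  refine ⟨fun Y (g : K.X (n + 1) ⟶ Y) hg => hK.1 Y g ?_,
    fun i hi Y (g : K.X (i + 1) ⟶ Y) hg => ?_⟩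
  · have hg' : (-K.d n (n + 1)) ≫ g = 0 := hg
    rwa [Preadditive.neg_comp, neg_eq_zero] at hg'
  · have hg' : (-K.d i (i + 1)) ≫ g = 0 := hg
    rw [Preadditive.neg_comp, neg_eq_zero] at hg'
    obtain ⟨h, hh⟩ := hK.2 i hi Y g hg'
    exact ⟨-h, by
      change (-K.d (i + 1) (i + 2)) ≫ (-h) = g
      rw [Preadditive.neg_comp, Preadditive.comp_neg, neg_neg, hh]⟩

/-- The truncation of a complex to the degrees `0, …, n`. -/
theorem exists_truncation [HasZeroObject C] (n : ℕ) (Y : CochainComplex C ℕ) :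
    ∃ (Y' : CochainComplex C ℕ) (p : Y ⟶ Y'), ConcentratedLE n Y' ∧ ∀ i, i ≤ n → IsIso (p.f i) := by
  obtain ⟨O, hO⟩ := HasZeroObject.zero (C := C)
  -- Choosing mutually inverse `p` and `s` in low degrees, and zero maps above, lets the
  -- differential be written uniformly as `s ≫ d ≫ p`.
  have key : ∀ i, ∃ (Z : C) (p : Y.X i ⟶ Z) (s : Z ⟶ Y.X i),
      (i ≤ n → p ≫ s = 𝟙 _ ∧ s ≫ p = 𝟙 _) ∧ (n < i → IsZero Z) := by
    intro i
    by_cases h : i ≤ n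
    · exact ⟨Y.X i, 𝟙 _, 𝟙 _, fun _ => by simp, fun h' => by omega⟩
    · exact ⟨O, 0, 0, fun h' => absurd h' h, fun _ => hO⟩
  choose Z p s h₁ h₂ using key
  let Y' : CochainComplex C ℕ :=
    { X := Z
      d := fun i j => s i ≫ Y.d i j ≫ p j
      shape := fun i j h => by rw [Y.shape i j h, zero_comp, comp_zero]
      d_comp_d' := by
        rintro i _ _ rfl rfl
        by_cases h : i + 1 ≤ n
        · simp [reassoc_of% (h₁ (i + 1) h).1]
        · exact (h₂ (i + 1 + 1) (by omega)).eq_of_tgt _ _ }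
  refine ⟨Y', { f := p, comm' := ?_ }, h₂, fun i hi => ⟨s i, (h₁ i hi).1, (h₁ i hi).2⟩⟩
  rintro i _ rfl
  change p i ≫ s i ≫ Y.d i (i + 1) ≫ p (i + 1) = Y.d i (i + 1) ≫ p (i + 1)
  by_cases h : i ≤ n
  · rw [reassoc_of% (h₁ i h).1]
  · exact (h₂ (i + 1) (by omega)).eq_of_tgt _ _

theorem units_smul_hom {P : ObjectProperty C} (ε : ℤˣ) {A B : P.FullSubcategory} (f : A ⟶ B) :
    (ε • f).hom = ε • f.hom := by
  rcases Int.units_eq_one_or ε with rfl | rfl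
  · simp
  · rw [Units.neg_smul, Units.neg_smul, one_smul, one_smul]
    rfl

variable [HasFiniteBiproducts C]

/-- The cocone of `f`, with the opposite differentials, is the cone of `-f`. -/
noncomputable def MappingCone.negOfCocone {U V K : CochainComplex C ℕ} {f : U ⟶ V}
    (k : MappingCone n (-1) f K) : MappingCone n 1 (-f) (negComplex K) where
  concentrated := k.concentrated
  isoFirst := k.isoFirst
  isoMid := k.isoMid
  isoLast := k.isoLast
  d_first h := by
    change (-K.d 0 1) ≫ _ = _
    rw [Preadditive.neg_comp, k.d_first h, ← Preadditive.comp_neg]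
    congr 1
    ext <;> simp
  d_mid i h := by
    change (-K.d (i + 1) (i + 2)) ≫ _ = _
    rw [Preadditive.neg_comp, k.d_mid i h, ← Preadditive.comp_neg]
    congr 1
    ext <;> simp
  d_last i h := by
    change (-K.d (i + 1) (n + 1)) ≫ _ = _
    rw [Preadditive.neg_comp, k.d_last i h, ← Preadditive.comp_neg]
    congr 1
    ext <;> simp

/-- The mapping cone depends only on the degrees `0, …, n` of the target. -/
noncomputable def MappingCone.compRight {U V V' K : CochainComplex C ℕ} {f : U ⟶ V} {ε : ℤˣ}
    (k : MappingCone n ε f K) (p : V ⟶ V') (hp : ∀ i, i ≤ n → IsIso (p.f i)) :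
    MappingCone n ε (f ≫ p) K where
  concentrated := k.concentrated
  isoFirst := k.isoFirst
  isoMid i hi := k.isoMid i hi ≪≫
    biprod.mapIso (Iso.refl _) (@asIso _ _ _ _ (p.f i) (hp i (by omega)))
  isoLast := k.isoLast ≪≫ @asIso _ _ _ _ (p.f n) (hp n le_rfl)
  d_first h := by
    rw [Iso.trans_hom, ← Category.assoc, k.d_first h, Category.assoc]
    congr 1
    ext <;> simp
  d_mid i h := by
    rw [Iso.trans_hom, Iso.trans_hom, ← Category.assoc, k.d_mid i h, Category.assoc, Category.assoc]
    congr 1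
    ext <;> simp
  d_last i h := by
    subst h
    rw [Iso.trans_hom, Iso.trans_hom, ← Category.assoc, k.d_last i rfl, Category.assoc,
      Category.assoc]
    congr 1
    ext <;> simp

variable {P : ObjectProperty C} [HasFiniteBiproducts P.FullSubcategory]

theorem biprod_lift_hom {A B W : P.FullSubcategory} (a : W ⟶ A) (b : W ⟶ B) :
    (biprod.lift a b).hom = biprod.lift a.hom b.hom ≫ (objBiprod A B).inv := by
  rw [Iso.eq_comp_inv]
  ext
  · simp [objBiprod, ← ObjectProperty.FullSubcategory.comp_hom]
  · simp [objBiprod, ← ObjectProperty.FullSubcategory.comp_hom]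

theorem biprod_desc_hom {A B W : P.FullSubcategory} (a : A ⟶ W) (b : B ⟶ W) :
    (biprod.desc a b).hom = (objBiprod A B).hom ≫ biprod.desc a.hom b.hom := by
  rw [← Iso.inv_comp_eq]
  ext
  · simp [objBiprod, ← ObjectProperty.FullSubcategory.comp_hom]
  · simp [objBiprod, ← ObjectProperty.FullSubcategory.comp_hom]

theorem biprod_desc_comp {A B D D' : C} (a : A ⟶ D) (b : B ⟶ D) (c : D ⟶ D') :
    biprod.desc a b ≫ c = biprod.desc (a ≫ c) (b ≫ c) := by
  ext <;> simp

/-- Mapping cones in a full subcategory may be computed in the ambient category. -/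
noncomputable def MappingCone.lift {U V K : CochainComplex P.FullSubcategory ℕ} {f : U ⟶ V}
    {ε : ℤˣ} (k : MappingCone n ε ((P.ι.mapHomologicalComplex _).map f)
      ((P.ι.mapHomologicalComplex _).obj K)) : MappingCone n ε f K where
  concentrated i hi := isZero_of_isZero_obj (k.concentrated i hi)
  isoFirst := P.isoMk k.isoFirst
  isoMid i hi := P.isoMk (k.isoMid i hi ≪≫ (objBiprod _ _).symm)
  isoLast := P.isoMk k.isoLast
  d_first h := by
    refine ObjectProperty.hom_ext _ ?_
    have e : (-(ε • U.d 0 1)).hom = -(ε • (U.d 0 1).hom) :=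
      congrArg Neg.neg (units_smul_hom ε (U.d 0 1))
    change (K.d 0 1).hom ≫ (k.isoMid 0 h).hom ≫ (objBiprod _ _).inv =
      k.isoFirst.hom ≫ (biprod.lift (-(ε • U.d 0 1)) (f.f 0)).hom
    rw [biprod_lift_hom, e]
    exact (Category.assoc _ _ _).symm.trans
      ((congrArg (· ≫ (objBiprod _ _).inv) (k.d_first h)).trans (Category.assoc _ _ _))
  d_mid i h := by
    refine ObjectProperty.hom_ext _ ?_
    have e : (-(ε • U.d (i + 1) (i + 2))).hom = -(ε • (U.d (i + 1) (i + 2)).hom) :=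
      congrArg Neg.neg (units_smul_hom ε _)
    refine comp_comp_eq (o := objBiprod (U.X (i + 1)) (V.X i)) ?_ (k.d_mid i h)
    rw [biprod_desc_hom, biprod_lift_hom, biprod_lift_hom, e, units_smul_hom, ← biprod_desc_comp]
    rfl
  d_last i h := by
    subst h
    refine ObjectProperty.hom_ext _ ?_
    refine comp_eq (o := objBiprod (U.X (i + 1)) (V.X i)) ?_ (k.d_last i rfl)
    rw [biprod_desc_hom, units_smul_hom]
    rfl

end MappingCones

/-! ### Pushouts and pullbacks -/

namespace NExangulated

variable {C : Type u} [Category.{v} C] [Preadditive C] [HasFiniteBiproducts C] {m : ℕ}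
  {S : NExangulated.{w} (m + 1) C} {P : ObjectProperty C} [HasFiniteBiproducts P.FullSubcategory]

/-- The good lift from `X` to a realization of `φ_* δ` has a cocone realizing an extension of
objects of `P`, with middle terms in `P`; hence it is `n`-exact and in particular an `n`-cokernel.
The rest adjusts signs and truncates. -/
theorem IsGood.exists_pushout (hG : S.IsGood P) {X : CochainComplex P.FullSubcategory ℕ}
    (hX : X ∈ S.TConflations P) {W : P.FullSubcategory} (φ : X.X 0 ⟶ W) :
    ∃ (Y : CochainComplex P.FullSubcategory ℕ) (f : X ⟶ Y) (e : Y.X 0 ≅ W)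
      (K : CochainComplex P.FullSubcategory ℕ), ConcentratedLE (m + 1) Y ∧ f.f 0 ≫ e.hom = φ ∧
      Nonempty (MappingCone (m + 1) 1 f K) ∧ IsNCokernel (m + 1) K ∧
      AdmissibleMono (S.TConflations P) (Y.d 0 1) := by
  have hXe := hG.exact_of_mem hX
  obtain ⟨δ, hδ⟩ := hG.exists_realizes_of_mem (EndedComplex.self X hXe.1) hX
  obtain ⟨Y, hY⟩ := S.exists_realizes_incl hG.add hG.ext (push S.E φ.hom δ)
  obtain ⟨f, M, k, hf, -, -, hM⟩ := S.good_lift_op δ φ.hom _ _ hδ hY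
  have hMP : ∀ i, P (M.K.X i) := prop_of_middle hG.add (Y.K.X (m + 1)).property
    (X.X 0).property M fun i h1 h2 => by
      obtain ⟨j, rfl⟩ : ∃ j, i = j + 1 := ⟨i - 1, by omega⟩
      exact hG.add.of_iso (k.isoMid j (by omega)).symm
        (hG.add.sum _ _ (X.X (j + 1)).property (Y.K.X j).property)
  have hMe : IsNExactSeq (m + 1) (M.lift (Z := Y.K.X (m + 1)) (A := X.X 0) hMP).K := hG.exact hM
  obtain ⟨Y', p, hY', hp⟩ := exists_truncation (m + 1) Y.K
  have hp0 := hp 0 (by omega)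
  have hp1 := hp 1 (by omega)
  let F : X ⟶ Y.K := liftChainMap f
  have hF : F.f 0 ≫ Y.left.hom = φ :=
    ObjectProperty.hom_ext _ (hf.1.trans (Category.id_comp _))
  let k' : MappingCone (m + 1) (-1) F (M.lift (Z := Y.K.X (m + 1)) (A := X.X 0) hMP).K :=
    MappingCone.lift k
  -- A cocone of `F` becomes a cone only for `-F`; identifying `Y₀` with `W` through `-1` restores
  -- `φ` in degree zero.
  let ν : W ≅ W := ⟨-𝟙 W, -𝟙 W, by simp, by simp⟩
  refine ⟨Y', (-F) ≫ p, (asIso (p.f 0)).symm ≪≫ Y.left ≪≫ ν, _, hY', ?_,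
    ⟨k'.negOfCocone.compRight p hp⟩, isNCokernel_negComplex hMe.2.2, Y.K, S.mem_tConflations hY,
    ⟨Arrow.isoMk (asIso (p.f 0)) (asIso (p.f 1)) (by simp)⟩⟩
  simp [ν, hF]

/-- Here (EA2) already speaks of the cone of the truncated lift from a realization of `φ^* δ`, so no
change of sign is needed. -/
theorem IsGood.exists_pullback (hG : S.IsGood P) {X : CochainComplex P.FullSubcategory ℕ}
    (hX : X ∈ S.TConflations P) {W : P.FullSubcategory} (φ : W ⟶ X.X (m + 1 + 1)) :
    ∃ (Y : CochainComplex P.FullSubcategory ℕ) (f : Y ⟶ CochainComplex.truncate.obj X)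
      (e : Y.X (m + 1) ≅ W) (K : CochainComplex P.FullSubcategory ℕ),
      ConcentratedLE (m + 1) Y ∧ f.f (m + 1) = e.hom ≫ φ ∧
      Nonempty (MappingCone (m + 1) 1 f K) ∧ IsNKernel (m + 1) K ∧
      ∀ i, i + 1 = m + 1 → AdmissibleEpi (m + 1) (S.TConflations P) (Y.d i (m + 1)) := by
  have hXe := hG.exact_of_mem hX
  obtain ⟨δ, hδ⟩ := hG.exists_realizes_of_mem (EndedComplex.self X hXe.1) hX
  obtain ⟨Z, hZ⟩ := S.exists_realizes_incl hG.add hG.ext (pull S.E φ.hom δ)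
  obtain ⟨f, M, k, hf, -, -, hM⟩ := S.good_lift δ φ.hom _ _ hZ hδ
  have hMP : ∀ i, P (M.K.X i) := prop_of_middle hG.add (X.X (m + 2)).property
    (Z.K.X 1).property M fun i h1 h2 => by
      obtain ⟨j, rfl⟩ : ∃ j, i = j + 1 := ⟨i - 1, by omega⟩
      exact hG.add.of_iso (k.isoMid j (by omega)).symm
        (hG.add.sum _ _ (Z.K.X (j + 2)).property (X.X (j + 1)).property)
  have hMe : IsNExactSeq (m + 1) (M.lift (Z := X.X (m + 2)) (A := Z.K.X 1) hMP).K := hG.exact hM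
  let F : Z.K ⟶ X := liftChainMap f
  have hF : F.f (m + 2) = Z.right.hom ≫ φ :=
    ObjectProperty.hom_ext _ ((Category.comp_id _).symm.trans hf.2)
  let k' : MappingCone (m + 1) 1 (CochainComplex.truncate.map F)
      (M.lift (Z := X.X (m + 2)) (A := Z.K.X 1) hMP).K := MappingCone.lift k
  refine ⟨CochainComplex.truncate.obj Z.K, CochainComplex.truncate.map F, Z.right, _,
    fun i hi => Z.concentrated (i + 1) (by omega), hF, ⟨k'⟩, hMe.2.1, fun i hi => ?_⟩
  obtain rfl : i = m := by omega
  exact ⟨Z.K, S.mem_tConflations hZ, ⟨Iso.refl _⟩⟩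

end NExangulated

/-! ### Compositions of admissible morphisms -/

namespace NExangulated

variable {C : Type u} [Category.{v} C] [Preadditive C] [HasFiniteBiproducts C] {m : ℕ}

section

variable (S : NExangulated.{w} (m + 1) C)

theorem push_eq_zero_of_factor {Z A A' A'' : C} {δ : Ext S.E Z A} (a : A ⟶ A')
    (h : push S.E a δ = 0) {b : A ⟶ A''} (t : A' ⟶ A'') (hb : b = a ≫ t) : push S.E b δ = 0 := by
  rw [hb, push_comp, h, push_zero]

theorem pull_eq_zero_of_factor {Z Z' Z'' A : C} {δ : Ext S.E Z A} (c : Z' ⟶ Z)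
    (h : pull S.E c δ = 0) {d : Z'' ⟶ Z} (t : Z'' ⟶ Z') (hd : d = t ≫ c) : pull S.E d δ = 0 := by
  rw [hd, pull_comp, h, pull_zero]

/-- If the composite of the inflations of `⟨X, δ⟩` and `⟨Y, ρ⟩` is the inflation of `⟨X', θ⟩`, then
it is, up to morphisms in both directions, the inflation of an extension of `Vₘ₊₁ ⊞ Z`, where `V`
realizes the pushforward of `ρ` along `X₁ ⟶ X₂`. -/
theorem exists_comp_inflation {A Z Z' T : C} {δ : Ext S.E Z A} {X : EndedComplex (m + 1) A Z}
    (hX : Realizes S.s δ X) {ρ : Ext S.E T (X.K.X 1)} {Y : EndedComplex (m + 1) (X.K.X 1) T}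
    (hY : Realizes S.s ρ Y) {θ : Ext S.E Z' A} {X' : EndedComplex (m + 1) A Z'}
    (hX' : Realizes S.s θ X') (τ : Y.K.X 1 ≅ X'.K.X 1)
    (hτ : (X.left.inv ≫ X.K.d 0 1) ≫ (Y.left.inv ≫ Y.K.d 0 1) ≫ τ.hom =
      X'.left.inv ≫ X'.K.d 0 1) {V : EndedComplex (m + 1) (X.K.X 2) T}
    (hV : Realizes S.s (push S.E (X.K.d 1 2) ρ) V) :
    ∃ (σ : Ext S.E (V.K.X (m + 1)) (X.K.X 1))
      (M : EndedComplex (m + 1) (X.K.X 1) (V.K.X (m + 1)))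
      (e : ∀ i, i < m + 1 → (M.K.X (i + 1) ≅ Y.K.X (i + 1) ⊞ V.K.X i))
      (δ' : Ext S.E (V.K.X (m + 1) ⊞ Z) A),
      Realizes S.s σ M ∧
      (M.left.inv ≫ M.K.d 0 1) ≫ (e 0 (by omega)).hom =
        biprod.lift (Y.left.inv ≫ Y.K.d 0 1) (X.K.d 1 2 ≫ V.left.inv) ∧
      ∀ L : EndedComplex (m + 1) A (V.K.X (m + 1) ⊞ Z), Realizes S.s δ' L →
        ∃ (p : L.K.X 1 ⟶ Y.K.X 1) (q : Y.K.X 1 ⟶ L.K.X 1),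
          (L.left.inv ≫ L.K.d 0 1) ≫ p = (X.left.inv ≫ X.K.d 0 1) ≫ Y.left.inv ≫ Y.K.d 0 1 ∧
          ((X.left.inv ≫ X.K.d 0 1) ≫ Y.left.inv ≫ Y.K.d 0 1) ≫ q = L.left.inv ≫ L.K.d 0 1 := by
  -- The inflation of `X'` factors through that of `X`, which kills `δ`; so `δ = c^* θ`, and the
  -- cone `M'` of a good lift `X ⟶ X'` begins with `X₁ ⟶ X₂ ⊞ X'₁`.
  obtain ⟨c, rfl⟩ := S.exists_pull_eq θ X' hX' δ
    (S.push_eq_zero_of_factor _ (S.exangle _ _ hX).push_d ((Y.left.inv ≫ Y.K.d 0 1) ≫ τ.hom) hτ.symm)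
  obtain ⟨u, M', e', hu, h1', h2', -, hM'⟩ := S.exists_good_lift θ c X X' hX hX'
  obtain ⟨-, M, e, -, h1, -, -, hM⟩ := S.exists_good_lift_op ρ (X.K.d 1 2) Y V hY hV
  have hu1 : (X.left.inv ≫ X.K.d 0 1) ≫ u.f 1 = X'.left.inv ≫ X'.K.d 0 1 := by
    have h0 : X.left.inv ≫ u.f 0 = X'.left.inv := by
      rw [Iso.inv_comp_eq, Iso.eq_comp_inv, hu.1, Category.comp_id]
    rw [Category.assoc, ← u.comm, reassoc_of% h0]
  -- Both `u.f 1` and the inflation of `Y` extend the composite along `A ⟶ X₁`, so they differ by a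
  -- morphism through `X₂`. Hence the first morphisms of `M` and `M'` factor through each other, and
  -- their extensions are pullbacks of each other along `aa` and `bb`.
  obtain ⟨k, hk⟩ := (S.exangle _ _ hX).exact_from 0 (by omega) _
    ((Y.left.inv ≫ Y.K.d 0 1) ≫ τ.hom - u.f 1) (by
      rw [← cancel_epi X.left.inv, ← Category.assoc, Preadditive.comp_sub, hτ, hu1, sub_self,
        comp_zero])
  rw [← Iso.eq_comp_inv] at h1 h1'
  rw [Iso.inv_comp_eq] at h2'
  have hy : Y.left.inv ≫ Y.K.d 0 1 = (X.K.d 1 2 ≫ k + u.f 1) ≫ τ.inv := by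
    rw [hk]
    simp
  have hu' : u.f 1 = (Y.left.inv ≫ Y.K.d 0 1) ≫ τ.hom - X.K.d 1 2 ≫ k := by
    rw [hk]
    simp
  obtain ⟨bb, hbb⟩ := S.exists_pull_eq _ M hM _
    (S.push_eq_zero_of_factor _ (S.exangle _ _ hM').push_d
      ((e' 0 (by omega)).hom ≫ biprod.lift (biprod.desc (-(k ≫ τ.inv)) τ.inv)
        (biprod.desc (-V.left.inv) 0) ≫ (e 0 (by omega)).inv) (by
      rw [h1, h1', Category.assoc, Iso.inv_hom_id_assoc, ← Category.assoc, hy]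
      congr 1
      ext <;> simp))
  obtain ⟨aa, haa⟩ := S.exists_pull_eq _ M' hM' _
    (S.push_eq_zero_of_factor _ (S.exangle _ _ hM).push_d
      ((e 0 (by omega)).hom ≫ biprod.lift (biprod.desc 0 (-V.left.hom))
        (biprod.desc τ.hom (-(V.left.hom ≫ k))) ≫ (e' 0 (by omega)).inv) (by
      rw [h1, h1', Category.assoc, Iso.inv_hom_id_assoc, ← Category.assoc, hu']
      congr 1
      ext <;> simp [sub_eq_add_neg]))
  obtain ⟨h, hh⟩ := (S.exangle _ _ hM').exact_to_last _ (𝟙 _ - bb ≫ aa) (by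
    rw [S.sub_pull, pull_id, pull_comp, haa, hbb, sub_self])
  let x : Z' ⟶ Z := h ≫ (e' m (by omega)).hom ≫ biprod.fst ≫ X.right.hom
  have hid : 𝟙 Z' = bb ≫ aa + x ≫ c + (h ≫ (e' m (by omega)).hom ≫ biprod.snd) ≫
      X'.K.d (m + 1) (m + 2) ≫ X'.right.hom := by
    rw [h2', biprod.desc_eq] at hh
    rw [add_assoc, ← sub_eq_iff_eq_add', ← hh]
    simp [x]
  -- By `hid`, the identity of `Z'` is `bb ≫ aa + x ≫ c` up to a morphism through the deflation of
  -- `X'`, which kills `θ`. So `θ` is recovered from its pullback to `Vₘ₊₁ ⊞ Z`, and (R0) gives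
  -- lifts in both directions.
  have hθ : pull S.E (biprod.lift bb x) (pull S.E (biprod.desc aa c) θ) = θ := by
    have h3 := congrArg (fun t => pull S.E t θ) hid
    simp only [S.add_pull _ _ θ, pull_id] at h3
    rw [S.pull_eq_zero_of_factor _ (S.exangle _ _ hX').pull_d _ rfl, add_zero] at h3
    rw [← pull_comp, biprod.lift_desc, S.add_pull, ← h3]
  refine ⟨_, M, e, pull S.E (biprod.desc aa c) θ, hM, by rw [h1]; simp, fun L hL => ?_⟩
  obtain ⟨p, hp⟩ := S.lift _ θ (𝟙 A) (biprod.desc aa c) (push_id _ _) L X' hL hX'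
  obtain ⟨q, hq⟩ := S.lift θ _ (𝟙 A) (biprod.lift bb x) (by rw [push_id, hθ]) X' L hX' hL
  have hp0 : L.left.inv ≫ p.f 0 = X'.left.inv := by
    rw [Iso.inv_comp_eq, Iso.eq_comp_inv, hp.1, Category.comp_id]
  have hq0 : X'.left.inv ≫ q.f 0 = L.left.inv := by
    rw [Iso.inv_comp_eq, Iso.eq_comp_inv, hq.1, Category.comp_id]
  refine ⟨p.f 1 ≫ τ.inv, τ.hom ≫ q.f 1, ?_, ?_⟩
  · rw [← Category.assoc, Iso.comp_inv_eq, Category.assoc, ← p.comm, reassoc_of% hp0, ← hτ]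
    simp only [Category.assoc]
  · have h3 := hτ =≫ q.f 1
    rw [Category.assoc X'.left.inv, ← q.comm, reassoc_of% hq0] at h3
    rw [← h3]
    simp only [Category.assoc]

/-- If the composite of the deflations of `⟨Y, ρ⟩` and `⟨X, δ⟩` is the deflation of `⟨X', θ⟩`, then
it is, up to morphisms in both directions, the deflation of an extension by `V₁ ⊞ A`, where `V`
realizes the pullback of `ρ` along `Xₘ ⟶ Xₘ₊₁`. -/
theorem exists_comp_deflation {A A' T Z : C} {δ : Ext S.E Z A} {X : EndedComplex (m + 1) A Z}
    (hX : Realizes S.s δ X) {ρ : Ext S.E (X.K.X (m + 1)) T}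
    {Y : EndedComplex (m + 1) T (X.K.X (m + 1))}
    (hY : Realizes S.s ρ Y) {θ : Ext S.E Z A'} {X' : EndedComplex (m + 1) A' Z}
    (hX' : Realizes S.s θ X') (τ : X'.K.X (m + 1) ≅ Y.K.X (m + 1))
    (hτ : τ.hom ≫ (Y.K.d (m + 1) (m + 2) ≫ Y.right.hom) ≫ X.K.d (m + 1) (m + 2) ≫ X.right.hom =
      X'.K.d (m + 1) (m + 2) ≫ X'.right.hom) {V : EndedComplex (m + 1) T (X.K.X m)}
    (hV : Realizes S.s (pull S.E (X.K.d m (m + 1)) ρ) V) :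
    ∃ (σ : Ext S.E (X.K.X (m + 1)) (V.K.X 1))
      (M : EndedComplex (m + 1) (V.K.X 1) (X.K.X (m + 1)))
      (e : ∀ i, i < m + 1 → (M.K.X (i + 1) ≅ V.K.X (i + 2) ⊞ Y.K.X (i + 1)))
      (δ' : Ext S.E Z (V.K.X 1 ⊞ A)),
      Realizes S.s σ M ∧
      (e m (by omega)).inv ≫ M.K.d (m + 1) (m + 2) ≫ M.right.hom =
        biprod.desc (V.right.hom ≫ X.K.d m (m + 1)) (Y.K.d (m + 1) (m + 2) ≫ Y.right.hom) ∧
      ∀ L : EndedComplex (m + 1) (V.K.X 1 ⊞ A) Z, Realizes S.s δ' L →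
        ∃ (p : L.K.X (m + 1) ⟶ Y.K.X (m + 1)) (q : Y.K.X (m + 1) ⟶ L.K.X (m + 1)),
          p ≫ (Y.K.d (m + 1) (m + 2) ≫ Y.right.hom) ≫ X.K.d (m + 1) (m + 2) ≫ X.right.hom =
            L.K.d (m + 1) (m + 2) ≫ L.right.hom ∧
          q ≫ L.K.d (m + 1) (m + 2) ≫ L.right.hom =
            (Y.K.d (m + 1) (m + 2) ≫ Y.right.hom) ≫ X.K.d (m + 1) (m + 2) ≫ X.right.hom := by
  -- Dual to the case of inflations: the last morphisms of `M` and `M'` factor through each other,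
  -- and `θ` is recovered from its pushforward to `V₁ ⊞ A`.
  obtain ⟨c, rfl⟩ := S.exists_push_eq θ X' hX' δ
    (S.pull_eq_zero_of_factor _ (S.exangle _ _ hX).pull_d
      (τ.hom ≫ Y.K.d (m + 1) (m + 2) ≫ Y.right.hom) (hτ.symm.trans (Category.assoc _ _ _).symm))
  obtain ⟨u, M', e', hu, h1', h2', -, hM'⟩ := S.exists_good_lift_op θ c X' X hX' hX
  obtain ⟨-, M, e, -, -, h2, -, hM⟩ := S.exists_good_lift ρ (X.K.d m (m + 1)) V Y hV hY
  have hu1 : u.f (m + 1) ≫ X.K.d (m + 1) (m + 2) ≫ X.right.hom =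
      X'.K.d (m + 1) (m + 2) ≫ X'.right.hom := by
    have h0 : u.f (m + 2) ≫ X.right.hom = X'.right.hom := hu.2.trans (Category.comp_id _)
    rw [← Category.assoc, u.comm, Category.assoc, h0]
  obtain ⟨k, hk⟩ := (S.exangle _ _ hX).exact_to m (by omega) _
    (τ.hom ≫ (Y.K.d (m + 1) (m + 2) ≫ Y.right.hom) - u.f (m + 1)) (by
      rw [← cancel_mono X.right.hom, Category.assoc, Preadditive.sub_comp, Category.assoc, hτ, hu1,
        sub_self, zero_comp])
  rw [Iso.inv_comp_eq] at h2 h2'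
  rw [← Iso.eq_comp_inv] at h1'
  have hy : Y.K.d (m + 1) (m + 2) ≫ Y.right.hom =
      τ.inv ≫ (k ≫ X.K.d m (m + 1) + u.f (m + 1)) := by
    rw [hk]
    simp
  have hu' : u.f (m + 1) = τ.hom ≫ (Y.K.d (m + 1) (m + 2) ≫ Y.right.hom) -
      k ≫ X.K.d m (m + 1) := by
    rw [hk]
    simp
  obtain ⟨bb, hbb⟩ := S.exists_push_eq _ M hM _
    (S.pull_eq_zero_of_factor _ (S.exangle _ _ hM').pull_d
      ((e m (by omega)).hom ≫ biprod.desc (biprod.lift 0 (-V.right.hom))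
        (biprod.lift τ.inv (-(τ.inv ≫ k))) ≫ (e' m (by omega)).inv) (by
      rw [h2, h2', Category.assoc, Category.assoc, Iso.inv_hom_id_assoc, hy]
      congr 1
      ext <;> simp [add_comm]))
  obtain ⟨aa, haa⟩ := S.exists_push_eq _ M' hM' _
    (S.pull_eq_zero_of_factor _ (S.exangle _ _ hM).pull_d
      ((e' m (by omega)).hom ≫ biprod.desc (biprod.lift (-(k ≫ V.right.inv)) τ.hom)
        (biprod.lift (-V.right.inv) 0) ≫ (e m (by omega)).inv) (by
      rw [h2, h2', Category.assoc, Category.assoc, Iso.inv_hom_id_assoc, hu']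
      congr 1
      ext <;> simp [sub_eq_neg_add]))
  obtain ⟨h, hh⟩ := (S.exangle _ _ hM').exact_from_first _ (𝟙 _ - aa ≫ bb) (by
    rw [S.sub_push, push_id, push_comp, haa, hbb, sub_self])
  let x : A ⟶ A' := X.left.inv ≫ biprod.inr ≫ (e' 0 (by omega)).inv ≫ h
  have hid : 𝟙 A' = aa ≫ bb + c ≫ x + (X'.left.inv ≫ X'.K.d 0 1) ≫
      biprod.inl ≫ (e' 0 (by omega)).inv ≫ h := by
    rw [h1', biprod.lift_eq] at hh
    rw [add_assoc, ← sub_eq_iff_eq_add', ← hh]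
    simp [x, add_comm]
  have hθ : push S.E (biprod.desc bb x) (push S.E (biprod.lift aa c) θ) = θ := by
    have h3 := congrArg (fun t => push S.E t θ) hid
    simp only [S.add_push _ _ θ, push_id] at h3
    rw [S.push_eq_zero_of_factor _ (S.exangle _ _ hX').push_d _ rfl, add_zero] at h3
    rw [← push_comp, biprod.lift_desc, S.add_push, ← h3]
  refine ⟨_, M, e, push S.E (biprod.lift aa c) θ, hM, by rw [h2]; simp, fun L hL => ?_⟩
  obtain ⟨p, hp⟩ := S.lift _ θ (biprod.desc bb x) (𝟙 Z) (by rw [pull_id, hθ]) L X' hL hX'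
  obtain ⟨q, hq⟩ := S.lift θ _ (biprod.lift aa c) (𝟙 Z) (pull_id _ _).symm X' L hX' hL
  have hp0 : p.f (m + 2) ≫ X'.right.hom = L.right.hom := hp.2.trans (Category.comp_id _)
  have hq0 : q.f (m + 2) ≫ L.right.hom = X'.right.hom := hq.2.trans (Category.comp_id _)
  refine ⟨p.f (m + 1) ≫ τ.hom, τ.inv ≫ q.f (m + 1), ?_, ?_⟩
  · rw [Category.assoc, hτ, ← Category.assoc, p.comm, Category.assoc, hp0]
  · rw [Category.assoc, Iso.inv_comp_eq, hτ, ← Category.assoc, q.comm, Category.assoc, hq0]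

end

end NExangulated

/-! ### Compositions of admissible morphisms in extension-closed subcategories -/

theorem comp_assoc₆ {C : Type u} [Category.{v} C] {X₀ X₁ X₂ X₃ X₄ X₅ X₆ : C} (a : X₀ ⟶ X₁)
    (b : X₁ ⟶ X₂) (c : X₂ ⟶ X₃) (d : X₃ ⟶ X₄) (t : X₄ ⟶ X₅) (r : X₅ ⟶ X₆) :
    (a ≫ b) ≫ (c ≫ d) ≫ t ≫ r = (a ≫ b ≫ c ≫ d ≫ t) ≫ r := by
  simp only [Category.assoc]

theorem comp_assoc₆' {C : Type u} [Category.{v} C] {X₀ X₁ X₂ X₃ X₄ X₅ X₆ : C} (a : X₀ ⟶ X₁)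
    (b : X₁ ⟶ X₂) (c : X₂ ⟶ X₃) (d : X₃ ⟶ X₄) (t : X₄ ⟶ X₅) (r : X₅ ⟶ X₆) :
    (a ≫ b) ≫ (c ≫ d) ≫ t ≫ r = a ≫ b ≫ c ≫ d ≫ t ≫ r := by
  simp only [Category.assoc]

section

variable {C : Type u} [Category.{v} C] [Preadditive C] [HasFiniteBiproducts C]

theorem comp_mapIso_eq {A A' B D D' D'' T : C} {d : A' ⟶ B} {l : A' ≅ A} {x : A ⟶ D} {y : A ⟶ D'}
    {e : B ≅ D ⊞ D''} (v : D'' ≅ D') (h : (l.inv ≫ d) ≫ e.hom = biprod.lift x (y ≫ v.inv))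
    (o : D ⊞ D' ⟶ T) :
    d ≫ e.hom ≫ (biprod.mapIso (Iso.refl D) v).hom ≫ o = l.hom ≫ biprod.lift x y ≫ o := by
  rw [Category.assoc, Iso.inv_comp_eq] at h
  rw [reassoc_of% h]
  congr 1
  rw [← Category.assoc]
  congr 1
  ext <;> simp

theorem mapIso_comp_eq {A A' B D D' D'' T : C} {d : B ⟶ A'} {r : A' ⟶ A} {x : D' ⟶ A} {y : D ⟶ A}
    {e : B ≅ D'' ⊞ D} (v : D'' ≅ D') (h : e.inv ≫ d ≫ r = biprod.desc (v.hom ≫ x) y)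
    (o : T ⟶ D ⊞ D') :
    (((o ≫ (biprod.mapIso (Iso.refl D) v).inv) ≫ (biprod.braiding D'' D).inv) ≫ e.inv) ≫ d ≫ r =
      o ≫ biprod.desc y x := by
  rw [Category.assoc, h, Category.assoc, Category.assoc]
  congr 1
  ext <;> simp

end

namespace NExangulated

variable {C : Type u} [Category.{v} C] [Preadditive C] [HasFiniteBiproducts C] {m : ℕ}
  {S : NExangulated.{w} (m + 1) C} {P : ObjectProperty C}

theorem isInflation_hom {A B : P.FullSubcategory} {f : A ⟶ B}
    (hf : AdmissibleMono (S.TConflations P) f) : IsInflation S.s f.hom := by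
  obtain ⟨K, hK, ⟨j⟩⟩ := hf
  obtain ⟨Z, A', δ, X, rfl, hX⟩ := (S.mem_tConflations_iff K).1 hK
  exact ⟨Z.obj, A'.obj, δ, X.incl P, hX, ⟨P.ι.mapArrow.mapIso j⟩⟩

theorem isDeflation_hom {A B : P.FullSubcategory} {f : A ⟶ B}
    (hf : AdmissibleEpi (m + 1) (S.TConflations P) f) : IsDeflation S.s f.hom := by
  obtain ⟨K, hK, ⟨j⟩⟩ := hf
  obtain ⟨Z, A', δ, X, rfl, hX⟩ := (S.mem_tConflations_iff K).1 hK
  exact ⟨Z.obj, A'.obj, δ, X.incl P, hX, ⟨P.ι.mapArrow.mapIso j⟩⟩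

/-- Allows the first end to be prescribed up to isomorphism, so that consecutive conflations meet in
literally the same object, as `exists_comp_inflation` requires. -/
theorem IsGood.exists_realizes_of_admissibleMono (hG : S.IsGood P) {A A' B : P.FullSubcategory}
    {f : A ⟶ B} (hf : AdmissibleMono (S.TConflations P) f) (α : A' ≅ A) :
    ∃ (Z : P.FullSubcategory) (δ : Ext S.E Z.obj A'.obj) (X : EndedComplex (m + 1) A' Z)
      (b : X.K.X 1 ≅ B), Realizes S.s δ (X.incl P) ∧
        X.left.inv ≫ X.K.d 0 1 ≫ b.hom = α.hom ≫ f := by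
  obtain ⟨K, hK, ⟨j⟩⟩ := hf
  let X : EndedComplex (m + 1) A' (K.X (m + 2)) :=
    { K := K
      concentrated := (hG.exact_of_mem hK).1
      left := Arrow.leftFunc.mapIso j ≪≫ α.symm
      right := Iso.refl _ }
  obtain ⟨δ, hδ⟩ := hG.exists_realizes_of_mem X hK
  have hw : j.hom.left ≫ f = K.d 0 1 ≫ j.hom.right := j.hom.w
  refine ⟨_, δ, X, Arrow.rightFunc.mapIso j, hδ, ?_⟩
  rw [Iso.inv_comp_eq]
  change K.d 0 1 ≫ j.hom.right = (j.hom.left ≫ α.inv) ≫ α.hom ≫ f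
  rw [Category.assoc, Iso.inv_hom_id_assoc, hw]

theorem IsGood.exists_realizes_of_admissibleEpi (hG : S.IsGood P) {B D D' : P.FullSubcategory}
    {f : B ⟶ D} (hf : AdmissibleEpi (m + 1) (S.TConflations P) f) (β : D ≅ D') :
    ∃ (A : P.FullSubcategory) (δ : Ext S.E D'.obj A.obj) (X : EndedComplex (m + 1) A D')
      (b : X.K.X (m + 1) ≅ B), Realizes S.s δ (X.incl P) ∧
        X.K.d (m + 1) (m + 2) ≫ X.right.hom = b.hom ≫ f ≫ β.hom := by
  obtain ⟨K, hK, ⟨j⟩⟩ := hf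
  let X : EndedComplex (m + 1) (K.X 0) D' :=
    { K := K
      concentrated := (hG.exact_of_mem hK).1
      left := Iso.refl _
      right := Arrow.rightFunc.mapIso j ≪≫ β }
  obtain ⟨δ, hδ⟩ := hG.exists_realizes_of_mem X hK
  have hw : j.hom.left ≫ f = K.d (m + 1) (m + 2) ≫ j.hom.right := j.hom.w
  refine ⟨_, δ, X, Arrow.leftFunc.mapIso j, hδ, ?_⟩
  change K.d (m + 1) (m + 2) ≫ j.hom.right ≫ β.hom = j.hom.left ≫ f ≫ β.hom
  rw [← reassoc_of% hw]

variable [HasFiniteBiproducts P.FullSubcategory]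

theorem IsGood.admissibleMono_comp (hG : S.IsGood P) {A B D : P.FullSubcategory} (f : A ⟶ B)
    (g : B ⟶ D) (hf : AdmissibleMono (S.TConflations P) f)
    (hg : AdmissibleMono (S.TConflations P) g) : AdmissibleMono (S.TConflations P) (f ≫ g) := by
  obtain ⟨Z', A', θ, X', hX', ⟨j⟩⟩ :=
    S.comp_inflation f.hom g.hom (isInflation_hom hf) (isInflation_hom hg)
  have hj : j.hom.left ≫ f.hom ≫ g.hom = X'.K.d 0 1 ≫ j.hom.right := j.hom.w
  let r : X'.K.X 1 ≅ D.obj := Arrow.rightFunc.mapIso j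
  let l : X'.K.X 0 ≅ A.obj := Arrow.leftFunc.mapIso j
  -- The last term and most middle terms of `X'` are not controlled, but its first end is isomorphic
  -- to `A`, hence lies in `P`.
  let A₀ : P.FullSubcategory := ⟨A', hG.add.of_iso (l.symm ≪≫ X'.left) A.property⟩
  let α : A₀ ≅ A := P.isoMk (X'.left.symm ≪≫ l)
  obtain ⟨Z, δ, X, b, hX, hb⟩ := hG.exists_realizes_of_admissibleMono hf α
  obtain ⟨T, ρ, Y, t, hY, ht⟩ := hG.exists_realizes_of_admissibleMono hg b
  obtain ⟨V, hV⟩ := S.exists_realizes_incl hG.add hG.ext (push S.E (X.K.d 1 2).hom ρ)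
  let τ : (Y.K.X 1).obj ≅ X'.K.X 1 := P.ι.mapIso t ≪≫ r.symm
  obtain ⟨σ, M, e, δ', hM, he, hL⟩ := S.exists_comp_inflation hX hY hX' τ (by
    have h1 : X.left.inv ≫ X.K.d 0 1 ≫ Y.left.inv ≫ Y.K.d 0 1 ≫ t.hom = α.hom ≫ f ≫ g := by
      rw [ht, reassoc_of% hb]
    have h2 : (α.hom ≫ f ≫ g).hom ≫ r.inv = X'.left.inv ≫ X'.K.d 0 1 := by
      rw [Iso.comp_inv_eq, Category.assoc]
      exact (Category.assoc _ _ _).trans (congrArg (X'.left.inv ≫ ·) hj)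
    exact (comp_assoc₆ X.left.inv.hom (X.K.d 0 1).hom Y.left.inv.hom (Y.K.d 0 1).hom t.hom.hom
      r.inv).trans ((congrArg (fun s : A₀ ⟶ D => s.hom ≫ r.inv) h1).trans h2)) hV
  have hMP : ∀ i, P (M.K.X i) := prop_of_middle hG.add (V.K.X (m + 1)).property
    (X.K.X 1).property M fun i h1 h2 => by
      obtain ⟨j, rfl⟩ : ∃ j, i = j + 1 := ⟨i - 1, by omega⟩
      exact hG.add.of_iso (e j (by omega)).symm
        (hG.add.sum _ _ (Y.K.X (j + 1)).property (V.K.X j).property)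
  let M₀ : EndedComplex (m + 1) (X.K.X 1) (V.K.X (m + 1)) := M.lift hMP
  let w : M₀.K.X 1 ≅ Y.K.X 1 ⊞ X.K.X 2 := P.isoMk (e 0 (by omega) ≪≫
    biprod.mapIso (Iso.refl _) (P.ι.mapIso V.left) ≪≫ (objBiprod (Y.K.X 1) (X.K.X 2)).symm)
  -- `M₀` begins with `X₁ ⟶ Y₁ ⊞ X₂`, with components the inflation of `Y` and the differential of
  -- `X`; this is the input for splicing, and `N` begins with `f ≫ g`.
  obtain ⟨N, hN, a, d, had⟩ := exists_splice (hG.exact hX) (M := M₀.K) (hG.exact hM)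
    (Y.left.inv ≫ Y.K.d 0 1) M₀.left w (by
      exact ObjectProperty.hom_ext _ ((comp_mapIso_eq _ he _).trans
        (congrArg (M.left.hom ≫ ·) (biprod_lift_hom _ _).symm)))
  let Z₀ : P.FullSubcategory :=
    ⟨(V.K.X (m + 1)).obj ⊞ Z.obj, hG.add.sum _ _ (V.K.X (m + 1)).property Z.property⟩
  obtain ⟨L, hLr⟩ := S.exists_realizes_incl (A := A₀) (Z := Z₀) hG.add hG.ext δ'
  obtain ⟨p, q, hp, hq⟩ := hL _ hLr
  let p₀ : L.K.X 1 ⟶ Y.K.X 1 := ObjectProperty.homMk p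
  let q₀ : Y.K.X 1 ⟶ L.K.X 1 := ObjectProperty.homMk q
  have hp₀ : (L.left.inv ≫ L.K.d 0 1) ≫ p₀ =
      (X.left.inv ≫ X.K.d 0 1) ≫ Y.left.inv ≫ Y.K.d 0 1 := ObjectProperty.hom_ext _ hp
  have hq₀ : ((X.left.inv ≫ X.K.d 0 1) ≫ Y.left.inv ≫ Y.K.d 0 1) ≫ q₀ =
      L.left.inv ≫ L.K.d 0 1 := ObjectProperty.hom_ext _ hq
  have hLe := hG.exact (X := L) hLr
  -- The last terms of `L` and `N` need not be identified: chain maps inverse to each other in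
  -- degree zero are enough for `mem_of_equiv`.
  obtain ⟨F, hF, -⟩ := exists_chainMap hLe.1 hLe.rightExact hN.leftExact 0 (by omega)
    (L.left.hom ≫ X.left.inv ≫ a.inv) (p₀ ≫ d.inv) (by
      rw [← cancel_mono d.hom, ← cancel_epi L.left.inv]
      simpa [had] using hp₀)
  obtain ⟨G, hG', -⟩ := exists_chainMap hN.1 hN.rightExact hLe.leftExact 0 (by omega)
    (a.hom ≫ X.left.hom ≫ L.left.inv) (d.hom ≫ q₀) (by
      rw [reassoc_of% had, ← cancel_epi a.inv, ← cancel_epi X.left.inv]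
      simpa using hq₀)
  refine ⟨N, hG.mem_of_equiv (S.mem_tConflations (X := L) hLr) hN F G 0 (by omega) (by simp [hF, hG'])
    (by simp [hF, hG']), ⟨Arrow.isoMk (a ≪≫ X.left ≪≫ α) (d ≪≫ t) ?_⟩⟩
  have h3 : X.left.hom ≫ α.hom ≫ f = X.K.d 0 1 ≫ b.hom := by
    rw [← hb, Iso.hom_inv_id_assoc]
  simp [reassoc_of% had, ht, reassoc_of% h3]

theorem IsGood.admissibleEpi_comp (hG : S.IsGood P) {A B D : P.FullSubcategory} (f : A ⟶ B)
    (g : B ⟶ D) (hf : AdmissibleEpi (m + 1) (S.TConflations P) f)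
    (hg : AdmissibleEpi (m + 1) (S.TConflations P) g) :
    AdmissibleEpi (m + 1) (S.TConflations P) (f ≫ g) := by
  obtain ⟨Z', A', θ, X', hX', ⟨j⟩⟩ :=
    S.comp_deflation f.hom g.hom (isDeflation_hom hf) (isDeflation_hom hg)
  have hj : j.hom.left ≫ f.hom ≫ g.hom = X'.K.d (m + 1) (m + 2) ≫ j.hom.right := j.hom.w
  let r : X'.K.X (m + 2) ≅ D.obj := Arrow.rightFunc.mapIso j
  let l : X'.K.X (m + 1) ≅ A.obj := Arrow.leftFunc.mapIso j
  let D₀ : P.FullSubcategory := ⟨Z', hG.add.of_iso (r.symm ≪≫ X'.right) D.property⟩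
  let α : D ≅ D₀ := P.isoMk (r.symm ≪≫ X'.right)
  obtain ⟨A₁, δ, X, b, hX, hb⟩ := hG.exists_realizes_of_admissibleEpi hg α
  obtain ⟨T, ρ, Y, t, hY, ht⟩ := hG.exists_realizes_of_admissibleEpi hf b.symm
  obtain ⟨V, hV⟩ := S.exists_realizes_incl hG.add hG.ext (pull S.E (X.K.d m (m + 1)).hom ρ)
  let τ : X'.K.X (m + 1) ≅ (Y.K.X (m + 1)).obj := l ≪≫ P.ι.mapIso t.symm
  obtain ⟨σ, M, e, δ', hM, he, hL⟩ := S.exists_comp_deflation hX hY hX' τ (by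
    have h1 : t.inv ≫ Y.K.d (m + 1) (m + 2) ≫ Y.right.hom ≫ X.K.d (m + 1) (m + 2) ≫ X.right.hom =
        f ≫ g ≫ α.hom := by
      rw [reassoc_of% ht, hb]
      simp
    have h2 : l.hom ≫ (f ≫ g ≫ α.hom).hom = X'.K.d (m + 1) (m + 2) ≫ X'.right.hom := by
      have h3 : l.hom ≫ f.hom ≫ g.hom = X'.K.d (m + 1) (m + 2) ≫ r.hom := hj
      change l.hom ≫ f.hom ≫ g.hom ≫ r.inv ≫ X'.right.hom = _
      rw [reassoc_of% h3, Iso.hom_inv_id_assoc]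
    exact (comp_assoc₆' l.hom t.inv.hom (Y.K.d (m + 1) (m + 2)).hom Y.right.hom.hom
      (X.K.d (m + 1) (m + 2)).hom X.right.hom.hom).trans
        ((congrArg (fun s : A ⟶ D₀ => l.hom ≫ s.hom) h1).trans h2)) hV
  have hMP : ∀ i, P (M.K.X i) := prop_of_middle hG.add (X.K.X (m + 1)).property
    (V.K.X 1).property M fun i h1 h2 => by
      obtain ⟨j, rfl⟩ : ∃ j, i = j + 1 := ⟨i - 1, by omega⟩
      exact hG.add.of_iso (e j (by omega)).symm
        (hG.add.sum _ _ (V.K.X (j + 2)).property (Y.K.X (j + 1)).property)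
  let M₀ : EndedComplex (m + 1) (V.K.X 1) (X.K.X (m + 1)) := M.lift hMP
  let w : M₀.K.X (m + 1) ≅ Y.K.X (m + 1) ⊞ X.K.X m := P.isoMk (e m (by omega) ≪≫
    biprod.braiding _ _ ≪≫ biprod.mapIso (Iso.refl _) (P.ι.mapIso V.right) ≪≫
      (objBiprod (Y.K.X (m + 1)) (X.K.X m)).symm)
  -- Now `M₀` ends with `Yₘ₊₁ ⊞ Xₘ ⟶ Xₘ₊₁`, up to the order of the summands, and the comparison with
  -- `L` is made in the last degree.
  obtain ⟨N, hN, a, d, had⟩ := exists_cosplice (hG.exact hX) (M := M₀.K) (hG.exact hM)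
    (Y.K.d (m + 1) (m + 2) ≫ Y.right.hom) M₀.right w
    (ObjectProperty.hom_ext _ ((mapIso_comp_eq _ he _).trans (biprod_desc_hom _ _).symm))
  let A₀ : P.FullSubcategory :=
    ⟨(V.K.X 1).obj ⊞ A₁.obj, hG.add.sum _ _ (V.K.X 1).property A₁.property⟩
  obtain ⟨L, hLr⟩ := S.exists_realizes_incl (A := A₀) (Z := D₀) hG.add hG.ext δ'
  obtain ⟨p, q, hp, hq⟩ := hL _ hLr
  let p₀ : L.K.X (m + 1) ⟶ Y.K.X (m + 1) := ObjectProperty.homMk p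
  let q₀ : Y.K.X (m + 1) ⟶ L.K.X (m + 1) := ObjectProperty.homMk q
  have hp₀ : p₀ ≫ (Y.K.d (m + 1) (m + 2) ≫ Y.right.hom) ≫ X.K.d (m + 1) (m + 2) ≫ X.right.hom =
      L.K.d (m + 1) (m + 2) ≫ L.right.hom := ObjectProperty.hom_ext _ hp
  have hq₀ : q₀ ≫ L.K.d (m + 1) (m + 2) ≫ L.right.hom =
      (Y.K.d (m + 1) (m + 2) ≫ Y.right.hom) ≫ X.K.d (m + 1) (m + 2) ≫ X.right.hom :=
    ObjectProperty.hom_ext _ hq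
  have hLe := hG.exact (X := L) hLr
  have had' : N.d (m + 1) (m + 2) = d.hom ≫ (Y.K.d (m + 1) (m + 2) ≫ Y.right.hom) ≫
      X.K.d (m + 1) (m + 2) ≫ a.inv := by
    rw [← cancel_mono a.hom, had]
    simp
  obtain ⟨F, -, hF⟩ := exists_chainMap hLe.1 hLe.rightExact hN.leftExact (m + 1) le_rfl
    (p₀ ≫ d.inv) (L.right.hom ≫ X.right.inv ≫ a.inv) (by
      rw [← reassoc_of% hp₀, had']
      simp)
  obtain ⟨G, -, hG'⟩ := exists_chainMap hN.1 hN.rightExact hLe.leftExact (m + 1) le_rfl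
    (d.hom ≫ q₀) (a.hom ≫ X.right.hom ≫ L.right.inv) (by
      rw [← cancel_mono L.right.hom, had']
      simp [hq₀])
  refine ⟨N, hG.mem_of_equiv (S.mem_tConflations (X := L) hLr) hN F G (m + 2) le_rfl
    (by simp [hF, hG']) (by simp [hF, hG']), ⟨Arrow.isoMk (d ≪≫ t) (a ≪≫ X.right ≪≫ α.symm) ?_⟩⟩
  have ht' : t.hom ≫ f = (Y.K.d (m + 1) (m + 2) ≫ Y.right.hom) ≫ b.hom := by
    rw [ht]
    simp
  have hb' : b.hom ≫ g = X.K.d (m + 1) (m + 2) ≫ X.right.hom ≫ α.inv := by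
    rw [← Category.assoc, hb]
    simp
  simp [had', reassoc_of% ht', hb']

end NExangulated
end
end NExang

/-! ### The main theorem -/

theorem theorem3p16 {C : Type u} [Category.{v} C] [Preadditive C] [HasFiniteBiproducts C]
    (n : ℕ) (hn : 0 < n) (S : NExang.NExangulated.{w} n C)
    (hKS : NExang.IsKrullSchmidt C)
    (hproj : S.EnoughProjectives) (hinj : S.EnoughInjectives)
    (P : ObjectProperty C) (hP : NExang.IsAdditiveSubcategory P) (hext : S.IsExtensionClosed P)
    (hSigma : ∀ X Y : C, S.Sigma P X → P Y → ∀ f : X ⟶ Y, f = 0)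
    (hOmega : ∀ X Y : C, P X → S.Omega P Y → ∀ f : X ⟶ Y, f = 0) :
    NExang.IsNExactCategory n P.FullSubcategory (S.TConflations P) := by
  obtain ⟨m, rfl⟩ : ∃ m, n = m + 1 := ⟨n - 1, by omega⟩
  have hG := S.isGood hproj hinj hP hext hSigma hOmega
  have := hP.hasFiniteBiproducts
  exact
    { exact := fun K hK => hG.exact_of_mem hK
      closed := fun K L f hK hL hf => hG.mem_iff_of_isWeakIso f hK hL hf
      zero_mem := fun K hK => NExang.NExangulated.mem_of_isZero S K hK
      comp_mono := fun f g hf hg => hG.admissibleMono_comp f g hf hg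
      comp_epi := fun f g hf hg => hG.admissibleEpi_comp f g hf hg
      pushout := fun X hX W φ => hG.exists_pushout hX φ
      pullback := fun X hX W φ => hG.exists_pullback hX φ }
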